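/- **Setting.** Let $d\in\{2,3\}$, $\Gamma=(0,1)^{d-1}\times\{0\}$, $\Omega_1=\Gamma\times(0,1)$, $\Omega_2=\Gamma\times(-1,0)$, $\Gamma_i=\partial\Omega_i\setminus\Gamma$, $t_f>0$. Let $\tau_1,\tau_2$ be conforming meshes of $\Omega_1,\Omega_2$, both consisting of triangles (tetrahedra if $d=3$) or both of quadrilaterals (parallelepipeds if $d=3$), inducing the same partition of $\Gamma$. Let $k\ge1$, let $U_i$ be the continuous functions on $\overline{\Omega_i}$ that vanish on $\Gamma_i$ and are on each element polynomials of degree at most $k$ (of degree at most $k$ in each coordinate for quadrilaterals or parallelepipeds), and let $U_\Gamma$ be the space of the same kind on the induced partition of $\Gamma$, with zero values on $\partial\Gamma$. Write $(\cdot,\cdot)$, $\|\cdot\|$ for the inner product and norm of $L^2(\Omega_i)$ and $(\cdot,\cdot)_\Gamma$, $\|\cdot\|_\Gamma$ for those of $L^2(\Gamma)$. Let $\nu_i>0$ and $b_{i,j}\in\mathbb R$ be constants, let $\boldsymbol s_i\in W^{1,\infty}(\Omega_i)^d$ have zero normal component on $\partial\Omega_i$, let $f_i(t)\in L^2(\Omega_i)$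 and $g_i(t)\in L^2(\Gamma)$ for $0<t\le t_f$, let $u_i^0\in L^2(\Omega_i)$, and put $L(v,w)=\int_{\Omega_i}\nu_i\nabla v\cdot\nabla w+\nabla\cdot(\boldsymbol s_i v)\,w\,dx$. Let $u_i:[0,t_f]\to U_i$ (continuous) and $F_i:(0,t_f]\to U_\Gamma$, $i=1,2$, solve the semi-discrete problem: for $0<t\le t_f$, $v_i\in U_i$, $\mu\in U_\Gamma$, $$(\dot u_i,v_i)=-L(u_i,v_i)-(F_i,v_i)_\Gamma+(f_i,v_i),\qquad (F_i,\mu)_\Gamma=(b_{i,1}u_1+b_{i,2}u_2-g_i,\mu)_\Gamma,\qquad (u_i(0),v_i)=(u_i^0,v_i).$$ **Method.** Let $q,k_s,r_1,r_2\ge0$ and $0\le n_s\le q+1$ be integers, $\theta_1<\dots<\theta_{n_s}\le1$, and $\mathbb D$ a real $n_s\times(k_s+1)$ matrix. Assume that the $n_s\times n_s$ matrix with entries $\psi_m(2\theta_j-1)$, $1\le j\le n_s$, $q-n_s<m\le q$, is nonsingular, where $\psi_0,\dots,\psi_q$ is an $L^2(-1,1)$-orthogonal basis of the polynomials of degree at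 most $q$ with $\deg\psi_m\le m$. For positive integers $N,M_1,M_2$ put $\Delta t=t_f/N$, $\Delta t_i=\Delta t/M_i$, $t^{w}=w\Delta t$, and on the coupling window $I^w=(t^{w-1},t^w)$, $1\le w\le N$, put $t_i^n=t^{w-1}+n\Delta t_i$, $I_i^n=(t_i^{n-1},t_i^n)$, $t_i^{n,k}=t_i^{n-1}+\theta_k\Delta t_i$. A DGiT solution from window $N_0\ge1$ on consists of side values $U_i^n\in U_i$ at the times $t_i^n$ (numbered on each window; $U_i^0$ is the last side value of the previous window, and indices below $0$ continue into earlier windows), of states $u_i^n$ that are polynomials in time of degree at most $q$ with values in $U_i$, and, for $N_0\le w\le N$, of $u_{\Gamma,i}^w,F_i^w\in\mathcal V(r_i)$, the polynomials in time of degree at most $r_i$ with values in $U_\Gamma$, such that on each window $N_0\le w\le N$, for $i=1,2$ and $1\le n\le M_i$, $$u_i^n(t_i^{n,k})=\sum_{l=1}^{k_s+1}\mathbb D_{k,l}U_i^{n+1-l},\quad 1\le k\le n_s,$$ $$(U_i^n,v(t_i^n))-\int_{I_i^n}(u_i^n,\dot v)\,dt=(U_i^{n-1},v(t_i^{n-1}))-\int_{I_i^n}L(u_i^n,v)+(F_i^w,v)_\Gamma-(f_i,v)\,dt$$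 for all polynomials $v$ in time of degree at most $q+1-n_s$ with values in $U_i$, and for all $\lambda\in\mathcal V(r_i)$ $$\int_{I^w}(u_{\Gamma,i}^w,\lambda)_\Gamma dt=\sum_{n=1}^{M_i}\int_{I_i^n}(u_i^n,\lambda)_\Gamma dt,\qquad \int_{I^w}(F_i^w,\lambda)_\Gamma dt=\int_{I^w}(b_{i,1}u_{\Gamma,1}^w+b_{i,2}u_{\Gamma,2}^w-g_i,\lambda)_\Gamma dt .$$ States and side values on the windows before $N_0$, and $U_i^0$ at the time $0$, are given. **Theorem ($L^2$-convergence).** Assume $u_i\in H^{q+1}(0,t_f;L^2(\Omega_i))$ and $u_i|_\Gamma,F_i\in H^{r_i+1}(0,t_f;L^2(\Gamma))$ for $i=1,2$. Let $N_0\ge1$, $p>0$ and $K$ be given. Then there are $C_h>0$ and $\delta>0$ (which may depend on all the data above, in particular on the mesh, the semi-discrete solution, $N_0$, $t_f$, $p$ and $K$, but not on $N$, $M_1$, $M_2$, $\Delta t$, $\Delta t_1$, $\Delta t_2$, the window or the DGiT solution) such that the following holds for all $N,M_1,M_2$ with $\Delta t\le\delta$. Suppose that the side conditions on the windows $w\ge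 N_0$ refer only to nonnegative times ($t_i^{n,k}\ge0$ and, if $n_s>0$, $t_i^{n-k_s}\ge0$), that they are consistent, $$\Delta t_i\sum_{k=1}^{n_s}\Big\|u_i(t_i^{n,k})-\sum_{l=1}^{k_s+1}\mathbb D_{k,l}u_i(t_i^{n+1-l})\Big\|^2\le K\,\Delta t_i^{2q+2}\int_{t_i^{n-k_s}}^{t_i^n}\sum_{m=0}^{q+1}\Big\|\frac{d^m u_i}{dt^m}\Big\|^2dt$$ for $i=1,2$, $1\le n\le M_i$ on every window $N_0\le w\le N$, and that a DGiT solution from window $N_0$ on has initialization errors $\big(\sum_i\|u_i(0)-U_i^0\|^2\big)^{1/2}\le K\Delta t^p$ at the time $0$ and, on each window $1\le w<N_0$, $$\Big(\sum_{i=1,2}\sum_{n=1}^{M_i}\|u_i(t_i^n)-U_i^n\|^2\Big)^{1/2}\le K\Delta t^p,\qquad \Big(\sum_{i=1,2}\sum_{n=1}^{M_i}\int_{I_i^n}\|u_i-u_i^n\|^2dt\Big)^{1/2}\le K\Delta t^p .$$ Then on each window $N_0\le w\le N$, for $i=1,2$ and $1\le n\le M_i$, $$\|u_i(t_i^n)-U_i^n\|\le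 C_h\Big(\Delta t^p+\sum_{j=1,2}\big(\Delta t_j^{q+1}+\Delta t^{r_j+1}\big)\Big),$$ $$\Big(\sum_{i=1,2}\sum_{n=1}^{M_i}\int_{I_i^n}\|u_i-u_i^n\|^2dt\Big)^{1/2}\le C_h\Big(\Delta t^p+\sum_{j=1,2}\big(\Delta t_j^{q+1}+\Delta t^{r_j+1}\big)\Big).$$ -/

import Mathlib

open MeasureTheory Set

noncomputable section

namespace DGiT

/-! ### Geometry

The space dimension is `d = n + 1`, and the last coordinate is transversal to the interface.
The two subdomains are indexed by `Fin 2`: the index `0` stands for `Ω₁ = Γ × (0,1)` and the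
index `1` for `Ω₂ = Γ × (-1,0)`. -/

/-- Lower end of the `j`-th edge of the box `Ω i`. -/
def lo {n : ℕ} (i : Fin 2) (j : Fin (n + 1)) : ℝ :=
  if i = 1 ∧ j = Fin.last n then -1 else 0

/-- Upper end of the `j`-th edge of the box `Ω i`. -/
def hi {n : ℕ} (i : Fin 2) (j : Fin (n + 1)) : ℝ :=
  if i = 1 ∧ j = Fin.last n then 0 else 1

/-- The open subdomain `Ω i` of `ℝ^(n+1)`. -/
def Ω (n : ℕ) (i : Fin 2) : Set (Fin (n + 1) → ℝ) :=
  {x | ∀ j, x j ∈ Ioo (lo i j) (hi i j)}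

/-- The interface, in its own coordinates: the open unit cube of `ℝ^n`. -/
def Gam (n : ℕ) : Set (Fin n → ℝ) := {y | ∀ j, y j ∈ Ioo (0 : ℝ) 1}

/-- The embedding `y ↦ (y, 0)` of the interface coordinates into `ℝ^(n+1)`. -/
def embed {n : ℕ} (y : Fin n → ℝ) : Fin (n + 1) → ℝ :=
  Fin.snoc (α := fun _ => ℝ) y 0

/-- The exterior boundary `∂Ω i \ Γ`. -/
def extBoundary (n : ℕ) (i : Fin 2) : Set (Fin (n + 1) → ℝ) :=
  frontier (Ω n i) \ (embed '' Gam n)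

/-- Restriction of a function to the interface. -/
def trace {n : ℕ} (v : (Fin (n + 1) → ℝ) → ℝ) : (Fin n → ℝ) → ℝ := fun y => v (embed y)

/-! ### Meshes and finite element spaces -/

/-- The two families of meshes: triangles / tetrahedra, and quadrilaterals / parallelepipeds. -/
inductive ElementKind
  | simplicial
  | tensor

/-- `E` is a nondegenerate closed simplex in `ℝ^d`. -/
def IsSimplex {d : ℕ} (E : Set (Fin d → ℝ)) : Prop :=
  ∃ a : Fin (d + 1) → Fin d → ℝ, AffineIndependent ℝ a ∧ E = convexHull ℝ (range a)

/-- `E` is a closed convex quadrilateral with four genuine vertices (used for `d = 2`). -/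
def IsQuadrilateral {d : ℕ} (E : Set (Fin d → ℝ)) : Prop :=
  ∃ a : Fin 4 → Fin d → ℝ, ConvexIndependent ℝ a ∧ E = convexHull ℝ (range a)

/-- `E` is a nondegenerate closed parallelepiped in `ℝ^d`. -/
def IsParallelepiped {d : ℕ} (E : Set (Fin d → ℝ)) : Prop :=
  ∃ (a : Fin d → ℝ) (e : Fin d → Fin d → ℝ), LinearIndependent ℝ e ∧
    E = (fun x => a + x) '' parallelepiped e

/-- The admissible elements of each kind. -/
def IsElement {d : ℕ} : ElementKind → Set (Fin d → ℝ) → Prop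
  | .simplicial, E => IsSimplex E
  | .tensor, E => if d = 2 then IsQuadrilateral E else IsParallelepiped E

/-- `τ` is a conforming mesh of `D`: finitely many elements of the given kind cover the closure
of `D`, and any two distinct elements meet in a common (possibly empty) face.  The faces of a
convex polytope are its convex extreme subsets, and an intersection of two elements is convex. -/
structure IsConformingMesh {d : ℕ} (κ : ElementKind) (D : Set (Fin d → ℝ))
    (τ : Set (Set (Fin d → ℝ))) : Prop where
  finite : τ.Finite
  element : ∀ E ∈ τ, IsElement κ E
  cover : ⋃₀ τ = closure D
  face : ∀ E ∈ τ, ∀ E' ∈ τ, E ≠ E' → IsExtreme ℝ E (E ∩ E')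

/-- The partition of the interface induced by a mesh: the traces of positive measure on the
hyperplane of the interface. -/
def interfaceMesh {n : ℕ} (τ : Set (Set (Fin (n + 1) → ℝ))) : Set (Set (Fin n → ℝ)) :=
  {S | ∃ E ∈ τ, S = embed ⁻¹' E ∧ (interior S).Nonempty}

/-- Local polynomials: total degree at most `k` on simplices, degree at most `k` in each
coordinate otherwise. -/
def localPoly {d : ℕ} (κ : ElementKind) (k : ℕ) : Submodule ℝ (MvPolynomial (Fin d) ℝ) :=
  match κ with
  | .simplicial => MvPolynomial.restrictTotalDegree (Fin d) ℝ k
  | .tensor => MvPolynomial.restrictDegree (Fin d) ℝ k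

/-- Continuous piecewise polynomials on the closure of `D` with respect to the mesh `τ` that
vanish on the part `B` of the boundary.  Functions on the closure of `D` are represented by their
extensions by zero. -/
def feSpace {d : ℕ} (κ : ElementKind) (k : ℕ) (D : Set (Fin d → ℝ))
    (τ : Set (Set (Fin d → ℝ))) (B : Set (Fin d → ℝ)) : Submodule ℝ ((Fin d → ℝ) → ℝ) where
  carrier := {v | ContinuousOn v (closure D) ∧
    (∀ E ∈ τ, ∃ P ∈ localPoly κ k, ∀ x ∈ E, v x = MvPolynomial.eval x P) ∧
    (∀ x ∈ B, v x = 0) ∧ ∀ x, x ∉ closure D → v x = 0}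
  zero_mem' := ⟨continuousOn_const, fun _ _ => ⟨0, Submodule.zero_mem _, by simp⟩,
    by simp, by simp⟩
  add_mem' := by
    rintro v w ⟨hv1, hv2, hv3, hv4⟩ ⟨hw1, hw2, hw3, hw4⟩
    refine ⟨hv1.add hw1, fun E hE => ?_, fun x hx => ?_, fun x hx => ?_⟩
    · obtain ⟨P, hP, hvP⟩ := hv2 E hE
      obtain ⟨Q, hQ, hwQ⟩ := hw2 E hE
      exact ⟨P + Q, Submodule.add_mem _ hP hQ, fun x hx => by simp [hvP x hx, hwQ x hx]⟩
    · simp [hv3 x hx, hw3 x hx]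
    · simp [hv4 x hx, hw4 x hx]
  smul_mem' := by
    rintro c v ⟨hv1, hv2, hv3, hv4⟩
    refine ⟨hv1.const_smul c, fun E hE => ?_, fun x hx => ?_, fun x hx => ?_⟩
    · obtain ⟨P, hP, hvP⟩ := hv2 E hE
      exact ⟨c • P, Submodule.smul_mem _ c hP, fun x hx => by simp [hvP x hx]⟩
    · simp [hv3 x hx]
    · simp [hv4 x hx]

/-- The spatial discretization: conforming meshes of the two subdomains, of one kind, that
induce the same partition of the interface, and the polynomial order `k ≥ 1`. -/
structure SpatialMesh (n : ℕ) where
  kind : ElementKind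
  k : ℕ
  one_le_k : 1 ≤ k
  τ : Fin 2 → Set (Set (Fin (n + 1) → ℝ))
  conforming : ∀ i, IsConformingMesh kind (Ω n i) (τ i)
  matching : interfaceMesh (τ 0) = interfaceMesh (τ 1)

/-- The finite element space `U_i`. -/
def SpatialMesh.U {n : ℕ} (S : SpatialMesh n) (i : Fin 2) :
    Submodule ℝ ((Fin (n + 1) → ℝ) → ℝ) :=
  feSpace S.kind S.k (Ω n i) (S.τ i) (extBoundary n i)

/-- The finite element trace space `U_Γ`. -/
def SpatialMesh.UΓ {n : ℕ} (S : SpatialMesh n) : Submodule ℝ ((Fin n → ℝ) → ℝ) :=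
  feSpace S.kind S.k (Gam n) (interfaceMesh (S.τ 0)) (frontier (Gam n))

/-! ### Inner products and bilinear forms -/

/-- The `L²(D)` inner product. -/
def ip {d : ℕ} (D : Set (Fin d → ℝ)) (v w : (Fin d → ℝ) → ℝ) : ℝ := ∫ x in D, v x * w x

/-- The `L²(D)` norm. -/
def nrm {d : ℕ} (D : Set (Fin d → ℝ)) (v : (Fin d → ℝ) → ℝ) : ℝ := √(ip D v v)

/-- The partial derivative `∂_j v`. -/
def pderiv {d : ℕ} (j : Fin d) (v : (Fin d → ℝ) → ℝ) (x : Fin d → ℝ) : ℝ :=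
  fderiv ℝ v x (Pi.single j 1)

/-- The data of the model problem
`∂ₜ u_i = ∇·(ν_i ∇u_i - s_i u_i) + f_i` in `Ω i`, `u_i = 0` on the exterior boundary,
`-ν_i n_i·∇u_i = b_{i,1} u_1 + b_{i,2} u_2 - g_i` on the interface, `u_i(0) = u_i⁰`,
for times in `[0, tf]`. The advection fields are of class `W^{1,∞}` (Lipschitz, on a convex
domain) and have no normal component on the boundary. -/
structure ModelProblem (n : ℕ) where
  tf : ℝ
  tf_pos : 0 < tf
  ν : Fin 2 → ℝ
  ν_pos : ∀ i, 0 < ν i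
  b : Fin 2 → Fin 2 → ℝ
  s : Fin 2 → (Fin (n + 1) → ℝ) → (Fin (n + 1) → ℝ)
  s_lipschitz : ∀ i, ∃ K, LipschitzOnWith K (s i) (closure (Ω n i))
  s_tangential : ∀ i, ∀ x ∈ closure (Ω n i), ∀ j, x j = lo i j ∨ x j = hi i j → s i x j = 0
  f : Fin 2 → ℝ → (Fin (n + 1) → ℝ) → ℝ
  f_memLp : ∀ i, ∀ t ∈ Ioc 0 tf, MemLp (f i t) 2 (volume.restrict (Ω n i))
  g : Fin 2 → ℝ → (Fin n → ℝ) → ℝ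
  g_memLp : ∀ i, ∀ t ∈ Ioc 0 tf, MemLp (g i t) 2 (volume.restrict (Gam n))
  u₀ : Fin 2 → (Fin (n + 1) → ℝ) → ℝ
  u₀_memLp : ∀ i, MemLp (u₀ i) 2 (volume.restrict (Ω n i))

variable {n : ℕ}

/-- The diffusion form `a(v, w) = ∫ ν_i ∇v·∇w`. -/
def ModelProblem.a (P : ModelProblem n) (i : Fin 2) (v w : (Fin (n + 1) → ℝ) → ℝ) : ℝ :=
  ∫ x in Ω n i, P.ν i * ∑ j, pderiv j v x * pderiv j w x

/-- The advection form `b(v, w) = ∫ ∇·(s_i v) w`. -/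
def ModelProblem.adv (P : ModelProblem n) (i : Fin 2) (v w : (Fin (n + 1) → ℝ) → ℝ) : ℝ :=
  ∫ x in Ω n i, (∑ j, pderiv j (fun y => P.s i y j * v y) x) * w x

/-- `L(v, w) = a(v, w) + b(v, w)`. -/
def ModelProblem.L (P : ModelProblem n) (i : Fin 2) (v w : (Fin (n + 1) → ℝ) → ℝ) : ℝ :=
  P.a i v w + P.adv i v w

/-! ### The semi-discrete problem -/

/-- `u` and `F` solve the semi-discrete mixed formulation.  Time derivatives are one-sided at the
final time; on a finite-dimensional function space they may be taken pointwise in space. -/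
structure IsSemiDiscreteSolution (S : SpatialMesh n) (P : ModelProblem n)
    (u : Fin 2 → ℝ → (Fin (n + 1) → ℝ) → ℝ) (F : Fin 2 → ℝ → (Fin n → ℝ) → ℝ) : Prop where
  u_mem : ∀ i, ∀ t ∈ Icc 0 P.tf, u i t ∈ S.U i
  F_mem : ∀ i, ∀ t ∈ Ioc 0 P.tf, F i t ∈ S.UΓ
  continuous : ∀ i x, ContinuousOn (fun t => u i t x) (Icc 0 P.tf)
  evolution : ∀ i, ∀ t ∈ Ioc 0 P.tf, ∃ du ∈ S.U i,
    (∀ x, HasDerivWithinAt (fun τ => u i τ x) (du x) (Icc 0 P.tf) t) ∧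
    ∀ v ∈ S.U i, ip (Ω n i) du v =
      - P.L i (u i t) v - ip (Gam n) (F i t) (trace v) + ip (Ω n i) (P.f i t) v
  initial : ∀ i, ∀ v ∈ S.U i, ip (Ω n i) (u i 0) v = ip (Ω n i) (P.u₀ i) v
  interface : ∀ i, ∀ t ∈ Ioc 0 P.tf, ∀ μ ∈ S.UΓ,
    ip (Gam n) (F i t) μ =
      ip (Gam n) (fun y => P.b i 0 * trace (u 0 t) y + P.b i 1 * trace (u 1 t) y - P.g i t y) μ

/-- `v` belongs to `H^k(0, T; V)`, where `V` is a finite-dimensional space of functions on `D`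
with the `L²(D)` norm, and `w m` is its `m`-th time derivative for `m ≤ k`: for almost every time
`v = w 0`, for `m < k` the function `w m` is a primitive of `w (m+1)`, and for `m ≤ k` the norm of
`w m` is square integrable in time. -/
structure HasTimeDerivatives {d : ℕ} (D : Set (Fin d → ℝ)) (V : Submodule ℝ ((Fin d → ℝ) → ℝ))
    (T : ℝ) (k : ℕ) (v : ℝ → (Fin d → ℝ) → ℝ) (w : ℕ → ℝ → (Fin d → ℝ) → ℝ) : Prop where
  mem : ∀ m ≤ k, ∀ t ∈ Icc 0 T, w m t ∈ V
  zero : ∀ᵐ t ∂(volume.restrict (Ioo 0 T)), w 0 t = v t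
  integrable : ∀ m ≤ k, ∀ x, IntervalIntegrable (fun t => w m t x) volume 0 T
  primitive : ∀ m < k, ∀ x, ∀ t ∈ Icc 0 T, w m t x = w m 0 x + ∫ τ in (0 : ℝ)..t, w (m + 1) τ x
  norm_memLp : ∀ m ≤ k, MemLp (fun t => nrm D (w m t)) 2 (volume.restrict (Ioo 0 T))

/-! ### The multirate discontinuous Galerkin in time method -/

/-- The parameters of the time stepping: polynomial order `q` of the states, `ns` side conditions
at the relative times `θ` with the coefficient matrix `Dm` of a `ks`-step method, and the orders
`r i` of the coupling spaces. -/
structure TimeScheme where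
  q : ℕ
  ns : ℕ
  ns_le : ns ≤ q + 1
  ks : ℕ
  θ : Fin ns → ℝ
  θ_strictMono : StrictMono θ
  θ_le_one : ∀ k, θ k ≤ 1
  Dm : Matrix (Fin ns) (Fin (ks + 1)) ℝ
  r : Fin 2 → ℕ

/-- The side condition times are unisolvent: for an `L²(-1,1)`-orthogonal basis `ψ_0, …, ψ_q` of
the polynomials of degree at most `q` with `deg ψ_j ≤ j`, the `ns × ns` matrix of the values
`ψ_m (2 θ_j - 1)`, `q - ns < m ≤ q`, is nonsingular. -/
def TimeScheme.Unisolvent (A : TimeScheme) : Prop :=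
  ∃ ψ : ℕ → Polynomial ℝ, (∀ j ≤ A.q, ψ j ≠ 0 ∧ (ψ j).natDegree ≤ j) ∧
    (∀ j ≤ A.q, ∀ l ≤ A.q, j ≠ l → ∫ t in (-1 : ℝ)..1, (ψ j).eval t * (ψ l).eval t = 0) ∧
    (Matrix.of fun j m : Fin A.ns =>
      (ψ (A.q + 1 - A.ns + m)).eval (2 * A.θ j - 1)).det ≠ 0

/-- The time grids: `N` coupling windows, each with `M i` substeps on subdomain `i`. -/
structure TimeGrid where
  N : ℕ
  N_pos : 0 < N
  M : Fin 2 → ℕ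
  M_pos : ∀ i, 0 < M i

/-- The length `Δt = tf / N` of a coupling window. -/
def TimeGrid.dt (G : TimeGrid) (tf : ℝ) : ℝ := tf / G.N

/-- The substep size `Δt_i = Δt / M_i`. -/
def TimeGrid.dts (G : TimeGrid) (tf : ℝ) (i : Fin 2) : ℝ := G.dt tf / G.M i

/-- The number, counted from the initial time, of substep `m` of coupling window `w`
(windows are numbered from `1`). -/
def TimeGrid.idx (G : TimeGrid) (i : Fin 2) (w m : ℕ) : ℕ := (w - 1) * G.M i + m

/-- Polynomials in time of degree at most `q` with values in `V`. -/
def polyInTime {X : Type*} (V : Submodule ℝ (X → ℝ)) (q : ℕ) : Set (ℝ → X → ℝ) :=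
  {v | ∃ c : Fin (q + 1) → X → ℝ, (∀ m, c m ∈ V) ∧ ∀ t, v t = ∑ m : Fin (q + 1), t ^ (m : ℕ) • c m}

/-- A discrete approximation.  States `u i j` and side values `sv i j` are numbered over all
substeps of `[0, tf]`: `u i j` belongs to the time interval `((j-1) Δt_i, j Δt_i)` and `sv i j` to
the time `j Δt_i`.  So, on coupling window `w`, `u_i^m` is `u i (G.idx i w m)` and `U_i^m` is
`sv i (G.idx i w m)`.  The traces `uΓ i w` and the fluxes `F i w` belong to the window `w`. -/
structure DiscreteApprox (n : ℕ) where
  u : Fin 2 → ℕ → ℝ → (Fin (n + 1) → ℝ) → ℝ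
  sv : Fin 2 → ℕ → (Fin (n + 1) → ℝ) → ℝ
  uΓ : Fin 2 → ℕ → ℝ → (Fin n → ℝ) → ℝ
  F : Fin 2 → ℕ → ℝ → (Fin n → ℝ) → ℝ

/-- `Y` solves the multirate method on the coupling windows `N₀, …, N`, with given states and side
values on the earlier windows.  Its fields are the spaces, the side conditions, the variational
equations on the substeps, the projected traces and the fluxes. -/
structure IsDGiTSolution (S : SpatialMesh n) (P : ModelProblem n) (A : TimeScheme)
    (G : TimeGrid) (N₀ : ℕ) (Y : DiscreteApprox n) : Prop where
  u_mem : ∀ i, ∀ j ∈ Icc 1 (G.N * G.M i), Y.u i j ∈ polyInTime (S.U i) A.q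
  sv_mem : ∀ i, ∀ j ≤ G.N * G.M i, Y.sv i j ∈ S.U i
  uΓ_mem : ∀ i, ∀ w ∈ Icc N₀ G.N, Y.uΓ i w ∈ polyInTime S.UΓ (A.r i)
  F_mem : ∀ i, ∀ w ∈ Icc N₀ G.N, Y.F i w ∈ polyInTime S.UΓ (A.r i)
  side : ∀ i, ∀ w ∈ Icc N₀ G.N, ∀ m ∈ Icc 1 (G.M i), ∀ k,
    Y.u i (G.idx i w m) (((G.idx i w m : ℝ) - 1 + A.θ k) * G.dts P.tf i) =
      ∑ l : Fin (A.ks + 1), A.Dm k l • Y.sv i (G.idx i w m - (l : ℕ))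
  galerkin : ∀ i, ∀ w ∈ Icc N₀ G.N, ∀ m ∈ Icc 1 (G.M i),
    ∀ v ∈ polyInTime (S.U i) (A.q + 1 - A.ns),
    ip (Ω n i) (Y.sv i (G.idx i w m)) (v (G.idx i w m * G.dts P.tf i)) -
        (∫ t in (((G.idx i w m : ℝ) - 1) * G.dts P.tf i)..(G.idx i w m * G.dts P.tf i),
          ip (Ω n i) (Y.u i (G.idx i w m) t) (fun x => deriv (fun τ => v τ x) t)) =
      ip (Ω n i) (Y.sv i (G.idx i w m - 1)) (v (((G.idx i w m : ℝ) - 1) * G.dts P.tf i)) -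
        ∫ t in (((G.idx i w m : ℝ) - 1) * G.dts P.tf i)..(G.idx i w m * G.dts P.tf i),
          (P.L i (Y.u i (G.idx i w m) t) (v t) + ip (Gam n) (Y.F i w t) (trace (v t)) -
            ip (Ω n i) (P.f i t) (v t))
  traces : ∀ i, ∀ w ∈ Icc N₀ G.N, ∀ μ ∈ polyInTime S.UΓ (A.r i),
    (∫ t in (((w : ℝ) - 1) * G.dt P.tf)..(w * G.dt P.tf), ip (Gam n) (Y.uΓ i w t) (μ t)) =
      ∑ m ∈ Finset.Icc 1 (G.M i),
        ∫ t in (((G.idx i w m : ℝ) - 1) * G.dts P.tf i)..(G.idx i w m * G.dts P.tf i),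
          ip (Gam n) (trace (Y.u i (G.idx i w m) t)) (μ t)
  fluxes : ∀ i, ∀ w ∈ Icc N₀ G.N, ∀ μ ∈ polyInTime S.UΓ (A.r i),
    (∫ t in (((w : ℝ) - 1) * G.dt P.tf)..(w * G.dt P.tf), ip (Gam n) (Y.F i w t) (μ t)) =
      ∫ t in (((w : ℝ) - 1) * G.dt P.tf)..(w * G.dt P.tf),
        ip (Gam n) (fun y => P.b i 0 * Y.uΓ 0 w t y + P.b i 1 * Y.uΓ 1 w t y - P.g i t y) (μ t)

/-- The first window `N₀` is late enough for the side conditions on windows `N₀, …, N` to refer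
only to nonnegative times. -/
def LateStart (A : TimeScheme) (G : TimeGrid) (N₀ : ℕ) : Prop :=
  ∀ i, ∀ k : Fin A.ns, 0 ≤ ((N₀ : ℝ) - 1) * G.M i + A.θ k ∧ A.ks ≤ (N₀ - 1) * G.M i + 1

/-- Consistency of order `Δt_i^{q+1}` of the side conditions, with constant `K`, for the function
`u i` with time derivatives `Du i m`. -/
def ConsistentSide (P : ModelProblem n) (A : TimeScheme) (G : TimeGrid) (N₀ : ℕ) (K : ℝ)
    (u : Fin 2 → ℝ → (Fin (n + 1) → ℝ) → ℝ)
    (Du : Fin 2 → ℕ → ℝ → (Fin (n + 1) → ℝ) → ℝ) : Prop :=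
  ∀ i, ∀ w ∈ Icc N₀ G.N, ∀ m ∈ Icc 1 (G.M i),
    G.dts P.tf i * ∑ k, nrm (Ω n i)
        (u i (((G.idx i w m : ℝ) - 1 + A.θ k) * G.dts P.tf i) -
          ∑ l : Fin (A.ks + 1), A.Dm k l • u i (((G.idx i w m : ℝ) - l) * G.dts P.tf i)) ^ 2 ≤
      K * G.dts P.tf i ^ (2 * A.q + 2) *
        ∫ t in (((G.idx i w m : ℝ) - A.ks) * G.dts P.tf i)..(G.idx i w m * G.dts P.tf i),
          ∑ μ ∈ Finset.range (A.q + 2), nrm (Ω n i) (Du i μ t) ^ 2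

/-- The error `‖u_i(t_i^m) - U_i^m‖` of a side value on window `w`. -/
def sideError (P : ModelProblem n) (G : TimeGrid)
    (u : Fin 2 → ℝ → (Fin (n + 1) → ℝ) → ℝ) (Y : DiscreteApprox n) (i : Fin 2) (w m : ℕ) : ℝ :=
  nrm (Ω n i) (u i (G.idx i w m * G.dts P.tf i) - Y.sv i (G.idx i w m))

/-- The space-time error on window `w`: the square root of the sum, over the subdomains and the
substeps, of `∫ ‖u_i - u_i^m‖² dt`. -/
def stateError (P : ModelProblem n) (G : TimeGrid)
    (u : Fin 2 → ℝ → (Fin (n + 1) → ℝ) → ℝ) (Y : DiscreteApprox n) (w : ℕ) : ℝ :=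
  √(∑ i, ∑ m ∈ Finset.Icc 1 (G.M i),
    ∫ t in (((G.idx i w m : ℝ) - 1) * G.dts P.tf i)..(G.idx i w m * G.dts P.tf i),
      nrm (Ω n i) (u i t - Y.u i (G.idx i w m) t) ^ 2)

/-- The initialization errors are at most `K Δt^p`, at the initial time and on the windows before
`N₀`. -/
structure AccurateStart (P : ModelProblem n) (G : TimeGrid) (N₀ : ℕ) (K p : ℝ)
    (u : Fin 2 → ℝ → (Fin (n + 1) → ℝ) → ℝ) (Y : DiscreteApprox n) : Prop where
  initial : √(∑ i, nrm (Ω n i) (u i 0 - Y.sv i 0) ^ 2) ≤ K * G.dt P.tf ^ p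
  side : ∀ w ∈ Ico 1 N₀, w ≤ G.N →
    √(∑ i, ∑ m ∈ Finset.Icc 1 (G.M i), sideError P G u Y i w m ^ 2) ≤ K * G.dt P.tf ^ p
  state : ∀ w ∈ Ico 1 N₀, w ≤ G.N → stateError P G u Y w ≤ K * G.dt P.tf ^ p

/-- The error bound `Δt^p + Σ_i (Δt_i^{q+1} + Δt^{r_i+1})`. -/
def rate (P : ModelProblem n) (A : TimeScheme) (G : TimeGrid) (p : ℝ) : ℝ :=
  G.dt P.tf ^ p + ∑ i, (G.dts P.tf i ^ (A.q + 1) + G.dt P.tf ^ (A.r i + 1))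

end DGiT

end

/-! The mesh is fixed, so all spatial spaces are finite-dimensional. With their `L²` inner products
they are Hilbert spaces (`L2Sub`) on which `L` and the interface pairing are bounded bilinear forms
(`exists_formBound`). The bounds depend on the mesh, and the theorem becomes a perturbation estimate
for a linear system of ordinary differential equations.

On each substep the semi-discrete solution, integrated by parts in time against polynomials,
satisfies the Galerkin identity of the method exactly. Subtraction gives an error equation for the
state error `e`, the side value errors `E` and the flux error `δF` (`Run.errorEquation`), whose
residual is at most `c (‖e‖ + ‖δF‖)`. A constant test function bounds the growth of `E` across the
substep; test functions of higher degree bound the low moments of `e`. These moments and the values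
at the side condition times determine a polynomial of degree `q`, by the assumed nonsingularity and
equivalence of norms (`TimeScheme.Unisolvent.exists_stableWith`). Applied to the Taylor polynomial
of the solution minus the discrete state, this gives the local estimate `Run.e2_le`: the squared
state error is bounded by `h` times the squared side value errors, `h²` times the squared state and
flux errors, and a consistency term of order `h^(2q+2)`.

On a window, the discrete traces and fluxes are projections in time, so their errors are controlled
by the state errors and by Taylor remainders of order `r + 1` (`Run.traces_error`,
`Run.flux_error`).

Summed over a window, with `S` the largest side value error so far, `e` and `f` the squared state
and flux errors and `D` the squared defects, one gets `e ≤ C (Δt S² + Δt² (e + f) + D)`, `f ≤ C (e +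
D)`, and an increase of `S` by at most `(C Δt (e + f))^(1/2)`. For small `Δt` the state error is
absorbed, the increase is at most `C (Δt S + (Δt D)^(1/2))`, and a discrete Gronwall argument with
the Cauchy–Schwarz inequality concludes (`window_gronwall`). Taking `S` as a maximum over all
earlier side values accommodates side conditions that reach back over several substeps. The sum of
the defects over all windows is at most the squared rate times the squared Sobolev norms of the
solution (`Run.sum_defect_le`). -/

noncomputable section

namespace DGiT

variable {n : ℕ}

/-! ### Finite element functions -/

theorem integrableOn_mul_of_continuousOn {d : ℕ} {D : Set (Fin d → ℝ)} (hb : Bornology.IsBounded D)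
    {v w : (Fin d → ℝ) → ℝ} (hv : ContinuousOn v (closure D)) (hw : ContinuousOn w (closure D)) :
    IntegrableOn (fun x => v x * w x) D :=
  ((hv.mul hw).integrableOn_compact hb.isCompact_closure).mono_set subset_closure

/-- A vanishing norm gives zero almost everywhere; continuity upgrades this to the open set and then
to its closure. This is the definiteness of the `L²` inner product on finite element functions. -/
theorem eq_zero_of_ip_self {d : ℕ} {D : Set (Fin d → ℝ)} (ho : IsOpen D)
    (hb : Bornology.IsBounded D) {v : (Fin d → ℝ) → ℝ} (hv : ContinuousOn v (closure D))
    (hz : ∀ x, x ∉ closure D → v x = 0) (h : ip D v v = 0) : v = 0 := by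
  have h1 : v =ᵐ[volume.restrict D] (fun _ => (0 : ℝ)) := by
    have := (integral_eq_zero_iff_of_nonneg (μ := volume.restrict D)
      (f := fun x => v x * v x) (fun x => mul_self_nonneg _)
      (integrableOn_mul_of_continuousOn hb hv hv)).1 h
    filter_upwards [this] with x hx
    simpa using hx
  have h2 : EqOn v (fun _ => 0) D :=
    Measure.eqOn_open_of_ae_eq h1 ho (hv.mono subset_closure) continuousOn_const
  have h3 : EqOn v (fun _ => 0) (closure D) :=
    h2.of_subset_closure hv continuousOn_const subset_closure subset_rfl
  funext x
  by_cases hx : x ∈ closure D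
  · exact h3 hx
  · exact hz x hx

instance finite_localPoly {d : ℕ} (κ : ElementKind) (k : ℕ) :
    Module.Finite ℝ (localPoly (d := d) κ k) := by
  cases κ
  · exact inferInstanceAs (Module.Finite ℝ (MvPolynomial.restrictTotalDegree (Fin d) ℝ k))
  · exact inferInstanceAs (Module.Finite ℝ (MvPolynomial.restrictDegree (Fin d) ℝ k))

/-- Restriction of functions to a set. -/
def restrictₗ {X : Type*} (E : Set X) : (X → ℝ) →ₗ[ℝ] (E → ℝ) where
  toFun v := fun x => v x
  map_add' _ _ := rfl
  map_smul' _ _ := rfl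

/-- Polynomials as functions on a set. -/
def evalOn {d : ℕ} (E : Set (Fin d → ℝ)) : MvPolynomial (Fin d) ℝ →ₗ[ℝ] (E → ℝ) where
  toFun P := fun x => MvPolynomial.eval (x : Fin d → ℝ) P
  map_add' _ _ := by ext; simp
  map_smul' _ _ := by ext; simp

/-- Restriction to the elements maps into a finite product of finite-dimensional spaces of
polynomial functions and is injective. Covering almost every point suffices, which suits the
interface mesh, where traces with empty interior are discarded. -/
theorem finiteDimensional_feSpace {d : ℕ} {κ : ElementKind} {k : ℕ} {D B : Set (Fin d → ℝ)}
    {τ : Set (Set (Fin d → ℝ))} (ho : IsOpen D) (hb : Bornology.IsBounded D) (hτ : τ.Finite)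
    (hc : ∀ᵐ x ∂(volume.restrict D), ∃ E ∈ τ, x ∈ E) :
    FiniteDimensional ℝ (feSpace κ k D τ B) := by
  have := hτ.to_subtype
  let W : ∀ E : τ, Submodule ℝ (E.1 → ℝ) := fun E => (localPoly κ k).map (evalOn E.1)
  let Φ : feSpace κ k D τ B →ₗ[ℝ] (∀ E : τ, W E) := LinearMap.pi fun E =>
    LinearMap.codRestrict (W E)
      ((restrictₗ E.1).comp (feSpace κ k D τ B).subtype) (by
        rintro ⟨v, hv⟩
        obtain ⟨P, hP, h⟩ := hv.2.1 E E.2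
        exact ⟨P, hP, by ext x; exact (h x x.2).symm⟩)
  have hΦ : Function.Injective Φ := by
    rw [injective_iff_map_eq_zero]
    rintro ⟨v, hv⟩ h0
    have : v = 0 := by
      refine eq_zero_of_ip_self ho hb hv.1 hv.2.2.2 ?_
      refine integral_eq_zero_of_ae ?_
      filter_upwards [hc] with x hx
      obtain ⟨E, hE, hxE⟩ := hx
      have h1 := congrFun (congrArg Subtype.val (congrFun h0 ⟨E, hE⟩)) ⟨x, hxE⟩
      have h2 : v x = 0 := h1
      simp [h2]
    simpa using this
  exact Module.Finite.of_injective Φ hΦ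

/-! ### Geometry of the subdomains -/

theorem Ω_eq_pi (i : Fin 2) : Ω n i = univ.pi fun j => Ioo (lo i j) (hi i j) := by
  ext x; simp [Ω]

theorem Gam_eq_pi : Gam n = univ.pi fun _ => Ioo (0 : ℝ) 1 := by
  ext x; simp [Gam]

theorem lo_lt_hi (i : Fin 2) (j : Fin (n + 1)) : lo i j < hi i j := by
  unfold lo hi; split_ifs <;> norm_num

theorem isOpen_Ω (i : Fin 2) : IsOpen (Ω n i) := by
  rw [Ω_eq_pi]; exact isOpen_set_pi finite_univ fun _ _ => isOpen_Ioo

theorem isOpen_Gam : IsOpen (Gam n) := by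
  rw [Gam_eq_pi]; exact isOpen_set_pi finite_univ fun _ _ => isOpen_Ioo

theorem isBounded_Ω (i : Fin 2) : Bornology.IsBounded (Ω n i) := by
  rw [Ω_eq_pi]; exact Bornology.IsBounded.pi fun _ => Metric.isBounded_Ioo _ _

theorem isBounded_Gam : Bornology.IsBounded (Gam n) := by
  rw [Gam_eq_pi]; exact Bornology.IsBounded.pi fun _ => Metric.isBounded_Ioo _ _

theorem closure_Ω (i : Fin 2) : closure (Ω n i) = univ.pi fun j => Icc (lo i j) (hi i j) := by
  rw [Ω_eq_pi, closure_pi_set]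
  simp only [closure_Ioo (lo_lt_hi i _).ne]

theorem closure_Gam : closure (Gam n) = univ.pi fun _ => Icc (0 : ℝ) 1 := by
  rw [Gam_eq_pi, closure_pi_set]
  simp only [closure_Ioo (zero_ne_one' ℝ)]

theorem continuous_embed : Continuous (embed (n := n)) := by
  refine continuous_pi fun j => ?_
  refine Fin.lastCases ?_ (fun j => ?_) j
  · simp only [embed, Fin.snoc_last]; exact continuous_const
  · simp only [embed, Fin.snoc_castSucc]; exact continuous_apply j

theorem embed_mem_closure (i : Fin 2) {y : Fin n → ℝ} (hy : y ∈ closure (Gam n)) :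
    embed y ∈ closure (Ω n i) := by
  rw [closure_Gam] at hy
  rw [closure_Ω]
  intro j _
  refine Fin.lastCases ?_ (fun j => ?_) j
  · simp only [embed, Fin.snoc_last, lo, hi]; constructor <;> split_ifs <;> norm_num
  · have := hy j (mem_univ _)
    have hj : Fin.castSucc j ≠ Fin.last n := (Fin.castSucc_lt_last j).ne
    simpa [embed, lo, hi, hj] using this

theorem trace_continuousOn {i : Fin 2} {v : (Fin (n + 1) → ℝ) → ℝ}
    (hv : ContinuousOn v (closure (Ω n i))) : ContinuousOn (trace v) (closure (Gam n)) :=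
  hv.comp continuous_embed.continuousOn fun _ hy => embed_mem_closure i hy

theorem IsElement.convex_isCompact {d : ℕ} {κ : ElementKind} {E : Set (Fin d → ℝ)}
    (h : IsElement κ E) : Convex ℝ E ∧ IsCompact E := by
  cases κ with
  | simplicial =>
    obtain ⟨a, -, rfl⟩ := h
    exact ⟨convex_convexHull _ _, (finite_range a).isCompact_convexHull ℝ⟩
  | tensor =>
    unfold IsElement at h
    split_ifs at h
    · obtain ⟨a, -, rfl⟩ := h
      exact ⟨convex_convexHull _ _, (finite_range a).isCompact_convexHull ℝ⟩
    · obtain ⟨a, e, -, rfl⟩ := h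
      refine ⟨(convex_parallelepiped e).translate a, ?_⟩
      refine IsCompact.image ?_ (continuous_const_add a)
      exact isCompact_Icc.image (by fun_prop)

/-- The boundary of a convex set is a null set. -/
theorem ae_mem_interior {d : ℕ} {E : Set (Fin d → ℝ)} (hE : Convex ℝ E) :
    ∀ᵐ x ∂(volume : Measure (Fin d → ℝ)), x ∈ E → x ∈ interior E := by
  have h : ∀ᵐ x ∂(volume : Measure (Fin d → ℝ)), x ∉ frontier E :=
    measure_eq_zero_iff_ae_notMem.1 (hE.addHaar_frontier volume)
  filter_upwards [h] with x hx hxE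
  by_contra hi
  exact hx ⟨subset_closure hxE, hi⟩

theorem SpatialMesh.ae_mem_interior (S : SpatialMesh n) (i : Fin 2) :
    ∀ᵐ x ∂(volume.restrict (Ω n i)), ∃ E ∈ S.τ i, x ∈ interior E := by
  have h : ∀ᵐ x ∂(volume : Measure (Fin (n + 1) → ℝ)), ∀ E ∈ S.τ i, x ∈ E → x ∈ interior E :=
    (ae_ball_iff (S.conforming i).finite.countable).2 fun E hE =>
      DGiT.ae_mem_interior ((S.conforming i).element E hE).convex_isCompact.1
  filter_upwards [ae_restrict_of_ae h, ae_restrict_mem (isOpen_Ω i).measurableSet] with x hx hxD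
  have : x ∈ ⋃₀ S.τ i := by rw [(S.conforming i).cover]; exact subset_closure hxD
  obtain ⟨E, hE, hxE⟩ := this
  exact ⟨E, hE, hx E hE hxE⟩

theorem embed_convexComb (a b : ℝ) (x y : Fin n → ℝ) :
    embed (a • x + b • y) = a • embed x + b • embed y := by
  funext j
  refine Fin.lastCases ?_ (fun j => ?_) j <;> simp [embed]

theorem finite_interfaceMesh {τ : Set (Set (Fin (n + 1) → ℝ))} (hτ : τ.Finite) :
    (interfaceMesh τ).Finite :=
  (hτ.image fun E => embed ⁻¹' E).subset fun _ ⟨E, hE, h, _⟩ => ⟨E, hE, h.symm⟩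

/-- The trace of an element on the interface is convex, so almost every point of it is interior to
it; a trace with an interior point belongs to the interface mesh. -/
theorem SpatialMesh.ae_mem_interfaceMesh (S : SpatialMesh n) (i : Fin 2) :
    ∀ᵐ x ∂(volume.restrict (Gam n)), ∃ E ∈ interfaceMesh (S.τ i), x ∈ E := by
  have h : ∀ᵐ x ∂(volume : Measure (Fin n → ℝ)), ∀ E ∈ S.τ i,
      x ∈ embed ⁻¹' E → x ∈ interior (embed ⁻¹' E) := by
    refine (ae_ball_iff (S.conforming i).finite.countable).2 fun E hE =>
      DGiT.ae_mem_interior ?_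
    have hc := ((S.conforming i).element E hE).convex_isCompact.1
    intro x hx y hy a b ha hb hab
    show embed _ ∈ E
    rw [embed_convexComb]
    exact hc hx hy ha hb hab
  filter_upwards [ae_restrict_of_ae h, ae_restrict_mem isOpen_Gam.measurableSet] with x hx hxD
  have : embed x ∈ ⋃₀ S.τ i := by
    rw [(S.conforming i).cover]; exact embed_mem_closure i (subset_closure hxD)
  obtain ⟨E, hE, hxE⟩ := this
  exact ⟨_, ⟨E, hE, rfl, x, hx E hE hxE⟩, hxE⟩

instance SpatialMesh.finiteDimensional_U (S : SpatialMesh n) (i : Fin 2) :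
    FiniteDimensional ℝ (S.U i) := by
  refine finiteDimensional_feSpace (isOpen_Ω i) (isBounded_Ω i) (S.conforming i).finite ?_
  filter_upwards [S.ae_mem_interior i] with x ⟨E, hE, hx⟩ using ⟨E, hE, interior_subset hx⟩

instance SpatialMesh.finiteDimensional_UΓ (S : SpatialMesh n) : FiniteDimensional ℝ S.UΓ :=
  finiteDimensional_feSpace isOpen_Gam isBounded_Gam
    (finite_interfaceMesh (S.conforming 0).finite) (S.ae_mem_interfaceMesh 0)

/-! ### The bilinear forms -/

theorem contDiff_mvPolynomial_eval {d : ℕ} (P : MvPolynomial (Fin d) ℝ) :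
    ContDiff ℝ 1 fun x : Fin d → ℝ => MvPolynomial.eval x P := by
  induction P using MvPolynomial.induction_on with
  | C a => simpa using contDiff_const
  | add p q hp hq => simpa using hp.add hq
  | mul_X p j hp => simpa using hp.mul (contDiff_apply ℝ ℝ j)

/-- A function that is almost everywhere on `D` differentiable with bounded partial derivatives. -/
def HasBoundedGradient {d : ℕ} (D : Set (Fin d → ℝ)) (v : (Fin d → ℝ) → ℝ) : Prop :=
  (∃ C, ∀ x ∈ D, |v x| ≤ C) ∧ AEStronglyMeasurable v (volume.restrict D) ∧
  ∃ C, ∀ᵐ x ∂(volume.restrict D), DifferentiableAt ℝ v x ∧ ∀ j, |pderiv j v x| ≤ C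

theorem abs_pderiv_le {d : ℕ} (j : Fin d) (v : (Fin d → ℝ) → ℝ) (x : Fin d → ℝ) :
    |pderiv j v x| ≤ ‖fderiv ℝ v x‖ := by
  have := (fderiv ℝ v x).le_opNorm (Pi.single j 1)
  rwa [Pi.norm_single, norm_one, mul_one] at this

theorem HasBoundedGradient.of_continuousOn {d : ℕ} {D : Set (Fin d → ℝ)} (ho : IsOpen D)
    (hb : Bornology.IsBounded D) {v : (Fin d → ℝ) → ℝ} (hv : ContinuousOn v (closure D))
    (h : ∃ C, ∀ᵐ x ∂(volume.restrict D), DifferentiableAt ℝ v x ∧ ‖fderiv ℝ v x‖ ≤ C) :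
    HasBoundedGradient D v := by
  refine ⟨?_, (hv.mono subset_closure).aestronglyMeasurable ho.measurableSet, ?_⟩
  · obtain ⟨C, hC⟩ := hb.isCompact_closure.exists_bound_of_continuousOn hv
    exact ⟨C, fun x hx => hC x (subset_closure hx)⟩
  · obtain ⟨C, hC⟩ := h
    refine ⟨C, ?_⟩
    filter_upwards [hC] with x hx
    exact ⟨hx.1, fun j => (abs_pderiv_le j v x).trans hx.2⟩

/-- In the interior of an element the function agrees locally with a polynomial, whose gradient is
bounded on the compact element. The mesh is finite and the interiors of its elements fill the domain
up to a null set. -/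
theorem SpatialMesh.hasBoundedGradient (S : SpatialMesh n) (i : Fin 2)
    {v : (Fin (n + 1) → ℝ) → ℝ} (hv : v ∈ S.U i) : HasBoundedGradient (Ω n i) v := by
  refine .of_continuousOn (isOpen_Ω i) (isBounded_Ω i) hv.1 ?_
  have key : ∀ E ∈ S.τ i, ∃ C, ∀ x ∈ interior E,
      DifferentiableAt ℝ v x ∧ ‖fderiv ℝ v x‖ ≤ C := by
    intro E hE
    obtain ⟨P, -, hP⟩ := hv.2.1 E hE
    have hcd := contDiff_mvPolynomial_eval P
    obtain ⟨C, hC⟩ := ((S.conforming i).element E hE).convex_isCompact.2.exists_bound_of_continuousOn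
      (hcd.continuous_fderiv one_ne_zero).continuousOn
    refine ⟨C, fun x hx => ?_⟩
    have he : v =ᶠ[nhds x] fun x => MvPolynomial.eval x P := by
      filter_upwards [mem_interior_iff_mem_nhds.1 hx] with y hy using hP y hy
    refine ⟨(hcd.differentiable one_ne_zero x).congr_of_eventuallyEq he, ?_⟩
    rw [he.fderiv_eq]
    exact hC x (interior_subset hx)
  choose! C hC using key
  obtain ⟨M, hM⟩ := ((S.conforming i).finite.image C).bddAbove
  refine ⟨M, ?_⟩
  filter_upwards [S.ae_mem_interior i] with x ⟨E, hE, hx⟩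
  exact ⟨(hC E hE x hx).1, (hC E hE x hx).2.trans (hM ⟨E, hE, rfl⟩)⟩

/-- Rademacher's theorem, with the Lipschitz constant as the bound of the gradient. -/
theorem ModelProblem.hasBoundedGradient_s (P : ModelProblem n) (i : Fin 2) (j : Fin (n + 1)) :
    HasBoundedGradient (Ω n i) fun x => P.s i x j := by
  obtain ⟨K, hK⟩ := P.s_lipschitz i
  have hl : LipschitzOnWith K (fun x => P.s i x j) (closure (Ω n i)) := fun x hx y hy =>
    (edist_le_pi_edist _ _ j).trans (hK hx hy)
  have hl' := hl.mono (subset_closure (s := Ω n i))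
  refine .of_continuousOn (isOpen_Ω i) (isBounded_Ω i) hl.continuousOn ⟨K, ?_⟩
  have hd := hl'.ae_differentiableWithinAt (μ := volume) (isOpen_Ω i).measurableSet
  filter_upwards [hd, ae_restrict_mem (isOpen_Ω i).measurableSet] with x hx hxD
  have hn := (isOpen_Ω i).mem_nhds hxD
  exact ⟨hx.differentiableAt hn, norm_fderiv_le_of_lipschitzOn ℝ hn hl'⟩

theorem aestronglyMeasurable_pderiv {d : ℕ} (j : Fin d) (v : (Fin d → ℝ) → ℝ)
    (μ : Measure (Fin d → ℝ)) : AEStronglyMeasurable (pderiv j v) μ :=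
  (measurable_fderiv_apply_const ℝ v (Pi.single j 1)).aestronglyMeasurable

theorem pderiv_add {d : ℕ} (j : Fin d) {v w : (Fin d → ℝ) → ℝ} {x : Fin d → ℝ}
    (hv : DifferentiableAt ℝ v x) (hw : DifferentiableAt ℝ w x) :
    pderiv j (v + w) x = pderiv j v x + pderiv j w x := by
  simp [pderiv, fderiv_add hv hw]

theorem pderiv_smul {d : ℕ} (j : Fin d) (c : ℝ) {v : (Fin d → ℝ) → ℝ} {x : Fin d → ℝ}
    (hv : DifferentiableAt ℝ v x) : pderiv j (c • v) x = c * pderiv j v x := by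
  simp [pderiv, fderiv_const_smul hv]

theorem pderiv_mul {d : ℕ} (j : Fin d) {v w : (Fin d → ℝ) → ℝ} {x : Fin d → ℝ}
    (hv : DifferentiableAt ℝ v x) (hw : DifferentiableAt ℝ w x) :
    pderiv j (fun y => v y * w y) x = v x * pderiv j w x + w x * pderiv j v x := by
  simp [pderiv, fderiv_fun_mul hv hw]

theorem integrableOn_of_bounded {d : ℕ} {D : Set (Fin d → ℝ)} (hb : Bornology.IsBounded D)
    {f : (Fin d → ℝ) → ℝ} (hm : AEStronglyMeasurable f (volume.restrict D))
    (h : ∃ C, ∀ᵐ x ∂(volume.restrict D), |f x| ≤ C) : IntegrableOn f D := by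
  obtain ⟨C, hC⟩ := h
  have : IsFiniteMeasure (volume.restrict D) := ⟨by simpa using hb.measure_lt_top⟩
  exact Integrable.of_bound hm C hC

/-- The advection term `∇·(s v)` and its expansion. -/
theorem ModelProblem.adv_term (P : ModelProblem n) (i : Fin 2) {v : (Fin (n + 1) → ℝ) → ℝ}
    (hv : HasBoundedGradient (Ω n i) v) :
    ∀ᵐ x ∂(volume.restrict (Ω n i)), DifferentiableAt ℝ v x ∧
      ∀ j, DifferentiableAt ℝ (fun y => P.s i y j) x ∧ pderiv j (fun y => P.s i y j * v y) x =
        P.s i x j * pderiv j v x + v x * pderiv j (fun y => P.s i y j) x := by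
  obtain ⟨-, -, C, hC⟩ := hv
  have hs : ∀ᵐ x ∂(volume.restrict (Ω n i)), ∀ j, DifferentiableAt ℝ (fun x => P.s i x j) x := by
    refine ae_all_iff.2 fun j => ?_
    obtain ⟨-, -, C', hC'⟩ := P.hasBoundedGradient_s i j
    filter_upwards [hC'] with x hx using hx.1
  filter_upwards [hC, hs] with x hx hsx
  exact ⟨hx.1, fun j => ⟨hsx j, pderiv_mul j (hsx j) hx.1⟩⟩

theorem ModelProblem.integrable_a (P : ModelProblem n) (i : Fin 2) {v w : (Fin (n + 1) → ℝ) → ℝ}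
    (hv : HasBoundedGradient (Ω n i) v) (hw : HasBoundedGradient (Ω n i) w) :
    IntegrableOn (fun x => P.ν i * ∑ j, pderiv j v x * pderiv j w x) (Ω n i) := by
  refine Integrable.const_mul (integrable_finsetSum _ fun j _ => ?_) _
  refine integrableOn_of_bounded (isBounded_Ω i)
    ((aestronglyMeasurable_pderiv _ _ _).mul (aestronglyMeasurable_pderiv _ _ _)) ?_
  obtain ⟨-, -, C, hC⟩ := hv
  obtain ⟨-, -, C', hC'⟩ := hw
  refine ⟨C * C', ?_⟩
  filter_upwards [hC, hC'] with x hx hx'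
  rw [abs_mul]
  exact mul_le_mul (hx.2 j) (hx'.2 j) (abs_nonneg _) ((abs_nonneg _).trans (hx.2 j))

theorem ModelProblem.integrable_adv (P : ModelProblem n) (i : Fin 2)
    {v w : (Fin (n + 1) → ℝ) → ℝ}
    (hv : HasBoundedGradient (Ω n i) v) (hw : HasBoundedGradient (Ω n i) w) :
    IntegrableOn (fun x => (∑ j, pderiv j (fun y => P.s i y j * v y) x) * w x) (Ω n i) := by
  have hsum : (fun x => (∑ j, pderiv j (fun y => P.s i y j * v y) x) * w x) =
      fun x => ∑ j, pderiv j (fun y => P.s i y j * v y) x * w x := by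
    funext x; rw [Finset.sum_mul]
  rw [hsum]
  refine integrable_finsetSum _ fun j _ => ?_
  refine integrableOn_of_bounded (isBounded_Ω i)
    ((aestronglyMeasurable_pderiv _ _ _).mul hw.2.1) ?_
  have h1 := P.adv_term i hv
  obtain ⟨⟨Cv, hCv⟩, -, C, hC⟩ := hv
  obtain ⟨⟨Cw, hCw⟩, -⟩ := hw
  obtain ⟨⟨Cs, hCs⟩, -, Cs', hCs'⟩ := P.hasBoundedGradient_s i j
  refine ⟨(Cs * C + Cv * Cs') * Cw, ?_⟩
  filter_upwards [h1, hC, hCs', ae_restrict_mem (isOpen_Ω i).measurableSet] with x h1x hx hsx hxD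
  rw [abs_mul, (h1x.2 j).2]
  have b1 := hCv x hxD
  have b2 := hCw x hxD
  have b3 := hCs x hxD
  have b4 := hx.2 j
  have b5 := hsx.2 j
  have : |P.s i x j * pderiv j v x + v x * pderiv j (fun y => P.s i y j) x| ≤
      Cs * C + Cv * Cs' := by
    refine (abs_add_le _ _).trans (add_le_add ?_ ?_) <;> rw [abs_mul]
    · exact mul_le_mul b3 b4 (abs_nonneg _) ((abs_nonneg _).trans b3)
    · exact mul_le_mul b1 b5 (abs_nonneg _) ((abs_nonneg _).trans b1)
  exact mul_le_mul this b2 (abs_nonneg _) ((abs_nonneg _).trans this)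

/-- Derivatives are additive only at points of differentiability, so the integrands agree only
almost everywhere. The bounded gradients provide these points and the integrability that splits the
integrals. -/
theorem ModelProblem.L_add_left (P : ModelProblem n) (i : Fin 2)
    {v v' w : (Fin (n + 1) → ℝ) → ℝ} (hv : HasBoundedGradient (Ω n i) v)
    (hv' : HasBoundedGradient (Ω n i) v') (hw : HasBoundedGradient (Ω n i) w) :
    P.L i (v + v') w = P.L i v w + P.L i v' w := by
  have ha : P.a i (v + v') w = P.a i v w + P.a i v' w := by
    unfold ModelProblem.a
    rw [← integral_add (P.integrable_a i hv hw) (P.integrable_a i hv' hw)]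
    refine integral_congr_ae ?_
    filter_upwards [P.adv_term i hv, P.adv_term i hv'] with x hx hx'
    simp only [pderiv_add _ hx.1 hx'.1, add_mul, Finset.sum_add_distrib, mul_add]
  have hb : P.adv i (v + v') w = P.adv i v w + P.adv i v' w := by
    unfold ModelProblem.adv
    rw [← integral_add (P.integrable_adv i hv hw) (P.integrable_adv i hv' hw)]
    refine integral_congr_ae ?_
    filter_upwards [P.adv_term i hv, P.adv_term i hv'] with x hx hx'
    rw [← add_mul, ← Finset.sum_add_distrib]
    congr 1
    refine Finset.sum_congr rfl fun j _ => ?_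
    rw [(hx.2 j).2, (hx'.2 j).2, pderiv_mul j (hx.2 j).1 (hx.1.add hx'.1), pderiv_add j hx.1 hx'.1]
    simp only [Pi.add_apply]
    ring
  rw [ModelProblem.L, ha, hb, ModelProblem.L, ModelProblem.L]
  ring

theorem ModelProblem.L_smul_left (P : ModelProblem n) (i : Fin 2) (c : ℝ)
    {v w : (Fin (n + 1) → ℝ) → ℝ} (hv : HasBoundedGradient (Ω n i) v) :
    P.L i (c • v) w = c * P.L i v w := by
  have ha : P.a i (c • v) w = c * P.a i v w := by
    unfold ModelProblem.a
    rw [← integral_const_mul]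
    refine integral_congr_ae ?_
    filter_upwards [P.adv_term i hv] with x hx
    simp only [pderiv_smul _ c hx.1, mul_assoc, ← Finset.mul_sum]
    ring
  have hb : P.adv i (c • v) w = c * P.adv i v w := by
    unfold ModelProblem.adv
    rw [← integral_const_mul]
    refine integral_congr_ae ?_
    filter_upwards [P.adv_term i hv] with x hx
    rw [← mul_assoc, Finset.mul_sum]
    congr 1
    refine Finset.sum_congr rfl fun j _ => ?_
    rw [(hx.2 j).2, pderiv_mul j (hx.2 j).1 (hx.1.const_smul c), pderiv_smul j c hx.1]
    simp only [Pi.smul_apply, smul_eq_mul]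
    ring
  rw [ModelProblem.L, ha, hb, ModelProblem.L]
  ring

theorem ModelProblem.L_add_right (P : ModelProblem n) (i : Fin 2)
    {v w w' : (Fin (n + 1) → ℝ) → ℝ} (hv : HasBoundedGradient (Ω n i) v)
    (hw : HasBoundedGradient (Ω n i) w) (hw' : HasBoundedGradient (Ω n i) w') :
    P.L i v (w + w') = P.L i v w + P.L i v w' := by
  have ha : P.a i v (w + w') = P.a i v w + P.a i v w' := by
    unfold ModelProblem.a
    rw [← integral_add (P.integrable_a i hv hw) (P.integrable_a i hv hw')]
    refine integral_congr_ae ?_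
    filter_upwards [P.adv_term i hw, P.adv_term i hw'] with x hx hx'
    simp only [pderiv_add _ hx.1 hx'.1, Finset.sum_add_distrib, mul_add]
  have hb : P.adv i v (w + w') = P.adv i v w + P.adv i v w' := by
    unfold ModelProblem.adv
    rw [← integral_add (P.integrable_adv i hv hw) (P.integrable_adv i hv hw')]
    refine integral_congr_ae (Filter.Eventually.of_forall fun x => ?_)
    simp only [Pi.add_apply, mul_add]
  rw [ModelProblem.L, ha, hb, ModelProblem.L, ModelProblem.L]
  ring

theorem ModelProblem.L_smul_right (P : ModelProblem n) (i : Fin 2) (c : ℝ)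
    {v w : (Fin (n + 1) → ℝ) → ℝ} (hw : HasBoundedGradient (Ω n i) w) :
    P.L i v (c • w) = c * P.L i v w := by
  have ha : P.a i v (c • w) = c * P.a i v w := by
    unfold ModelProblem.a
    rw [← integral_const_mul]
    refine integral_congr_ae ?_
    filter_upwards [P.adv_term i hw] with x hx
    simp only [pderiv_smul _ c hx.1, Finset.mul_sum]
    refine Finset.sum_congr rfl fun j _ => by ring
  have hb : P.adv i v (c • w) = c * P.adv i v w := by
    unfold ModelProblem.adv
    rw [← integral_const_mul]
    refine integral_congr_ae (Filter.Eventually.of_forall fun x => ?_)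
    simp only [Pi.smul_apply, smul_eq_mul]
    ring
  rw [ModelProblem.L, ha, hb, ModelProblem.L]
  ring

/-! ### Finite-dimensional function spaces as Hilbert spaces -/

/-- A finite-dimensional space of functions on which the `L²(D)` inner product is definite. -/
structure IsL2Space {d : ℕ} (D : Set (Fin d → ℝ)) (V : Submodule ℝ ((Fin d → ℝ) → ℝ)) : Prop where
  finite : FiniteDimensional ℝ V
  integrable : ∀ v ∈ V, ∀ w ∈ V, IntegrableOn (fun x => v x * w x) D
  definite : ∀ v ∈ V, ip D v v = 0 → v = 0

theorem isL2Space_feSpace {d : ℕ} {κ : ElementKind} {k : ℕ} {D B : Set (Fin d → ℝ)}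
    {τ : Set (Set (Fin d → ℝ))} (ho : IsOpen D) (hb : Bornology.IsBounded D)
    (hf : FiniteDimensional ℝ (feSpace κ k D τ B)) : IsL2Space D (feSpace κ k D τ B) :=
  ⟨hf, fun _ hv _ hw => integrableOn_mul_of_continuousOn hb hv.1 hw.1,
    fun _ hv => eq_zero_of_ip_self ho hb hv.1 hv.2.2.2⟩

theorem SpatialMesh.isL2Space_U (S : SpatialMesh n) (i : Fin 2) : IsL2Space (Ω n i) (S.U i) :=
  isL2Space_feSpace (isOpen_Ω i) (isBounded_Ω i) (S.finiteDimensional_U i)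

theorem SpatialMesh.isL2Space_UΓ (S : SpatialMesh n) : IsL2Space (Gam n) S.UΓ :=
  isL2Space_feSpace isOpen_Gam isBounded_Gam S.finiteDimensional_UΓ

section L2Sub

variable {d : ℕ} {D : Set (Fin d → ℝ)} {V : Submodule ℝ ((Fin d → ℝ) → ℝ)}

/-- The space `V` with the Hilbert space structure of `L²(D)`. -/
def L2Sub (_ : IsL2Space D V) : Type := V

variable (h : IsL2Space D V)

/-- The vector space structure of `V`, without its topology of pointwise convergence. -/
abbrev L2Sub.addCommGroup : AddCommGroup (L2Sub h) := inferInstanceAs (AddCommGroup V)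

/-- The vector space structure of `V`, without its topology of pointwise convergence. -/
abbrev L2Sub.module : @Module ℝ (L2Sub h) _ (L2Sub.addCommGroup h).toAddCommMonoid :=
  inferInstanceAs (Module ℝ V)

/-- The `L²(D)` inner product on `V`. -/
@[reducible] def L2Sub.core : @InnerProductSpace.Core ℝ (L2Sub h) _ (L2Sub.addCommGroup h) (L2Sub.module h) :=
  letI := L2Sub.addCommGroup h
  letI := L2Sub.module h
  { inner := fun v w => ip D (Subtype.val (p := (· ∈ V)) v) (Subtype.val (p := (· ∈ V)) w)
    conj_inner_symm := fun v w => by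
      simp only [ip, conj_trivial]; simp_rw [mul_comm]
    re_inner_nonneg := fun v => integral_nonneg fun x => mul_self_nonneg _
    add_left := fun u v w => by
      refine Eq.trans ?_ (integral_add (h.integrable _ u.2 _ w.2) (h.integrable _ v.2 _ w.2))
      exact integral_congr_ae (Filter.Eventually.of_forall fun x => add_mul _ _ _)
    smul_left := fun v w r => by
      refine Eq.trans ?_ (integral_const_mul r _)
      exact integral_congr_ae (Filter.Eventually.of_forall fun x => mul_assoc _ _ _)
    definite := fun v hv => Subtype.ext (h.definite _ v.2 hv) }

instance : NormedAddCommGroup (L2Sub h) :=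
  letI := L2Sub.addCommGroup h
  letI := L2Sub.module h
  (L2Sub.core h).toNormedAddCommGroup

instance : InnerProductSpace ℝ (L2Sub h) :=
  letI := L2Sub.addCommGroup h
  letI := L2Sub.module h
  InnerProductSpace.ofCore (L2Sub.core h).toCore

/-- An element of the Hilbert space as a function. -/
def L2Sub.coe : L2Sub h →ₗ[ℝ] ((Fin d → ℝ) → ℝ) where
  toFun v := Subtype.val (p := (· ∈ V)) v
  map_add' _ _ := rfl
  map_smul' _ _ := rfl

theorem L2Sub.coe_mem (v : L2Sub h) : L2Sub.coe h v ∈ V := v.2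

theorem L2Sub.coe_injective : Function.Injective (L2Sub.coe h) := Subtype.val_injective

/-- A function as an element of the Hilbert space. -/
def L2Sub.mk (v : (Fin d → ℝ) → ℝ) (hv : v ∈ V) : L2Sub h := ⟨v, hv⟩

@[simp] theorem L2Sub.coe_mk (v : (Fin d → ℝ) → ℝ) (hv : v ∈ V) :
    L2Sub.coe h (L2Sub.mk h v hv) = v := rfl

theorem L2Sub.inner_eq (v w : L2Sub h) : inner ℝ v w = ip D (L2Sub.coe h v) (L2Sub.coe h w) := rfl

theorem L2Sub.norm_eq (v : L2Sub h) : ‖v‖ = nrm D (L2Sub.coe h v) := by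
  rw [norm_eq_sqrt_real_inner, L2Sub.inner_eq]; rfl

instance : FiniteDimensional ℝ (L2Sub h) := by
  have := h.finite
  let e : L2Sub h →ₗ[ℝ] V := (L2Sub.coe h).codRestrict V (L2Sub.coe_mem h)
  exact Module.Finite.of_injective e fun v w hvw =>
    L2Sub.coe_injective h (congrArg Subtype.val hvw)

/-- Linear functionals on a finite-dimensional function space are combinations of evaluations. -/
theorem L2Sub.exists_eval_repr (ℓ : L2Sub h →ₗ[ℝ] ℝ) :
    ∃ c : (Fin d → ℝ) →₀ ℝ, ∀ v, ℓ v = c.sum fun x a => a * L2Sub.coe h v x := by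
  let ev : (Fin d → ℝ) → Module.Dual ℝ (L2Sub h) := fun x => (LinearMap.proj x).comp (L2Sub.coe h)
  have hspan : Submodule.span ℝ (range ev) = ⊤ := by
    -- Only the zero function is annihilated by all evaluations, so by duality in finite dimensions
    -- the evaluations span the dual space.
    have h0 : (Submodule.span ℝ (range ev)).dualCoannihilator = ⊥ := by
      rw [eq_bot_iff]
      intro v hv
      rw [Submodule.mem_dualCoannihilator] at hv
      rw [Submodule.mem_bot]
      apply L2Sub.coe_injective h
      funext x
      rw [map_zero]
      exact hv (ev x) (Submodule.subset_span ⟨x, rfl⟩)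
    rw [← Subspace.dualCoannihilator_dualAnnihilator_eq (W := Submodule.span ℝ (range ev)), h0,
      Submodule.dualAnnihilator_bot]
  have hm : ℓ ∈ Submodule.span ℝ (range ev) := by rw [hspan]; trivial
  obtain ⟨c, hc⟩ := Finsupp.mem_span_range_iff_exists_finsupp.1 hm
  refine ⟨c, fun v => ?_⟩
  rw [← hc]
  simp [Finsupp.sum, ev]

end L2Sub

/-! ### Functions of time with values in a Hilbert space -/

section Time

variable {H : Type*} [NormedAddCommGroup H] [InnerProductSpace ℝ H]

/-- In finite dimensions weak continuity is continuity: expand in an orthonormal basis. -/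
theorem continuousOn_of_inner [FiniteDimensional ℝ H] {f : ℝ → H} {s : Set ℝ}
    (hf : ∀ φ, ContinuousOn (fun t => inner ℝ (f t) φ) s) : ContinuousOn f s := by
  let b := stdOrthonormalBasis ℝ H
  have : f = fun t => ∑ i, inner ℝ (f t) (b i) • b i := by
    funext t
    rw [← b.sum_repr' (f t)]
    simp only [b.sum_repr', real_inner_comm]
  rw [this]
  exact continuousOn_finsetSum _ fun i _ => (hf _).smul continuousOn_const

/-- Cauchy–Schwarz against the constant one, read off from the nonnegative integral of `((b - a) g -
m)²`, where `m` is the integral of `g`. -/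
theorem sq_integral_le {g : ℝ → ℝ} {a b : ℝ} (hab : a ≤ b) (hg : IntervalIntegrable g volume a b)
    (hg2 : IntervalIntegrable (fun t => g t ^ 2) volume a b) :
    (∫ t in a..b, g t) ^ 2 ≤ (b - a) * ∫ t in a..b, g t ^ 2 := by
  rcases hab.eq_or_lt with rfl | hlt
  · simp
  set m := ∫ t in a..b, g t with hm
  have h0 : 0 ≤ ∫ t in a..b, ((b - a) * g t - m) ^ 2 :=
    intervalIntegral.integral_nonneg hab fun t _ => sq_nonneg _
  have h1 : ∫ t in a..b, ((b - a) * g t - m) ^ 2 =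
      (b - a) ^ 2 * (∫ t in a..b, g t ^ 2) - 2 * (b - a) * m * m + (b - a) * m ^ 2 := by
    have : ∀ t, ((b - a) * g t - m) ^ 2 =
        (b - a) ^ 2 * g t ^ 2 - 2 * (b - a) * m * g t + m ^ 2 := fun t => by ring
    simp_rw [this]
    rw [intervalIntegral.integral_add ((hg2.const_mul _).sub (hg.const_mul _))
      intervalIntegrable_const, intervalIntegral.integral_sub (hg2.const_mul _) (hg.const_mul _),
      intervalIntegral.integral_const_mul, intervalIntegral.integral_const_mul, ← hm]
    simp
  rw [h1] at h0
  have h2 : 0 ≤ (b - a) * ((b - a) * (∫ t in a..b, g t ^ 2) - m ^ 2) := by nlinarith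
  have := nonneg_of_mul_nonneg_right h2 (sub_pos.2 hlt)
  linarith

/-- `W m`, `m ≤ k`, are the successive weak derivatives of `W 0` on `[0, T]`, square integrable. -/
structure WeakDerivs (T : ℝ) (k : ℕ) (W : ℕ → ℝ → H) : Prop where
  integrable : ∀ m ≤ k, ∀ φ, IntervalIntegrable (fun t => inner ℝ (W m t) φ) volume 0 T
  primitive : ∀ m < k, ∀ φ, ∀ t ∈ Icc 0 T,
    inner ℝ (W m t) φ = inner ℝ (W m 0) φ + ∫ τ in (0 : ℝ)..t, inner ℝ (W (m + 1) τ) φ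
  norm : ∀ m ≤ k, IntervalIntegrable (fun t => ‖W m t‖) volume 0 T
  norm_sq : ∀ m ≤ k, IntervalIntegrable (fun t => ‖W m t‖ ^ 2) volume 0 T

theorem intervalIntegrable_sub_of_mem {f : ℝ → ℝ} {T a b : ℝ}
    (hf : IntervalIntegrable f volume 0 T) (ha : a ∈ Icc 0 T) (hb : b ∈ Icc 0 T) :
    IntervalIntegrable f volume a b := by
  refine hf.mono_set ?_
  rw [uIcc_of_le (ha.1.trans ha.2)]
  exact uIcc_subset_Icc ha hb

/-- Taylor's formula at the right end of an interval, with the integral of the last derivative. -/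
theorem abs_sub_taylor_le {T : ℝ} (k : ℕ) : ∀ f : ℕ → ℝ → ℝ,
    (∀ m ≤ k + 1, IntervalIntegrable (f m) volume 0 T) →
    (∀ m < k + 1, ∀ t ∈ Icc 0 T, f m t = f m 0 + ∫ τ in (0 : ℝ)..t, f (m + 1) τ) →
    ∀ s t, 0 ≤ s → s ≤ t → t ≤ T →
    |f 0 s - ∑ m ∈ Finset.range (k + 1), ((s - t) ^ m / m.factorial) * f m t| ≤
      (t - s) ^ k * ∫ τ in s..t, |f (k + 1) τ| := by
  have base : ∀ f : ℕ → ℝ → ℝ, (IntervalIntegrable (f 1) volume 0 T) →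
      (∀ t ∈ Icc 0 T, f 0 t = f 0 0 + ∫ τ in (0 : ℝ)..t, f 1 τ) →
      ∀ s t, 0 ≤ s → s ≤ t → t ≤ T → f 0 s - f 0 t = - ∫ τ in s..t, f 1 τ := by
    intro f hi hp s t hs hst ht
    have h0 : (0 : ℝ) ∈ Icc 0 T := ⟨le_rfl, hs.trans (hst.trans ht)⟩
    have hsm : s ∈ Icc 0 T := ⟨hs, hst.trans ht⟩
    have htm : t ∈ Icc 0 T := ⟨hs.trans hst, ht⟩
    rw [hp s hsm, hp t htm, ← intervalIntegral.integral_add_adjacent_intervals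
      (intervalIntegrable_sub_of_mem hi h0 hsm) (intervalIntegrable_sub_of_mem hi hsm htm)]
    ring
  induction k with
  | zero =>
    intro f hi hp s t hs hst ht
    simp only [zero_add, Finset.range_one, Finset.sum_singleton, pow_zero, Nat.factorial_zero,
      Nat.cast_one, div_one, one_mul]
    rw [base f (hi 1 le_rfl) (hp 0 one_pos) s t hs hst ht, abs_neg]
    exact intervalIntegral.abs_integral_le_integral_abs hst
  | succ k ih =>
    intro f hi hp s t hs hst ht
    have ih' := ih (fun m => f (m + 1)) (fun m hm => hi (m + 1) (by omega))
      (fun m hm => hp (m + 1) (by omega))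
    have hsm : s ∈ Icc 0 T := ⟨hs, hst.trans ht⟩
    have htm : t ∈ Icc 0 T := ⟨hs.trans hst, ht⟩
    have hf1 := intervalIntegrable_sub_of_mem (hi 1 (by omega)) hsm htm
    -- The Taylor remainder of `f 0` is minus the integral over `(s, t)` of the remainder of `f 1`
    -- of one order less; the induction hypothesis bounds the integrand.
    have hid : f 0 s - ∑ m ∈ Finset.range (k + 1 + 1), ((s - t) ^ m / m.factorial) * f m t =
        - ∫ σ in s..t, (f 1 σ -
          ∑ m ∈ Finset.range (k + 1), ((σ - t) ^ m / m.factorial) * f (m + 1) t) := by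
      rw [intervalIntegral.integral_sub hf1
        (Continuous.intervalIntegrable (by fun_prop) _ _),
        intervalIntegral.integral_finsetSum
          (fun m _ => Continuous.intervalIntegrable (by fun_prop) _ _),
        Finset.sum_range_succ']
      simp only [pow_zero, Nat.factorial_zero, Nat.cast_one, div_one, one_mul]
      have h1 := base f (hi 1 (by omega)) (hp 0 (by omega)) s t hs hst ht
      have h2 : ∀ m : ℕ, ∫ σ in s..t, ((σ - t) ^ m / m.factorial) * f (m + 1) t =
          -((s - t) ^ (m + 1) / (m + 1).factorial * f (m + 1) t) := by
        intro m
        rw [intervalIntegral.integral_mul_const, intervalIntegral.integral_div,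
          intervalIntegral.integral_comp_sub_right (fun x => x ^ m), integral_pow]
        have : (m.factorial : ℝ) ≠ 0 := by positivity
        rw [Nat.factorial_succ]
        push_cast
        simp only [sub_self, ne_eq, Nat.succ_ne_zero, not_false_eq_true, zero_pow, zero_sub]
        field_simp
      simp_rw [h2, Finset.sum_neg_distrib]
      linarith
    rw [hid, abs_neg]
    set I := ∫ τ in s..t, |f (k + 1 + 1) τ| with hI
    have hb : ∀ σ ∈ uIoc s t, ‖f 1 σ -
        ∑ m ∈ Finset.range (k + 1), ((σ - t) ^ m / m.factorial) * f (m + 1) t‖ ≤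
        (t - s) ^ k * I := by
      intro σ hσ
      rw [uIoc_of_le hst] at hσ
      have hσm : σ ∈ Icc 0 T := ⟨hs.trans hσ.1.le, hσ.2.trans ht⟩
      refine (ih' σ t hσm.1 hσ.2 ht).trans ?_
      have hab := (hi (k + 1 + 1) le_rfl).abs
      have hm : ∫ τ in σ..t, |f (k + 1 + 1) τ| ≤ I := by
        rw [hI, ← intervalIntegral.integral_add_adjacent_intervals
          (intervalIntegrable_sub_of_mem hab hsm hσm) (intervalIntegrable_sub_of_mem hab hσm htm)]
        have := intervalIntegral.integral_nonneg (f := fun τ => |f (k + 1 + 1) τ|) (μ := volume)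
          hσ.1.le (fun τ _ => abs_nonneg _)
        linarith
      refine mul_le_mul (pow_le_pow_left₀ (by linarith [hσ.2]) (by linarith [hσ.1]) _) hm
        (intervalIntegral.integral_nonneg hσ.2 fun τ _ => abs_nonneg _)
        (pow_nonneg (by linarith) _)
    have := intervalIntegral.norm_integral_le_of_norm_le_const hb
    rw [Real.norm_eq_abs, abs_of_nonneg (sub_nonneg.2 hst)] at this
    refine this.trans (le_of_eq ?_)
    rw [pow_succ]; ring

/-- The Taylor polynomial at time `t`. -/
def taylor (k : ℕ) (W : ℕ → ℝ → H) (t s : ℝ) : H :=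
  ∑ m ∈ Finset.range (k + 1), ((s - t) ^ m / m.factorial) • W m t

/-- The scalar Taylor formula is applied to inner products with the remainder itself. One factor of
its norm cancels, and Cauchy–Schwarz turns the integral of the last derivative into that of its
square, at the price of one more power of `t - s`. -/
theorem WeakDerivs.norm_sub_taylor_sq_le {T : ℝ} {k : ℕ} {W : ℕ → ℝ → H}
    (hW : WeakDerivs T (k + 1) W) {s t : ℝ} (hs : 0 ≤ s) (hst : s ≤ t) (ht : t ≤ T) :
    ‖W 0 s - taylor k W t s‖ ^ 2 ≤ (t - s) ^ (2 * k + 1) * ∫ τ in s..t, ‖W (k + 1) τ‖ ^ 2 := by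
  have hsm : s ∈ Icc 0 T := ⟨hs, hst.trans ht⟩
  have htm : t ∈ Icc 0 T := ⟨hs.trans hst, ht⟩
  set R := W 0 s - taylor k W t s with hR
  have hn := intervalIntegrable_sub_of_mem (hW.norm (k + 1) le_rfl) hsm htm
  have hn2 := intervalIntegrable_sub_of_mem (hW.norm_sq (k + 1) le_rfl) hsm htm
  have h1 := abs_sub_taylor_le k (fun m t => inner ℝ (W m t) R)
    (fun m hm => hW.integrable m hm R) (fun m hm => hW.primitive m hm R) s t hs hst ht
  have h2 : inner ℝ (W 0 s) R -
      ∑ m ∈ Finset.range (k + 1), ((s - t) ^ m / m.factorial) * inner ℝ (W m t) R = ‖R‖ ^ 2 := by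
    rw [← real_inner_self_eq_norm_sq R]
    conv_rhs => rw [hR, inner_sub_left, taylor, sum_inner]
    simp only [inner_smul_left, conj_trivial]
    rfl
  rw [h2, abs_of_nonneg (sq_nonneg _)] at h1
  have h3 : ∫ τ in s..t, |inner ℝ (W (k + 1) τ) R| ≤ (∫ τ in s..t, ‖W (k + 1) τ‖) * ‖R‖ := by
    rw [← intervalIntegral.integral_mul_const]
    refine intervalIntegral.integral_mono_on hst
      (intervalIntegrable_sub_of_mem (hW.integrable _ le_rfl R) hsm htm).abs (hn.mul_const _)
      fun τ _ => abs_real_inner_le_norm _ _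
  set J := ∫ τ in s..t, ‖W (k + 1) τ‖ with hJ
  have hJ0 : 0 ≤ J := intervalIntegral.integral_nonneg hst fun τ _ => norm_nonneg _
  have hp : 0 ≤ (t - s) ^ k := pow_nonneg (by linarith) _
  have h4 : ‖R‖ ≤ (t - s) ^ k * J := by
    rcases (norm_nonneg R).eq_or_lt with h0 | h0
    · rw [← h0]; positivity
    · have : ‖R‖ * ‖R‖ ≤ ((t - s) ^ k * J) * ‖R‖ := by
        calc ‖R‖ * ‖R‖ = ‖R‖ ^ 2 := by ring
          _ ≤ (t - s) ^ k * (J * ‖R‖) := h1.trans (mul_le_mul_of_nonneg_left h3 hp)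
          _ = _ := by ring
      exact le_of_mul_le_mul_right this h0
  calc ‖R‖ ^ 2 ≤ ((t - s) ^ k * J) ^ 2 := pow_le_pow_left₀ (norm_nonneg _) h4 2
    _ = ((t - s) ^ k) ^ 2 * J ^ 2 := by ring
    _ ≤ ((t - s) ^ k) ^ 2 * ((t - s) * ∫ τ in s..t, ‖W (k + 1) τ‖ ^ 2) :=
        mul_le_mul_of_nonneg_left (sq_integral_le hst hn hn2) (sq_nonneg _)
    _ = _ := by ring

theorem WeakDerivs.continuousOn [FiniteDimensional ℝ H] {T : ℝ} {k : ℕ} {W : ℕ → ℝ → H}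
    (hT : 0 ≤ T) (hW : WeakDerivs T k W) {m : ℕ} (hm : m < k) : ContinuousOn (W m) (Icc 0 T) := by
  refine continuousOn_of_inner fun φ => ?_
  have : ContinuousOn (fun t => inner ℝ (W m 0) φ + ∫ τ in (0 : ℝ)..t, inner ℝ (W (m + 1) τ) φ)
      (Icc 0 T) := by
    have h := intervalIntegral.continuousOn_primitive_interval'
      (hW.integrable (m + 1) hm φ) left_mem_uIcc
    rw [uIcc_of_le hT] at h
    exact continuousOn_const.add h
  exact this.congr fun t ht => hW.primitive m hm φ t ht

/-- Integration by parts against a polynomial, for a function with weak derivative `g` that is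
differentiable in the interior with derivative `du`. -/
theorem integral_polynomial_mul_deriv {T : ℝ} {U g du : ℝ → ℝ}
    (hg : IntervalIntegrable g volume 0 T)
    (hU : ∀ t ∈ Icc 0 T, U t = U 0 + ∫ τ in (0 : ℝ)..t, g τ)
    (hdu : ∀ t ∈ Ioo 0 T, HasDerivAt U (du t) t) (p : Polynomial ℝ) {a b : ℝ}
    (ha : 0 ≤ a) (hab : a ≤ b) (hb : b ≤ T) :
    IntervalIntegrable du volume a b ∧
    ∫ t in a..b, p.eval t * du t =
      p.eval b * U b - p.eval a * U a - ∫ t in a..b, p.derivative.eval t * U t := by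
  have hT : 0 ≤ T := ha.trans (hab.trans hb)
  have ham : a ∈ Icc 0 T := ⟨ha, hab.trans hb⟩
  have hbm : b ∈ Icc 0 T := ⟨ha.trans hab, hb⟩
  have hUc : ContinuousOn U (Icc 0 T) := by
    have h := intervalIntegral.continuousOn_primitive_interval' hg left_mem_uIcc
    rw [uIcc_of_le hT] at h
    exact (continuousOn_const.add h).congr hU
  -- By Lebesgue differentiation the weak derivative `g` and the pointwise derivative `du` agree
  -- almost everywhere, so `du` is integrable.
  have hae : ∀ᵐ t, t ∈ Ioo 0 T → g t = du t := by
    filter_upwards [hg.ae_hasDerivAt_integral] with t ht htm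
    rw [uIcc_of_le hT] at ht
    have h1 := (ht (Ioo_subset_Icc_self htm) 0 ⟨le_rfl, hT⟩).const_add (U 0)
    refine (h1.congr_of_eventuallyEq ?_).unique (hdu t htm)
    filter_upwards [Ioo_mem_nhds htm.1 htm.2] with s hs using hU s (Ioo_subset_Icc_self hs)
  have hae' : g =ᵐ[volume.restrict (uIoc a b)] du := by
    rw [uIoc_of_le hab, ← restrict_Ioo_eq_restrict_Ioc]
    filter_upwards [ae_restrict_of_ae hae, ae_restrict_mem measurableSet_Ioo] with t ht htm
    exact ht ⟨ha.trans_lt htm.1, htm.2.trans_le hb⟩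
  have hi : IntervalIntegrable du volume a b :=
    (intervalIntegrable_sub_of_mem hg ham hbm).congr_ae hae'
  refine ⟨hi, ?_⟩
  refine intervalIntegral.integral_mul_deriv_eq_deriv_mul_of_hasDerivAt
    p.continuous.continuousOn (hUc.mono (uIcc_subset_Icc ham hbm))
    (fun x _ => p.hasDerivAt x) (fun x hx => hdu x ?_)
    (p.derivative.continuous.intervalIntegrable _ _) hi
  rw [min_eq_left hab, max_eq_right hab] at hx
  exact ⟨ha.trans_lt hx.1, hx.2.trans_le hb⟩

end Time

/-! ### Stability of the time stepping scheme -/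

theorem polynomial_integral_sum {ι : Type*} (s : Finset ι) (c : ι → ℝ) (f : ι → ℝ → ℝ) (g : ℝ → ℝ)
    (hf : ∀ i ∈ s, Continuous (f i)) (hg : Continuous g) (a b : ℝ) :
    ∫ t in a..b, (∑ i ∈ s, c i * f i t) * g t = ∑ i ∈ s, c i * ∫ t in a..b, f i t * g t := by
  simp_rw [Finset.sum_mul, mul_assoc]
  have hi : ∀ i ∈ s, IntervalIntegrable (fun t => c i * (f i t * g t)) volume a b :=
    fun i hi => (((hf i hi).mul hg).const_mul (c i)).intervalIntegrable _ _
  rw [intervalIntegral.integral_finsetSum hi]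
  simp_rw [intervalIntegral.integral_const_mul]

theorem integral_sq_polynomial_pos {ψ : Polynomial ℝ} (h : ψ ≠ 0) :
    0 < ∫ t in (-1 : ℝ)..1, ψ.eval t * ψ.eval t := by
  obtain ⟨x, hx, hne⟩ : ∃ x ∈ Icc (-1 : ℝ) 1, ψ.eval x ≠ 0 := by
    by_contra! hcon
    refine h (Polynomial.eq_zero_of_infinite_isRoot ψ ?_)
    exact (Icc_infinite (by norm_num : (-1 : ℝ) < 1)).mono fun x hx => hcon x hx
  exact intervalIntegral.integral_pos (by norm_num) (by fun_prop) (fun _ _ => mul_self_nonneg _)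
    ⟨x, hx, mul_self_pos.2 hne⟩

/-- Orthogonal nonzero polynomials are linearly independent, and there are `q + 1` of them in a
space of dimension `q + 1`. -/
theorem exists_sum_orthogonal {q : ℕ} {ψ : ℕ → Polynomial ℝ}
    (h1 : ∀ j ≤ q, ψ j ≠ 0 ∧ (ψ j).natDegree ≤ j)
    (h2 : ∀ j ≤ q, ∀ l ≤ q, j ≠ l → ∫ t in (-1 : ℝ)..1, (ψ j).eval t * (ψ l).eval t = 0)
    {Q : Polynomial ℝ} (hQ : Q.natDegree ≤ q) :
    ∃ c : ℕ → ℝ, ∀ t, Q.eval t = ∑ j ∈ Finset.range (q + 1), c j * (ψ j).eval t := by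
  have hmem : ∀ P : Polynomial ℝ, P.natDegree ≤ q → P ∈ Polynomial.degreeLT ℝ (q + 1) :=
    fun P hP => Polynomial.mem_degreeLT.2
      (lt_of_le_of_lt Polynomial.degree_le_natDegree (by exact_mod_cast Nat.lt_succ_of_le hP))
  let v : Fin (q + 1) → Polynomial.degreeLT ℝ (q + 1) := fun j =>
    ⟨ψ j, hmem _ ((h1 j (Nat.lt_succ_iff.1 j.2)).2.trans (Nat.lt_succ_iff.1 j.2))⟩
  have hli : LinearIndependent ℝ v := by
    rw [Fintype.linearIndependent_iff]
    intro g hg i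
    have h0 : ∀ t, ∑ j, g j * (ψ j).eval t = 0 := by
      intro t
      have := congrArg (fun P : Polynomial.degreeLT ℝ (q + 1) => (P : Polynomial ℝ).eval t) hg
      simpa [v, Polynomial.eval_finsetSum] using this
    have h3 := polynomial_integral_sum Finset.univ g (fun j t => (ψ j).eval t)
      (fun t => (ψ i).eval t) (fun j _ => (ψ j).continuous) (ψ i).continuous (-1) 1
    simp_rw [h0] at h3
    rw [Finset.sum_eq_single i] at h3
    · have hp := integral_sq_polynomial_pos (h1 i (Nat.lt_succ_iff.1 i.2)).1
      simp only [zero_mul, intervalIntegral.integral_zero] at h3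
      exact (mul_eq_zero.1 h3.symm).resolve_right hp.ne'
    · intro j _ hj
      rw [h2 j (Nat.lt_succ_iff.1 j.2) i (Nat.lt_succ_iff.1 i.2) (Fin.val_ne_of_ne hj), mul_zero]
    · simp
  have hfr : Module.finrank ℝ (Polynomial.degreeLT ℝ (q + 1)) = q + 1 := by
    rw [(Polynomial.degreeLTEquiv ℝ (q + 1)).finrank_eq]; simp
  have : FiniteDimensional ℝ (Polynomial.degreeLT ℝ (q + 1)) :=
    Module.Finite.equiv (Polynomial.degreeLTEquiv ℝ (q + 1)).symm
  have hspan := hli.span_eq_top_of_card_eq_finrank' (by simp [hfr])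
  have hQm : (⟨Q, hmem Q hQ⟩ : Polynomial.degreeLT ℝ (q + 1)) ∈ Submodule.span ℝ (range v) := by
    rw [hspan]; trivial
  obtain ⟨c, hc⟩ := (Submodule.mem_span_range_iff_exists_fun ℝ).1 hQm
  refine ⟨fun j => if hj : j < q + 1 then c ⟨j, hj⟩ else 0, fun t => ?_⟩
  rw [Finset.sum_range]
  have := congrArg (fun P : Polynomial.degreeLT ℝ (q + 1) => (P : Polynomial ℝ).eval t) hc
  simp only [v, AddSubmonoidClass.coe_finsetSum, Polynomial.eval_finsetSum, Submodule.coe_smul,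
    Polynomial.eval_smul, smul_eq_mul] at this
  rw [← this]
  exact Finset.sum_congr rfl fun j _ => by simp only [dif_pos j.2]

theorem integral_polynomial_mul_eq_zero {P : Polynomial ℝ} {m : ℕ}
    (hm : ∀ j < m, ∫ t in (0 : ℝ)..1, t ^ j * P.eval t = 0) {R : Polynomial ℝ}
    (hR : R.natDegree < m) : ∫ t in (0 : ℝ)..1, R.eval t * P.eval t = 0 := by
  simp_rw [Polynomial.eval_eq_sum_range' hR]
  rw [polynomial_integral_sum (Finset.range m) R.coeff (fun j t => t ^ j) (fun t => P.eval t)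
    (fun j _ => continuous_pow j) P.continuous]
  exact Finset.sum_eq_zero fun j hj => by rw [hm j (Finset.mem_range.1 hj), mul_zero]

/-- In the orthogonal expansion of `P`, transported to `(-1, 1)`, the vanishing moments kill the
coefficients of index at most `q - ns`. The remaining `ns` coefficients solve a homogeneous system
with the assumed nonsingular matrix, given by the values at the `θ k`. -/
theorem TimeScheme.Unisolvent.eq_zero {A : TimeScheme} (hA : A.Unisolvent) {P : Polynomial ℝ}
    (hP : P.natDegree ≤ A.q)
    (hm : ∀ j < A.q + 1 - A.ns, ∫ t in (0 : ℝ)..1, t ^ j * P.eval t = 0)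
    (hθ : ∀ k, P.eval (A.θ k) = 0) : P = 0 := by
  obtain ⟨ψ, h1, h2, hdet⟩ := hA
  set m₀ := A.q + 1 - A.ns with hm₀
  have hsum : m₀ + A.ns = A.q + 1 := Nat.sub_add_cancel A.ns_le
  -- `aff` maps `(-1, 1)` onto `(0, 1)`, and `aff'` is its inverse.
  let aff : Polynomial ℝ := Polynomial.C (1 / 2) * Polynomial.X + Polynomial.C (1 / 2)
  let aff' : Polynomial ℝ := Polynomial.C 2 * Polynomial.X + Polynomial.C (-1)
  have hQd : (P.comp aff).natDegree ≤ A.q := by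
    refine Polynomial.natDegree_comp_le.trans ?_
    calc P.natDegree * aff.natDegree ≤ A.q * 1 := Nat.mul_le_mul hP Polynomial.natDegree_linear_le
      _ = A.q := mul_one _
  obtain ⟨c, hc⟩ := exists_sum_orthogonal h1 h2 hQd
  have hPt : ∀ t, P.eval t = (P.comp aff).eval (2 * t - 1) := by
    intro t
    simp only [aff, Polynomial.eval_comp, Polynomial.eval_add, Polynomial.eval_mul,
      Polynomial.eval_C, Polynomial.eval_X]
    congr 1; ring
  have hlow : ∀ l < m₀, c l = 0 := by
    intro l hl
    have hlq : l ≤ A.q := by omega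
    have h3 := polynomial_integral_sum (Finset.range (A.q + 1)) c (fun j t => (ψ j).eval t)
      (fun t => (ψ l).eval t) (fun j _ => (ψ j).continuous) (ψ l).continuous (-1) 1
    rw [Finset.sum_eq_single l] at h3
    rotate_left
    · intro j hj hjl
      rw [h2 j (Nat.lt_succ_iff.1 (Finset.mem_range.1 hj)) l hlq hjl, mul_zero]
    · intro h; exact absurd (Finset.mem_range.2 (Nat.lt_succ_of_le hlq)) h
    have h4 : ∫ t in (0 : ℝ)..1, ((ψ l).comp aff').eval t * P.eval t = 0 := by
      refine integral_polynomial_mul_eq_zero hm (lt_of_le_of_lt ?_ hl)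
      refine Polynomial.natDegree_comp_le.trans ?_
      calc (ψ l).natDegree * aff'.natDegree ≤ l * 1 :=
            Nat.mul_le_mul (h1 l hlq).2 Polynomial.natDegree_linear_le
        _ = l := mul_one _
    have h5 : ∫ t in (-1 : ℝ)..1, (∑ j ∈ Finset.range (A.q + 1), c j * (ψ j).eval t) *
        (ψ l).eval t = 0 := by
      have h6 := intervalIntegral.mul_integral_comp_mul_sub
        (a := 0) (b := 1) (f := fun t => (P.comp aff).eval t * (ψ l).eval t) 2 1
      norm_num at h6
      simp_rw [← hc]
      simp only [Polynomial.eval_comp] at h6 ⊢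
      rw [← h6]
      have h7 : ∀ t, Polynomial.eval (Polynomial.eval (2 * t - 1) aff) P *
          Polynomial.eval (2 * t - 1) (ψ l) = ((ψ l).comp aff').eval t * P.eval t := by
        intro t
        have := hPt t
        rw [Polynomial.eval_comp] at this
        rw [← this, mul_comm]
        simp [aff', Polynomial.eval_comp, sub_eq_add_neg]
      simp_rw [h7, h4, mul_zero]
    rw [h5] at h3
    exact (mul_eq_zero.1 h3.symm).resolve_right (integral_sq_polynomial_pos (h1 l hlq).1).ne'
  have hhigh : (fun m : Fin A.ns => c (m₀ + m)) = 0 := by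
    refine Matrix.eq_zero_of_mulVec_eq_zero hdet ?_
    funext k
    have h3 := hPt (A.θ k)
    rw [hθ k, hc, ← hsum, Finset.sum_range_add, Finset.sum_eq_zero, zero_add,
      Finset.sum_range] at h3
    · simp only [Matrix.mulVec, dotProduct, Matrix.of_apply, Pi.zero_apply]
      rw [h3]
      exact Finset.sum_congr rfl fun m _ => mul_comm _ _
    · intro j hj; rw [hlow j (Finset.mem_range.1 hj), zero_mul]
  refine Polynomial.funext fun t => ?_
  rw [hPt t, hc, Polynomial.eval_zero]
  refine Finset.sum_eq_zero fun j hj => ?_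
  have : c j = 0 := by
    by_cases hj' : j < m₀
    · exact hlow j hj'
    · have hj2 := Finset.mem_range.1 hj
      have := congrFun hhigh ⟨j - m₀, by omega⟩
      simpa [Nat.add_sub_cancel' (not_lt.1 hj')] using this
  rw [this, zero_mul]

/-- The moments and the side values control a polynomial, with constant `C`. -/
def TimeScheme.StableWith (A : TimeScheme) (C : ℝ) : Prop :=
  ∀ P : Polynomial ℝ, P.natDegree ≤ A.q → ∀ τ ∈ Icc (0 : ℝ) 1,
    |P.eval τ| ≤ C * (∑ j ∈ Finset.range (A.q + 1 - A.ns), |∫ t in (0 : ℝ)..1, t ^ j * P.eval t| +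
      ∑ k, |P.eval (A.θ k)|)

/-- Moments and side values form an injective linear map on the coefficient vectors, and an
injective linear map on a finite-dimensional space is bounded below. -/
theorem TimeScheme.Unisolvent.exists_stableWith {A : TimeScheme} (hA : A.Unisolvent) :
    ∃ C, 0 ≤ C ∧ A.StableWith C := by
  let poly : (Fin (A.q + 1) → ℝ) →ₗ[ℝ] Polynomial ℝ :=
    (Polynomial.degreeLT ℝ (A.q + 1)).subtype.comp
      (Polynomial.degreeLTEquiv ℝ (A.q + 1)).symm.toLinearMap
  have hpd : ∀ a, (poly a).natDegree ≤ A.q := fun a => by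
    have := Polynomial.mem_degreeLT.1 ((Polynomial.degreeLTEquiv ℝ (A.q + 1)).symm a).2
    by_cases h0 : poly a = 0
    · rw [h0]; simp
    · exact Nat.lt_succ_iff.1 ((Polynomial.natDegree_lt_iff_degree_lt h0).2 this)
  let mom : ℕ → Polynomial ℝ →ₗ[ℝ] ℝ := fun j =>
    { toFun := fun P => ∫ t in (0 : ℝ)..1, t ^ j * P.eval t
      map_add' := fun P Q => by
        simp only [Polynomial.eval_add, mul_add]
        exact intervalIntegral.integral_add
          (Continuous.intervalIntegrable (by fun_prop) _ _)
          (Continuous.intervalIntegrable (by fun_prop) _ _)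
      map_smul' := fun c P => by
        simp only [Polynomial.eval_smul, smul_eq_mul, RingHom.id_apply]
        rw [← intervalIntegral.integral_const_mul]
        congr 1; funext t; ring }
  let Φ : (Fin (A.q + 1) → ℝ) →ₗ[ℝ] (Fin (A.q + 1 - A.ns) → ℝ) × (Fin A.ns → ℝ) :=
    (LinearMap.prod (LinearMap.pi fun j : Fin (A.q + 1 - A.ns) => mom j)
      (LinearMap.pi fun k => Polynomial.leval (A.θ k))).comp poly
  have hker : LinearMap.ker Φ = ⊥ := by
    rw [LinearMap.ker_eq_bot']
    intro a ha
    have h0 : poly a = 0 := by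
      refine hA.eq_zero (hpd a) (fun j hj => ?_) fun k => ?_
      · exact congrFun (congrArg Prod.fst ha) ⟨j, hj⟩
      · exact congrFun (congrArg Prod.snd ha) k
    have h1 : (Polynomial.degreeLTEquiv ℝ (A.q + 1)).symm a = 0 := Subtype.ext h0
    simpa using h1
  obtain ⟨K, -, hK⟩ := LinearMap.exists_antilipschitzWith Φ hker
  -- On `[0, 1]` each of the `q + 1` monomials is at most one, and `K` bounds the largest
  -- coefficient by the data.
  refine ⟨(A.q + 1) * K, by positivity, fun P hP τ hτ => ?_⟩
  have hPm : P ∈ Polynomial.degreeLT ℝ (A.q + 1) := Polynomial.mem_degreeLT.2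
    (lt_of_le_of_lt Polynomial.degree_le_natDegree (by exact_mod_cast Nat.lt_succ_of_le hP))
  let a := Polynomial.degreeLTEquiv ℝ (A.q + 1) ⟨P, hPm⟩
  have hpa : poly a = P := by simp [poly, a]
  have h1 : ‖a‖ ≤ K * ‖Φ a‖ := by
    have := hK.le_mul_dist a 0
    simpa using this
  set B := ∑ j ∈ Finset.range (A.q + 1 - A.ns), |∫ t in (0 : ℝ)..1, t ^ j * P.eval t| +
      ∑ k, |P.eval (A.θ k)| with hB
  have hs1 : 0 ≤ ∑ j ∈ Finset.range (A.q + 1 - A.ns), |∫ t in (0 : ℝ)..1, t ^ j * P.eval t| :=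
    Finset.sum_nonneg fun _ _ => abs_nonneg _
  have hs2 : 0 ≤ ∑ k, |P.eval (A.θ k)| := Finset.sum_nonneg fun _ _ => abs_nonneg _
  have h2 : ‖Φ a‖ ≤ B := by
    rw [Prod.norm_def]
    refine max_le ?_ ?_
    · refine (pi_norm_le_iff_of_nonneg (by positivity)).2 fun j => ?_
      have : ‖(Φ a).1 j‖ = |∫ t in (0 : ℝ)..1, t ^ (j : ℕ) * P.eval t| := by
        rw [← hpa]; rfl
      rw [this]
      refine le_trans ?_ (le_add_of_nonneg_right hs2)
      exact Finset.single_le_sum (f := fun j : ℕ => |∫ t in (0 : ℝ)..1, t ^ j * P.eval t|)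
        (fun _ _ => abs_nonneg _) (Finset.mem_range.2 j.2)
    · refine (pi_norm_le_iff_of_nonneg (by positivity)).2 fun k => ?_
      have : ‖(Φ a).2 k‖ = |P.eval (A.θ k)| := by
        rw [← hpa]; rfl
      rw [this]
      refine le_trans ?_ (le_add_of_nonneg_left hs1)
      exact Finset.single_le_sum (f := fun k => |P.eval (A.θ k)|)
        (fun _ _ => abs_nonneg _) (Finset.mem_univ k)
  calc |P.eval τ| = |∑ m ∈ Finset.range (A.q + 1), P.coeff m * τ ^ m| := by
        rw [Polynomial.eval_eq_sum_range' (Nat.lt_succ_of_le hP)]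
    _ ≤ ∑ m ∈ Finset.range (A.q + 1), |P.coeff m * τ ^ m| := Finset.abs_sum_le_sum_abs _ _
    _ ≤ ∑ m ∈ Finset.range (A.q + 1), ‖a‖ := by
        refine Finset.sum_le_sum fun m hm => ?_
        rw [abs_mul]
        have h3 : |τ ^ m| ≤ 1 := by
          rw [abs_of_nonneg (pow_nonneg hτ.1 _)]; exact pow_le_one₀ hτ.1 hτ.2
        have h4 : |P.coeff m| ≤ ‖a‖ := norm_le_pi_norm a ⟨m, Finset.mem_range.1 hm⟩
        calc |P.coeff m| * |τ ^ m| ≤ ‖a‖ * 1 :=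
              mul_le_mul h4 h3 (abs_nonneg _) (norm_nonneg _)
          _ = ‖a‖ := mul_one _
    _ = (A.q + 1) * ‖a‖ := by simp
    _ ≤ (A.q + 1) * (K * B) := by gcongr; exact h1.trans (by gcongr)
    _ = _ := by ring

/-! ### One substep -/

section Step

variable {H : Type*} [NormedAddCommGroup H] [InnerProductSpace ℝ H]

theorem abs_integral_polynomial_mul_le {a b : ℝ} (hab : a ≤ b) {p R g : ℝ → ℝ} {x : ℝ}
    (hp : ∀ t ∈ Icc a b, |p t| ≤ 1) (hR : ∀ t ∈ Icc a b, |R t| ≤ g t * x)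
    (hg : IntervalIntegrable g volume a b) :
    |∫ t in a..b, p t * R t| ≤ (∫ t in a..b, g t) * x := by
  rw [← intervalIntegral.integral_mul_const]
  refine intervalIntegral.norm_integral_le_of_norm_le (f := fun t => p t * R t) hab
    (Filter.Eventually.of_forall fun t ht => ?_) (hg.mul_const x)
  have htm := Ioc_subset_Icc_self ht
  rw [Real.norm_eq_abs, abs_mul]
  calc |p t| * |R t| ≤ 1 * (g t * x) :=
        mul_le_mul (hp t htm) (hR t htm) (abs_nonneg _) zero_le_one
    _ = _ := one_mul _

theorem norm_le_of_inner_le {x : H} {c : ℝ} (hc : 0 ≤ c) (h : ∀ φ, inner ℝ x φ ≤ c * ‖φ‖) :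
    ‖x‖ ≤ c := by
  rcases (norm_nonneg x).eq_or_lt with h0 | h0
  · rwa [← h0]
  · have := h x
    rw [real_inner_self_eq_norm_mul_norm] at this
    exact le_of_mul_le_mul_right this h0

/-- The error equation of one substep `(a, b)`: the side value errors are `E₀` and `E₁`, the state
error is `e`, and `R` is the residual of the right hand side. -/
def ErrorEquation (m : ℕ) (a b : ℝ) (E₀ E₁ : H) (e : ℝ → H) (R : ℝ → H → ℝ) : Prop :=
  ∀ p : Polynomial ℝ, p.natDegree ≤ m → ∀ φ : H,
    p.eval b * inner ℝ E₁ φ - ∫ t in a..b, p.derivative.eval t * inner ℝ (e t) φ =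
      p.eval a * inner ℝ E₀ φ - ∫ t in a..b, p.eval t * R t φ

variable {m : ℕ} {a b : ℝ} {E₀ E₁ : H} {e : ℝ → H} {R : ℝ → H → ℝ} {g : ℝ → ℝ}

/-- The constant test polynomial makes the state error drop out of the left-hand side. -/
theorem ErrorEquation.norm_sub_le (h : ErrorEquation m a b E₀ E₁ e R) (hab : a ≤ b)
    (hR : ∀ t ∈ Icc a b, ∀ φ, |R t φ| ≤ g t * ‖φ‖) (hg : IntervalIntegrable g volume a b)
    (hg0 : ∀ t ∈ Icc a b, 0 ≤ g t) : ‖E₁ - E₀‖ ≤ ∫ t in a..b, g t := by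
  refine norm_le_of_inner_le (intervalIntegral.integral_nonneg hab hg0) fun φ => ?_
  have h1 := h 1 (by simp) φ
  simp only [Polynomial.eval_one, one_mul, Polynomial.derivative_one, Polynomial.eval_zero,
    zero_mul, intervalIntegral.integral_zero, sub_zero] at h1
  have h2 := abs_integral_polynomial_mul_le hab (p := fun _ => 1) (R := fun t => R t φ) (x := ‖φ‖)
    (by simp) (fun t ht => hR t ht φ) hg
  simp only [one_mul] at h2
  rw [inner_sub_left, h1]
  linarith [neg_abs_le (∫ t in a..b, R t φ)]

theorem ErrorEquation.abs_moment_le (h : ErrorEquation m a b E₀ E₁ e R) (hab : a < b)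
    (hR : ∀ t ∈ Icc a b, ∀ φ, |R t φ| ≤ g t * ‖φ‖) (hg : IntervalIntegrable g volume a b)
    {j : ℕ} (hj : j < m) (φ : H) :
    |(b - a)⁻¹ * ∫ t in a..b, ((t - a) / (b - a)) ^ j * inner ℝ (e t) φ| ≤
      (‖E₀‖ + ∫ t in a..b, g t) * ‖φ‖ := by
  have hh : 0 < b - a := sub_pos.2 hab
  -- This test polynomial vanishes at `b`, which removes `E₁`, equals `-1` at `a`, and has modulus
  -- at most one between. Its derivative is `j + 1` times the weight of the `j`-th scaled moment.
  let p : Polynomial ℝ :=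
    (Polynomial.C (b - a)⁻¹ * Polynomial.X + Polynomial.C (-((b - a)⁻¹ * a))) ^ (j + 1) - 1
  have hpe : ∀ t, p.eval t = ((t - a) / (b - a)) ^ (j + 1) - 1 := by
    intro t
    simp only [p, Polynomial.eval_sub, Polynomial.eval_pow, Polynomial.eval_add,
      Polynomial.eval_mul, Polynomial.eval_C, Polynomial.eval_X, Polynomial.eval_one]
    congr 2; field_simp; ring
  have hpd : ∀ t, p.derivative.eval t = (j + 1) * ((b - a)⁻¹ * ((t - a) / (b - a)) ^ j) := by
    intro t
    simp only [p, Polynomial.derivative_sub, Polynomial.derivative_pow, Polynomial.derivative_add,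
      Polynomial.derivative_mul, Polynomial.derivative_C, Polynomial.derivative_X,
      Polynomial.derivative_one, Polynomial.eval_sub, Polynomial.eval_pow, Polynomial.eval_add,
      Polynomial.eval_mul, Polynomial.eval_C, Polynomial.eval_X, Polynomial.eval_one,
      Polynomial.eval_zero, Nat.add_sub_cancel]
    have : (b - a)⁻¹ * t + -((b - a)⁻¹ * a) = (t - a) / (b - a) := by field_simp; ring
    rw [this]; push_cast; ring
  have hdeg : p.natDegree ≤ m := by
    refine (Polynomial.natDegree_sub_le _ _).trans (max_le ?_ (by simp))
    refine (Polynomial.natDegree_pow_le).trans ?_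
    calc (j + 1) * _ ≤ (j + 1) * 1 := Nat.mul_le_mul_left _ Polynomial.natDegree_linear_le
      _ ≤ m := by omega
  have h1 := h p hdeg φ
  have ha : p.eval a = -1 := by rw [hpe]; simp
  have hb : p.eval b = 0 := by rw [hpe, div_self hh.ne']; simp
  have h2 := abs_integral_polynomial_mul_le hab.le (p := fun t => p.eval t) (R := fun t => R t φ)
    (x := ‖φ‖) (fun t ht => by
      rw [hpe]
      have h0 : 0 ≤ (t - a) / (b - a) := div_nonneg (by linarith [ht.1]) hh.le
      have h1 : (t - a) / (b - a) ≤ 1 := (div_le_one hh).2 (by linarith [ht.2])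
      have h2 := pow_nonneg h0 (j + 1)
      have h3 : ((t - a) / (b - a)) ^ (j + 1) ≤ 1 := pow_le_one₀ h0 h1
      rw [abs_le]; constructor <;> linarith) (fun t ht => hR t ht φ) hg
  rw [ha, hb] at h1
  simp_rw [hpd] at h1
  have h3 : ∫ t in a..b, ((j : ℝ) + 1) * ((b - a)⁻¹ * ((t - a) / (b - a)) ^ j) * inner ℝ (e t) φ =
      (j + 1) * ((b - a)⁻¹ * ∫ t in a..b, ((t - a) / (b - a)) ^ j * inner ℝ (e t) φ) := by
    rw [← intervalIntegral.integral_const_mul, ← intervalIntegral.integral_const_mul]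
    congr 1; funext t; ring
  rw [h3] at h1
  set X := (b - a)⁻¹ * ∫ t in a..b, ((t - a) / (b - a)) ^ j * inner ℝ (e t) φ
  set Y := ∫ t in a..b, p.eval t * R t φ
  have h4 : ((j : ℝ) + 1) * X = inner ℝ E₀ φ + Y := by linarith
  have h5 : |inner ℝ E₀ φ + Y| ≤ (‖E₀‖ + ∫ t in a..b, g t) * ‖φ‖ := by
    rw [add_mul]
    exact (abs_add_le _ _).trans (add_le_add (abs_real_inner_le_norm _ _) h2)
  rw [← h4, abs_mul] at h5
  refine le_trans ?_ h5
  have : (1 : ℝ) ≤ |(j : ℝ) + 1| := by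
    rw [abs_of_nonneg (by positivity)]; linarith [Nat.cast_nonneg (α := ℝ) j]
  exact le_mul_of_one_le_left (abs_nonneg _) this

/-- A function with values in a Hilbert space that is in the weak sense polynomial of degree at
most `q`. -/
def WeakPolynomial (q : ℕ) (ξ : ℝ → H) : Prop :=
  ∀ φ, ∃ P : Polynomial ℝ, P.natDegree ≤ q ∧ ∀ t, inner ℝ (ξ t) φ = P.eval t

/-- The stability constant is applied to the scalar polynomials `(ξ, φ)`, rescaled to `[0, 1]`. The
error equation bounds the moments of `e`, and those of `ξ` differ from them by at most `β`. The side
times may lie to the left of `a`, where `ξ` still makes sense as a polynomial but no closeness to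
`e` is assumed; hence the side values enter as separate terms. -/
theorem ErrorEquation.norm_polynomial_le {A : TimeScheme} {C β : ℝ} (hC : 0 ≤ C)
    (hA : A.StableWith C) (h : ErrorEquation (A.q + 1 - A.ns) a b E₀ E₁ e R) (hab : a < b)
    (hR : ∀ t ∈ Icc a b, ∀ φ, |R t φ| ≤ g t * ‖φ‖) (hg : IntervalIntegrable g volume a b)
    (hg0 : ∀ t ∈ Icc a b, 0 ≤ g t) (he : ContinuousOn e (Icc a b)) {ξ : ℝ → H}
    (hξ : WeakPolynomial A.q ξ) (hβ : ∀ t ∈ Icc a b, ‖e t - ξ t‖ ≤ β) {t : ℝ} (ht : t ∈ Icc a b) :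
    ‖ξ t‖ ≤ C * ((A.q + 1) * (‖E₀‖ + (∫ t in a..b, g t) + β) +
      ∑ k, ‖ξ (a + A.θ k * (b - a))‖) := by
  have hh : 0 < b - a := sub_pos.2 hab
  have hβ0 : 0 ≤ β := (norm_nonneg _).trans (hβ t ht)
  have hg1 : 0 ≤ ∫ t in a..b, g t := intervalIntegral.integral_nonneg hab.le hg0
  refine norm_le_of_inner_le (by positivity) fun φ => ?_
  obtain ⟨P, hPd, hP⟩ := hξ φ
  let Q : Polynomial ℝ := P.comp (Polynomial.C (b - a) * Polynomial.X + Polynomial.C a)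
  have hQd : Q.natDegree ≤ A.q := by
    refine Polynomial.natDegree_comp_le.trans ?_
    calc _ ≤ A.q * 1 := Nat.mul_le_mul hPd Polynomial.natDegree_linear_le
      _ = A.q := mul_one _
  have hQ : ∀ τ, Q.eval τ = inner ℝ (ξ (a + τ * (b - a))) φ := by
    intro τ
    rw [hP]
    simp only [Q, Polynomial.eval_comp, Polynomial.eval_add, Polynomial.eval_mul,
      Polynomial.eval_C, Polynomial.eval_X]
    congr 1; ring
  have hτ : (t - a) / (b - a) ∈ Icc (0 : ℝ) 1 :=
    ⟨div_nonneg (by linarith [ht.1]) hh.le, (div_le_one hh).2 (by linarith [ht.2])⟩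
  have hQt : Q.eval ((t - a) / (b - a)) = inner ℝ (ξ t) φ := by
    rw [hQ, div_mul_cancel₀ _ hh.ne']; congr 2; ring
  rw [← hQt]
  refine (le_abs_self _).trans ((hA Q hQd _ hτ).trans ?_)
  rw [mul_assoc]
  refine mul_le_mul_of_nonneg_left ?_ hC
  rw [add_mul]
  refine add_le_add ?_ ?_
  · have hmom : ∀ j ∈ Finset.range (A.q + 1 - A.ns), |∫ t in (0 : ℝ)..1, t ^ j * Q.eval t| ≤
        (‖E₀‖ + (∫ t in a..b, g t) + β) * ‖φ‖ := by
      intro j hj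
      have h1 := h.abs_moment_le hab hR hg (Finset.mem_range.1 hj) φ
      have hie : ContinuousOn (fun t => ((t - a) / (b - a)) ^ j * inner ℝ (e t) φ) (uIcc a b) := by
        rw [uIcc_of_le hab.le]
        exact (by fun_prop : ContinuousOn (fun t => ((t - a) / (b - a)) ^ j) _).mul
          (he.inner continuousOn_const)
      have hiξ : Continuous (fun t => ((t - a) / (b - a)) ^ j * inner ℝ (ξ t) φ) := by
        simp_rw [hP]; fun_prop
      have h2 : ∫ τ in (0 : ℝ)..1, τ ^ j * Q.eval τ =
          (b - a)⁻¹ * ∫ t in a..b, ((t - a) / (b - a)) ^ j * inner ℝ (ξ t) φ := by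
        have h3 := intervalIntegral.integral_comp_add_mul (a := 0) (b := 1)
          (fun t => ((t - a) / (b - a)) ^ j * inner ℝ (ξ t) φ) hh.ne' a
        simp only [mul_zero, add_zero, mul_one, add_sub_cancel, smul_eq_mul] at h3
        rw [← h3]
        congr 1; funext τ
        rw [hQ, add_sub_cancel_left, mul_div_cancel_left₀ _ hh.ne', mul_comm τ (b - a)]
      have h4 : ∫ τ in (0 : ℝ)..1, τ ^ j * Q.eval τ =
          (b - a)⁻¹ * (∫ t in a..b, ((t - a) / (b - a)) ^ j * inner ℝ (e t) φ) -
          (b - a)⁻¹ * ∫ t in a..b, ((t - a) / (b - a)) ^ j * inner ℝ (e t - ξ t) φ := by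
        rw [h2, ← mul_sub, ← intervalIntegral.integral_sub hie.intervalIntegrable]
        · congr 2; funext t; rw [inner_sub_left]; ring
        · have := hie.intervalIntegrable.sub (hiξ.intervalIntegrable (μ := volume) a b)
          refine this.congr fun t _ => ?_
          simp only [inner_sub_left]; ring
      have h5 : |(b - a)⁻¹ * ∫ t in a..b, ((t - a) / (b - a)) ^ j * inner ℝ (e t - ξ t) φ| ≤
          β * ‖φ‖ := by
        have h6 := abs_integral_polynomial_mul_le hab.le (p := fun t => ((t - a) / (b - a)) ^ j)
          (R := fun t => inner ℝ (e t - ξ t) φ) (g := fun _ => β) (x := ‖φ‖) (fun t ht => by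
            have h0 : 0 ≤ (t - a) / (b - a) := div_nonneg (by linarith [ht.1]) hh.le
            have h1 : (t - a) / (b - a) ≤ 1 := (div_le_one hh).2 (by linarith [ht.2])
            rw [abs_of_nonneg (pow_nonneg h0 j)]
            exact pow_le_one₀ h0 h1)
          (fun t ht => (abs_real_inner_le_norm _ _).trans
            (mul_le_mul_of_nonneg_right (hβ t ht) (norm_nonneg _))) intervalIntegrable_const
        rw [intervalIntegral.integral_const, smul_eq_mul] at h6
        rw [abs_mul, abs_of_pos (inv_pos.2 hh)]
        calc _ ≤ (b - a)⁻¹ * ((b - a) * β * ‖φ‖) := by gcongr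
          _ = β * ‖φ‖ := by field_simp
      rw [h4, add_mul]
      exact (abs_sub _ _).trans (add_le_add h1 h5)
    refine (Finset.sum_le_sum hmom).trans ?_
    rw [Finset.sum_const, Finset.card_range, nsmul_eq_mul, mul_assoc]
    refine mul_le_mul_of_nonneg_right ?_ (by positivity)
    exact_mod_cast Nat.sub_le _ _
  · rw [Finset.sum_mul]
    refine Finset.sum_le_sum fun k _ => ?_
    rw [hQ]
    exact abs_real_inner_le_norm _ _

/-- The pointwise bound `‖e‖ ≤ β + ‖ξ‖` is squared and integrated. The factor 4 comes from the
square of a sum of four terms, and the summand 1 in the constant from `β`, the distance of `e` from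
`ξ`. -/
theorem ErrorEquation.integral_norm_sq_le {A : TimeScheme} {C β s d r : ℝ} (hC : 0 ≤ C)
    (hA : A.StableWith C) (h : ErrorEquation (A.q + 1 - A.ns) a b E₀ E₁ e R) (hab : a < b)
    (hR : ∀ t ∈ Icc a b, ∀ φ, |R t φ| ≤ g t * ‖φ‖) (hg : IntervalIntegrable g volume a b)
    (hg0 : ∀ t ∈ Icc a b, 0 ≤ g t) (he : ContinuousOn e (Icc a b)) {ξ : ℝ → H}
    (hξ : WeakPolynomial A.q ξ) (hβ : ∀ t ∈ Icc a b, ‖e t - ξ t‖ ≤ β) (hs : ‖E₀‖ ≤ s)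
    (hd : 0 ≤ d) (hr : 0 ≤ r) (hside : ∑ k, ‖ξ (a + A.θ k * (b - a))‖ ≤ d * s + r) :
    ∫ t in a..b, ‖e t‖ ^ 2 ≤ 4 * (C * (A.q + 2 + d) + 1) ^ 2 *
      ((b - a) * (s ^ 2 + (∫ t in a..b, g t) ^ 2 + β ^ 2 + r ^ 2)) := by
  have hh : 0 < b - a := sub_pos.2 hab
  have hβ0 : 0 ≤ β := (norm_nonneg _).trans (hβ a ⟨le_rfl, hab.le⟩)
  have hg1 : 0 ≤ ∫ t in a..b, g t := intervalIntegral.integral_nonneg hab.le hg0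
  have hs0 : 0 ≤ s := (norm_nonneg _).trans hs
  set G := ∫ t in a..b, g t with hG
  set C₁ := C * (A.q + 2 + d) + 1 with hC₁
  have hsup : ∀ t ∈ Icc a b, ‖e t‖ ≤ C₁ * (s + G + β + r) := by
    intro t ht
    have h1 := h.norm_polynomial_le hC hA hab hR hg hg0 he hξ hβ ht
    have h2 : ‖e t‖ ≤ ‖e t - ξ t‖ + ‖ξ t‖ := by
      simpa using norm_add_le (e t - ξ t) (ξ t)
    have h3 : C * ((A.q + 1) * (‖E₀‖ + G + β) + ∑ k, ‖ξ (a + A.θ k * (b - a))‖) ≤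
        C * ((A.q + 2 + d) * (s + G + β + r)) := by
      refine mul_le_mul_of_nonneg_left ?_ hC
      have h4 : (A.q + 1) * (‖E₀‖ + G + β) ≤ ((A.q : ℝ) + 1) * (s + G + β) := by gcongr
      have h5 : 0 ≤ d * (G + β + r) := by positivity
      have h6 : 0 ≤ ((A.q : ℝ) + 1) * r := by positivity
      nlinarith
    have h4 : C₁ * (s + G + β + r) =
        C * ((A.q + 2 + d) * (s + G + β + r)) + (s + G + β + r) := by rw [hC₁]; ring
    rw [h4]
    linarith [hβ t ht]
  have hcont : ContinuousOn (fun t => ‖e t‖ ^ 2) (uIcc a b) := by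
    rw [uIcc_of_le hab.le]; exact he.norm.pow 2
  calc ∫ t in a..b, ‖e t‖ ^ 2 ≤ ∫ t in a..b, (C₁ * (s + G + β + r)) ^ 2 :=
        intervalIntegral.integral_mono_on hab.le hcont.intervalIntegrable intervalIntegrable_const
          fun t ht => pow_le_pow_left₀ (norm_nonneg _) (hsup t ht) 2
    _ = (b - a) * C₁ ^ 2 * (s + G + β + r) ^ 2 := by
        rw [intervalIntegral.integral_const, smul_eq_mul]; ring
    _ ≤ (b - a) * C₁ ^ 2 * (4 * (s ^ 2 + G ^ 2 + β ^ 2 + r ^ 2)) := by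
        refine mul_le_mul_of_nonneg_left ?_ (by positivity)
        nlinarith [sq_nonneg (s - G), sq_nonneg (s - β), sq_nonneg (s - r), sq_nonneg (G - β),
          sq_nonneg (G - r), sq_nonneg (β - r)]
    _ = _ := by ring

end Step

/-! ### A discrete Gronwall inequality over the coupling windows -/

/-- For `0 ≤ x ≤ 1 / 2` one has `(1 + 2 x) (1 - x) ≥ 1`, which resolves the implicit term. -/
theorem gronwall_step {x a b s : ℝ} (hx : 0 ≤ x) (hx' : x ≤ 1 / 2) (hs : 0 ≤ s)
    (h : s ≤ a + x * s + b) : s ≤ (1 + 2 * x) * (a + b) := by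
  have h1 : (1 - x) * s ≤ a + b := by linarith
  have h2 : (1 + 2 * x) * ((1 - x) * s) ≤ (1 + 2 * x) * (a + b) :=
    mul_le_mul_of_nonneg_left h1 (by linarith)
  have h3 : 0 ≤ x * (1 - 2 * x) * s := mul_nonneg (mul_nonneg hx (by linarith)) hs
  nlinarith

theorem discrete_gronwall {S B : ℕ → ℝ} {x Z : ℝ} (hx : 0 ≤ x) (hx' : x ≤ 1 / 2) {M N : ℕ}
    (hS : ∀ w, 0 ≤ S w) (hB : ∀ w, 0 ≤ B w) (hZ : S M ≤ Z)
    (h : ∀ w, M < w → w ≤ N → S w ≤ S (w - 1) + x * S w + B w) (k : ℕ) (hk : M + k ≤ N) :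
    S (M + k) ≤ (1 + 2 * x) ^ k * (Z + ∑ j ∈ Finset.range k, B (M + 1 + j)) := by
  induction k with
  | zero => simpa using hZ
  | succ k ih =>
    have h1 := gronwall_step hx hx' (hS _) (h (M + (k + 1)) (by omega) hk)
    have h2 : M + (k + 1) - 1 = M + k := by omega
    have h3 : M + (k + 1) = M + 1 + k := by omega
    rw [h2] at h1
    refine h1.trans ?_
    rw [Finset.sum_range_succ, pow_succ', mul_assoc]
    refine mul_le_mul_of_nonneg_left ?_ (by linarith)
    have h4 : 1 ≤ (1 + 2 * x) ^ k := one_le_pow₀ (by linarith)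
    have h5 := ih (by omega)
    rw [← h3] at *
    nlinarith [hB (M + (k + 1))]

/-- The constant of the recursion for the side value errors. -/
def recConst (C : ℝ) : ℝ := C * ((1 + C) * (2 * C * (C + 1)) + C) + 1

theorem one_le_recConst {C : ℝ} (hC : 0 ≤ C) : 1 ≤ recConst C :=
  le_add_of_nonneg_left (by positivity)

/-- After the flux bound is inserted, the state error on the right has the factor `C (1 + C) dt²`,
at most one half, and moves to the left. -/
theorem state_error_absorb {C dt S e f D : ℝ} (hC : 0 ≤ C) (hdt0 : 0 ≤ dt) (hdt1 : dt ≤ 1)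
    (hx : C * (1 + C) * dt ≤ 1 / 2) (he : 0 ≤ e) (hD : 0 ≤ D)
    (ha : e ≤ C * (dt * S ^ 2 + dt ^ 2 * (e + f) + D)) (hb : f ≤ C * (e + D)) :
    e ≤ 2 * C * (dt * S ^ 2 + (C + 1) * D) := by
  have h1 : C * dt ^ 2 * (e + f) ≤ C * dt ^ 2 * (e + C * (e + D)) := by gcongr
  have h0 : C * (1 + C) * dt ^ 2 ≤ 1 / 2 := by
    calc C * (1 + C) * dt ^ 2 = C * (1 + C) * dt * dt := by ring
      _ ≤ 1 / 2 * 1 := by gcongr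
      _ = 1 / 2 := mul_one _
  have h2 : C * (1 + C) * dt ^ 2 * e ≤ 1 / 2 * e := mul_le_mul_of_nonneg_right h0 he
  have h3 : C * (C * dt ^ 2) * D ≤ C * (C * 1) * D := by
    gcongr; exact pow_le_one₀ hdt0 hdt1
  linarith

/-- The increment of the side error carries a factor `dt` of its own, so its square is bounded by
`(dt S)² + dt D` up to constants. After the square root, `S` has the full factor `dt`, as Gronwall's
argument needs; a factor `√dt` would not sum up over the windows. -/
theorem side_error_rec {C dt S S' e f D y : ℝ} (hC : 0 ≤ C) (hdt0 : 0 ≤ dt) (hS : 0 ≤ S)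
    (hD : 0 ≤ D) (he : e ≤ 2 * C * (dt * S ^ 2 + (C + 1) * D)) (hb : f ≤ C * (e + D))
    (hy : S ≤ S' + y) (hy2 : y ^ 2 ≤ C * (dt * (e + f))) :
    S ≤ S' + recConst C * dt * S + recConst C * √(dt * D) := by
  set C₂ := (1 + C) * (2 * C * (C + 1)) + C with hC₂
  have hC₂0 : 0 ≤ C₂ := by positivity
  have hr : recConst C = C * C₂ + 1 := rfl
  have hef : e + f ≤ C₂ * (dt * S ^ 2 + D) := by
    have hA : 0 ≤ dt * S ^ 2 := by positivity
    generalize dt * S ^ 2 = a at *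
    have h2 : (1 + C) * e ≤ (1 + C) * (2 * C * ((C + 1) * (a + D))) := by
      gcongr
      refine he.trans ?_
      gcongr
      have := mul_nonneg hC hA
      linarith
    have h3 : 0 ≤ C * a := mul_nonneg hC hA
    have h4 : C₂ * (a + D) = (1 + C) * (2 * C * ((C + 1) * (a + D))) + C * (a + D) := by
      rw [hC₂]; ring
    rw [h4]
    linarith
  have h0 : 0 ≤ √(dt * D) := Real.sqrt_nonneg _
  have h1 : y ^ 2 ≤ (recConst C * (dt * S + √(dt * D))) ^ 2 := by
    have hsq : √(dt * D) ^ 2 = dt * D := Real.sq_sqrt (mul_nonneg hdt0 hD)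
    have h2 : y ^ 2 ≤ C * (dt * (C₂ * (dt * S ^ 2 + D))) := by
      refine hy2.trans ?_
      gcongr
    have h3 : C * C₂ ≤ recConst C ^ 2 := by
      have := mul_nonneg hC hC₂0
      rw [hr]; nlinarith
    have h4 : (dt * S) ^ 2 + dt * D ≤ (dt * S + √(dt * D)) ^ 2 := by
      have : 0 ≤ dt * S * √(dt * D) := mul_nonneg (mul_nonneg hdt0 hS) h0
      nlinarith
    calc y ^ 2 ≤ C * C₂ * ((dt * S) ^ 2 + dt * D) := by linarith
      _ ≤ recConst C ^ 2 * (dt * S + √(dt * D)) ^ 2 := by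
          refine mul_le_mul h3 h4 ?_ (sq_nonneg _)
          have := mul_nonneg hdt0 hD
          positivity
      _ = _ := by ring
  have h2 : y ≤ recConst C * (dt * S + √(dt * D)) :=
    (le_abs_self _).trans (abs_le_of_sq_le_sq h1 (mul_nonneg (by linarith [one_le_recConst hC])
      (add_nonneg (mul_nonneg hdt0 hS) h0)))
  linarith

/-- The roles are: `S` the largest side value error so far, `e` and `f` the squared state and flux
errors, `D` the squared defects, `Z` the initial error, `X²` the total defect. Both constants are
fixed before `N` and `N₀`, since the growth over at most `N` windows of length `T / N` is bounded by
an exponential in `T`. -/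
theorem window_gronwall {C T : ℝ} (hC : 0 ≤ C) (hT : 0 < T) : ∃ C' > 0, ∃ δ > 0, ∀ N : ℕ, 0 < N →
    T / N ≤ δ → ∀ N₀, 1 ≤ N₀ → ∀ (S e f D : ℕ → ℝ) (Z X : ℝ), 0 ≤ Z → 0 ≤ X →
    (∀ w, 0 ≤ S w) → (∀ w, 0 ≤ e w) → (∀ w, 0 ≤ D w) → S (N₀ - 1) ≤ Z →
    (∀ w ∈ Icc N₀ N, e w ≤ C * (T / N * S w ^ 2 + (T / N) ^ 2 * (e w + f w) + D w)) →
    (∀ w ∈ Icc N₀ N, f w ≤ C * (e w + D w)) →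
    (∀ w ∈ Icc N₀ N, ∃ y, S w ≤ S (w - 1) + y ∧ y ^ 2 ≤ C * (T / N * (e w + f w))) →
    ∑ w ∈ Finset.Icc N₀ N, D w ≤ X ^ 2 →
    ∀ w ∈ Icc N₀ N, S w ≤ C' * (Z + X) ∧ e w ≤ (C' * (Z + X)) ^ 2 := by
  set C₃ := recConst C with hC₃
  have hC₃1 : 1 ≤ C₃ := one_le_recConst hC
  set C₄ := Real.exp (2 * C₃ * T) * (1 + C₃ * √T) with hC₄
  have hC₄0 : 0 < C₄ := by positivity
  -- `C₅` dominates `C₄`, for the side error; it is also at least one and at least `2 C (C₄² + C +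
  -- 1)`, so its square bounds the factor in the state error.
  set C₅ := C₄ + 2 * C * (C₄ ^ 2 + C + 1) + 1 with hC₅
  have hC₄5 : C₄ ≤ C₅ := by
    have : 0 ≤ 2 * C * (C₄ ^ 2 + C + 1) := by positivity
    linarith
  -- This threshold makes both `C₃ dt` and `C (1 + C) dt` at most one half, for the Gronwall step
  -- and for the absorption.
  refine ⟨C₅, by positivity, min 1 (1 / (2 * (C₃ + C * (1 + C)))), by positivity, ?_⟩
  intro N hN hdt N₀ hN₀ S e f D Z X hZ hX hS he hD hSZ ha hb hc hd
  set dt := T / N with hdtdef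
  have hdt0 : 0 < dt := by positivity
  have hdt1 : dt ≤ 1 := hdt.trans (min_le_left _ _)
  have hdt2 : (C₃ + C * (1 + C)) * dt ≤ 1 / 2 := by
    have := hdt.trans (min_le_right _ _)
    rw [le_div_iff₀ (by positivity)] at this
    linarith
  have hCC : 0 ≤ C * (1 + C) * dt := by positivity
  have hC₃dt : 0 ≤ C₃ * dt := by positivity
  have hx : C₃ * dt ≤ 1 / 2 := by linarith
  have hx2 : C * (1 + C) * dt ≤ 1 / 2 := by linarith
  have he2 : ∀ w ∈ Icc N₀ N, e w ≤ 2 * C * (dt * S w ^ 2 + (C + 1) * D w) := fun w hw =>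
    state_error_absorb hC hdt0.le hdt1 hx2 (he w) (hD w) (ha w hw) (hb w hw)
  have hrec : ∀ w, N₀ - 1 < w → w ≤ N →
      S w ≤ S (w - 1) + C₃ * dt * S w + C₃ * √(dt * D w) := by
    intro w hw hwN
    have hwm : w ∈ Icc N₀ N := ⟨by omega, hwN⟩
    obtain ⟨y, hy, hy2⟩ := hc w hwm
    exact side_error_rec hC hdt0.le (hS w) (hD w) (he2 w hwm) (hb w hwm) hy hy2
  have hB0 : ∀ w, 0 ≤ C₃ * √(dt * D w) := fun w => mul_nonneg (by linarith) (Real.sqrt_nonneg _)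
  have hSw : ∀ w ∈ Icc N₀ N, S w ≤ C₄ * (Z + X) := by
    intro w hw
    obtain ⟨k, rfl⟩ : ∃ k, w = N₀ - 1 + k := ⟨w - (N₀ - 1), by have := hw.1; omega⟩
    have hkN : N₀ - 1 + k ≤ N := hw.2
    have h1 := discrete_gronwall (by positivity) hx hS hB0 hSZ hrec k hkN
    have h2 : (1 + 2 * (C₃ * dt)) ^ k ≤ Real.exp (2 * C₃ * T) := by
      have h3 : 1 + 2 * (C₃ * dt) ≤ Real.exp (2 * (C₃ * dt)) := by
        linarith [Real.add_one_le_exp (2 * (C₃ * dt))]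
      calc (1 + 2 * (C₃ * dt)) ^ k ≤ Real.exp (2 * (C₃ * dt)) ^ k := by gcongr
        _ = Real.exp (k * (2 * (C₃ * dt))) := (Real.exp_nat_mul _ _).symm
        _ ≤ _ := by
          refine Real.exp_le_exp.2 ?_
          have h4 : (k : ℝ) * dt ≤ T := by
            rw [hdtdef, mul_div_assoc', div_le_iff₀ (by positivity), mul_comm]
            have : (k : ℝ) ≤ N := by exact_mod_cast (by omega : k ≤ N)
            gcongr
          calc (k : ℝ) * (2 * (C₃ * dt)) = 2 * C₃ * (k * dt) := by ring
            _ ≤ 2 * C₃ * T := by gcongr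
    -- Cauchy–Schwarz over the windows: there are at most `N` of them and `N dt = T`, so the sum of
    -- the square roots is at most `√T X`.
    have h3 : ∑ j ∈ Finset.range k, C₃ * √(dt * D (N₀ - 1 + 1 + j)) ≤ C₃ * (√T * X) := by
      rw [← Finset.mul_sum]
      refine mul_le_mul_of_nonneg_left ?_ (by linarith)
      have h4 := sq_sum_le_card_mul_sum_sq (s := Finset.range k)
        (f := fun j => √(dt * D (N₀ - 1 + 1 + j)))
      refine (le_abs_self _).trans (abs_le_of_sq_le_sq (h4.trans ?_) (by positivity))
      have h5 : ∑ j ∈ Finset.range k, D (N₀ - 1 + 1 + j) ≤ ∑ w ∈ Finset.Icc N₀ N, D w := by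
        rw [← Finset.sum_image (f := D) (g := fun j => N₀ - 1 + 1 + j) (by intro a _ b _ h; simpa using h)]
        refine Finset.sum_le_sum_of_subset_of_nonneg ?_ fun _ _ _ => hD _
        intro v hv
        obtain ⟨j, hj, rfl⟩ := Finset.mem_image.1 hv
        have := Finset.mem_range.1 hj
        exact Finset.mem_Icc.2 ⟨by omega, by omega⟩
      simp_rw [fun j => Real.sq_sqrt (mul_nonneg hdt0.le (hD (N₀ - 1 + 1 + j)))]
      rw [Finset.card_range, ← Finset.mul_sum, mul_pow, Real.sq_sqrt hT.le, ← mul_assoc]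
      refine mul_le_mul ?_ (h5.trans hd) (Finset.sum_nonneg fun _ _ => hD _) hT.le
      rw [hdtdef, mul_div_assoc', div_le_iff₀ (by positivity), mul_comm]
      have : (k : ℝ) ≤ N := by exact_mod_cast (by omega : k ≤ N)
      gcongr
    calc S (N₀ - 1 + k) ≤ _ := h1
      _ ≤ Real.exp (2 * C₃ * T) * (Z + C₃ * (√T * X)) := by
          refine mul_le_mul h2 (by linarith) ?_ (Real.exp_pos _).le
          exact add_nonneg hZ (Finset.sum_nonneg fun _ _ => hB0 _)
      _ ≤ Real.exp (2 * C₃ * T) * ((1 + C₃ * √T) * (Z + X)) := by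
          refine mul_le_mul_of_nonneg_left ?_ (Real.exp_pos _).le
          have : 0 ≤ C₃ * √T * Z := by positivity
          linarith
      _ = _ := by rw [hC₄]; ring
  intro w hw
  have h1 := hSw w hw
  refine ⟨h1.trans (by gcongr), ?_⟩
  have h2 := he2 w hw
  have h3 : D w ≤ X ^ 2 :=
    (Finset.single_le_sum (f := D) (fun v _ => hD v) (Finset.mem_Icc.2 hw)).trans hd
  have h4 : S w ^ 2 ≤ (C₄ * (Z + X)) ^ 2 := pow_le_pow_left₀ (hS w) h1 2
  have h5 : X ^ 2 ≤ (Z + X) ^ 2 := pow_le_pow_left₀ hX (by linarith) 2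
  have h6 : dt * S w ^ 2 + (C + 1) * D w ≤ (C₄ ^ 2 + C + 1) * (Z + X) ^ 2 := by
    have : dt * S w ^ 2 ≤ 1 * S w ^ 2 := by gcongr
    have : (C + 1) * D w ≤ (C + 1) * (Z + X) ^ 2 := by gcongr; exact h3.trans h5
    linarith
  calc e w ≤ 2 * C * ((C₄ ^ 2 + C + 1) * (Z + X) ^ 2) := h2.trans (by gcongr)
    _ = 2 * C * (C₄ ^ 2 + C + 1) * (Z + X) ^ 2 := by ring
    _ ≤ C₅ ^ 2 * (Z + X) ^ 2 := by
        gcongr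
        have h7 : 0 ≤ 2 * C * (C₄ ^ 2 + C + 1) := by positivity
        have h8 : 2 * C * (C₄ ^ 2 + C + 1) ≤ C₅ := by linarith
        have h9 : 1 ≤ C₅ := by linarith
        exact h8.trans (le_self_pow₀ h9 two_ne_zero)
    _ = _ := by ring

/-! ### Quasi-optimality of the projections on a window -/

/-- Here `X` is exact, `Z` its perturbed projection and `T` a comparison function from the
projection space. Write `‖Z - T‖² = (Z - X, Z - T) + (X - T, Z - T)`. The hypothesis and Young's
inequality each cost a quarter of the left side, so `‖Z - T‖²` integrates to at most `2 μ` plus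
twice the integral of `‖X - T‖²`; the triangle inequality gives the factors 4 and 6. -/
theorem integral_norm_sub_sq_le {H : Type*} [NormedAddCommGroup H] [InnerProductSpace ℝ H]
    {a b μ : ℝ} (hab : a ≤ b) {X Z T : ℝ → H} (hX : ContinuousOn X (Icc a b))
    (hZ : ContinuousOn Z (Icc a b)) (hT : ContinuousOn T (Icc a b))
    (h : ∫ t in a..b, inner ℝ (Z t - X t) (Z t - T t) ≤ μ + 1 / 4 * ∫ t in a..b, ‖Z t - T t‖ ^ 2) :
    ∫ t in a..b, ‖X t - Z t‖ ^ 2 ≤ 4 * μ + 6 * ∫ t in a..b, ‖X t - T t‖ ^ 2 := by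
  rw [← uIcc_of_le hab] at hX hZ hT
  have i1 : IntervalIntegrable (fun t => inner ℝ (Z t - X t) (Z t - T t)) volume a b :=
    ((hZ.sub hX).inner (hZ.sub hT)).intervalIntegrable
  have i2 : IntervalIntegrable (fun t => ‖Z t - T t‖ ^ 2) volume a b :=
    ((hZ.sub hT).norm.pow 2).intervalIntegrable
  have i3 : IntervalIntegrable (fun t => ‖X t - T t‖ ^ 2) volume a b :=
    ((hX.sub hT).norm.pow 2).intervalIntegrable
  have i4 : IntervalIntegrable (fun t => ‖X t - Z t‖ ^ 2) volume a b :=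
    ((hX.sub hZ).norm.pow 2).intervalIntegrable
  have h1 : ∫ t in a..b, ‖Z t - T t‖ ^ 2 ≤ (∫ t in a..b, inner ℝ (Z t - X t) (Z t - T t)) +
      ((∫ t in a..b, ‖X t - T t‖ ^ 2) + 1 / 4 * ∫ t in a..b, ‖Z t - T t‖ ^ 2) := by
    rw [← intervalIntegral.integral_const_mul, ← intervalIntegral.integral_add i3 (i2.const_mul _),
      ← intervalIntegral.integral_add i1 (i3.add (i2.const_mul _))]
    refine intervalIntegral.integral_mono_on hab i2 (i1.add (i3.add (i2.const_mul _)))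
      fun t _ => ?_
    have h2 : ‖Z t - T t‖ ^ 2 =
        inner ℝ (Z t - X t) (Z t - T t) + inner ℝ (X t - T t) (Z t - T t) := by
      rw [← inner_add_left, sub_add_sub_cancel, real_inner_self_eq_norm_sq]
    have h3 := real_inner_le_norm (X t - T t) (Z t - T t)
    nlinarith [sq_nonneg (‖X t - T t‖ - 1 / 2 * ‖Z t - T t‖)]
  have h2 : ∫ t in a..b, ‖X t - Z t‖ ^ 2 ≤
      2 * (∫ t in a..b, ‖X t - T t‖ ^ 2) + 2 * ∫ t in a..b, ‖Z t - T t‖ ^ 2 := by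
    rw [← intervalIntegral.integral_const_mul, ← intervalIntegral.integral_const_mul,
      ← intervalIntegral.integral_add (i3.const_mul _) (i2.const_mul _)]
    refine intervalIntegral.integral_mono_on hab i4 ((i3.const_mul _).add (i2.const_mul _))
      fun t _ => ?_
    have h3 : ‖X t - Z t‖ ≤ ‖X t - T t‖ + ‖Z t - T t‖ := by
      have := norm_sub_le (X t - T t) (Z t - T t)
      rwa [sub_sub_sub_cancel_right] at this
    nlinarith [norm_nonneg (X t - Z t), sq_nonneg (‖X t - T t‖ - ‖Z t - T t‖)]
  linarith

/-! ### Overlapping intervals -/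

/-- A point lies in at most `σ` of the intervals, up to endpoints. In the induction on `σ` the
leftmost cells split off from the intervals are adjacent, and together cost one full integral. -/
theorem sum_integral_overlapping_le {ω : ℝ → ℝ} (hω : Integrable ω) (h0 : ∀ t, 0 ≤ ω t) {h : ℝ}
    (hh : 0 ≤ h) (J σ : ℕ) :
    ∑ j ∈ Finset.range J, ∫ t in (((j : ℝ) + 1 - σ) * h)..(((j : ℝ) + 1) * h), ω t ≤
      σ * ∫ t, ω t := by
  have hi : ∀ a b, IntervalIntegrable ω volume a b := fun a b => hω.intervalIntegrable
  induction σ with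
  | zero => simp
  | succ σ ih =>
    have h1 : ∀ j : ℕ, ∫ t in (((j : ℝ) + 1 - (σ + 1 : ℕ)) * h)..(((j : ℝ) + 1) * h), ω t =
        (∫ t in (((j : ℝ) - σ) * h)..(((j + 1 : ℕ) - σ : ℝ) * h), ω t) +
        ∫ t in (((j : ℝ) + 1 - σ) * h)..(((j : ℝ) + 1) * h), ω t := by
      intro j
      push_cast
      rw [intervalIntegral.integral_add_adjacent_intervals (hi _ _) (hi _ _)]
      congr 2; ring
    simp_rw [h1]
    rw [Finset.sum_add_distrib, intervalIntegral.sum_integral_adjacent_intervals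
      (a := fun j : ℕ => ((j : ℝ) - σ) * h) (fun _ _ => hi _ _)]
    have h2 : ∫ t in (((0 : ℕ) : ℝ) - σ) * h..((J : ℝ) - σ) * h, ω t ≤ ∫ t, ω t := by
      rw [intervalIntegral.integral_of_le (by gcongr; simp)]
      exact setIntegral_le_integral hω (Filter.Eventually.of_forall h0)
    push_cast
    push_cast at h2
    linarith

/-! ### Functions of time with values in a finite-dimensional function space -/

section OfFun

variable {d : ℕ} {D : Set (Fin d → ℝ)} {V : Submodule ℝ ((Fin d → ℝ) → ℝ)} (h : IsL2Space D V)

open Classical in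
/-- A function as an element of the Hilbert space, zero if it is not in `V`. -/
def L2Sub.ofFun (v : (Fin d → ℝ) → ℝ) : L2Sub h := if hv : v ∈ V then L2Sub.mk h v hv else 0

theorem L2Sub.coe_ofFun {v : (Fin d → ℝ) → ℝ} (hv : v ∈ V) :
    L2Sub.coe h (L2Sub.ofFun h v) = v := by
  rw [L2Sub.ofFun, dif_pos hv, L2Sub.coe_mk]

theorem L2Sub.inner_ofFun {v : (Fin d → ℝ) → ℝ} (hv : v ∈ V) (φ : L2Sub h) :
    inner ℝ (L2Sub.ofFun h v) φ = ip D v (L2Sub.coe h φ) := by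
  rw [L2Sub.inner_eq, L2Sub.coe_ofFun h hv]

theorem L2Sub.norm_ofFun {v : (Fin d → ℝ) → ℝ} (hv : v ∈ V) :
    ‖L2Sub.ofFun h v‖ = nrm D v := by
  rw [L2Sub.norm_eq, L2Sub.coe_ofFun h hv]

/-- An inner product with a fixed element is a finite combination of point values. This carries
continuity, integrability and differentiation in time, given pointwise in space, over to the Hilbert
space. -/
theorem L2Sub.exists_inner_repr (φ : L2Sub h) : ∃ c : (Fin d → ℝ) →₀ ℝ, ∀ v ∈ V,
    inner ℝ (L2Sub.ofFun h v) φ = ∑ x ∈ c.support, c x * v x := by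
  obtain ⟨c, hc⟩ := L2Sub.exists_eval_repr h (innerₗ (L2Sub h) φ)
  refine ⟨c, fun v hv => ?_⟩
  have := hc (L2Sub.ofFun h v)
  rw [L2Sub.coe_ofFun h hv, innerₗ_apply_apply, real_inner_comm] at this
  exact this

theorem L2Sub.continuousOn_ofFun {v : ℝ → (Fin d → ℝ) → ℝ} {s : Set ℝ} (hv : ∀ t ∈ s, v t ∈ V)
    (hc : ∀ x, ContinuousOn (fun t => v t x) s) :
    ContinuousOn (fun t => L2Sub.ofFun h (v t)) s := by
  refine continuousOn_of_inner fun φ => ?_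
  obtain ⟨c, hcφ⟩ := L2Sub.exists_inner_repr h φ
  have : ContinuousOn (fun t => ∑ x ∈ c.support, c x * v t x) s :=
    continuousOn_finsetSum _ fun x _ => continuousOn_const.mul (hc x)
  exact this.congr fun t ht => hcφ _ (hv t ht)

theorem HasTimeDerivatives.weakDerivs {T : ℝ} (hT : 0 < T) {k : ℕ} {v : ℝ → (Fin d → ℝ) → ℝ}
    {w : ℕ → ℝ → (Fin d → ℝ) → ℝ} (hw : HasTimeDerivatives D V T k v w) :
    WeakDerivs T k fun m t => L2Sub.ofFun h (w m t) := by
  have hint : ∀ m ≤ k, ∀ c : (Fin d → ℝ) →₀ ℝ,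
      IntervalIntegrable (fun t => ∑ x ∈ c.support, c x * w m t x) volume 0 T :=
    fun m hm c => by
      have := IntervalIntegrable.sum c.support (f := fun x t => c x * w m t x) (μ := volume)
        (a := 0) (b := T) fun x _ => (hw.integrable m hm x).const_mul (c x)
      refine this.congr fun t _ => ?_
      simp [Finset.sum_apply]
  have hmemLp : ∀ m ≤ k, MemLp (fun t => ‖L2Sub.ofFun h (w m t)‖) 2 (volume.restrict (Ioo 0 T)) :=
    fun m hm => by
      refine (memLp_congr_ae ?_).2 (hw.norm_memLp m hm)
      filter_upwards [ae_restrict_mem measurableSet_Ioo] with t ht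
      exact L2Sub.norm_ofFun h (hw.mem m hm t (Ioo_subset_Icc_self ht))
  refine ⟨fun m hm φ => ?_, fun m hm φ t ht => ?_, fun m hm => ?_, fun m hm => ?_⟩
  · obtain ⟨c, hc⟩ := L2Sub.exists_inner_repr h φ
    refine (hint m hm c).congr fun t ht => ?_
    rw [uIoc_of_le hT.le] at ht
    exact (hc _ (hw.mem m hm t (Ioc_subset_Icc_self ht))).symm
  · obtain ⟨c, hc⟩ := L2Sub.exists_inner_repr h φ
    have h0 : (0 : ℝ) ∈ Icc 0 T := ⟨le_rfl, hT.le⟩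
    rw [hc _ (hw.mem m hm.le t ht), hc _ (hw.mem m hm.le 0 h0)]
    have h1 : ∫ τ in (0 : ℝ)..t, inner ℝ (L2Sub.ofFun h (w (m + 1) τ)) φ =
        ∫ τ in (0 : ℝ)..t, ∑ x ∈ c.support, c x * w (m + 1) τ x := by
      refine intervalIntegral.integral_congr fun τ hτ => ?_
      rw [uIcc_of_le ht.1] at hτ
      exact hc _ (hw.mem (m + 1) hm τ ⟨hτ.1, hτ.2.trans ht.2⟩)
    have h2 : ∀ x ∈ c.support, IntervalIntegrable (fun τ => c x * w (m + 1) τ x) volume 0 t :=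
      fun x _ => intervalIntegrable_sub_of_mem ((hw.integrable (m + 1) hm x).const_mul _) h0 ht
    rw [h1, intervalIntegral.integral_finsetSum h2, ← Finset.sum_add_distrib]
    refine Finset.sum_congr rfl fun x _ => ?_
    rw [intervalIntegral.integral_const_mul, hw.primitive m hm x t ht]
    ring
  · rw [intervalIntegrable_iff, uIoc_of_le hT.le, IntegrableOn, ← restrict_Ioo_eq_restrict_Ioc]
    exact (hmemLp m hm).integrable (by norm_num)
  · rw [intervalIntegrable_iff, uIoc_of_le hT.le, IntegrableOn, ← restrict_Ioo_eq_restrict_Ioc]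
    exact (hmemLp m hm).integrable_sq

variable {h} in
theorem polyInTime.mem {q : ℕ} {y : ℝ → (Fin d → ℝ) → ℝ} (hy : y ∈ polyInTime V q) (t : ℝ) :
    y t ∈ V := by
  obtain ⟨c, hc, hyc⟩ := hy
  rw [hyc t]
  exact V.sum_mem fun m _ => V.smul_mem _ (hc m)

theorem polyInTime.ofFun_eq {q : ℕ} {y : ℝ → (Fin d → ℝ) → ℝ} (hy : y ∈ polyInTime V q) :
    ∃ c : Fin (q + 1) → L2Sub h, ∀ t, L2Sub.ofFun h (y t) = ∑ m : Fin (q + 1), t ^ (m : ℕ) • c m := by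
  have hmem := polyInTime.mem hy
  obtain ⟨c, hc, hyc⟩ := hy
  refine ⟨fun m => L2Sub.mk h (c m) (hc m), fun t => L2Sub.coe_injective h ?_⟩
  rw [L2Sub.coe_ofFun h (hmem t), hyc t, map_sum]
  simp

theorem polyInTime.continuous_ofFun {q : ℕ} {y : ℝ → (Fin d → ℝ) → ℝ}
    (hy : y ∈ polyInTime V q) : Continuous fun t => L2Sub.ofFun h (y t) := by
  obtain ⟨c, hc⟩ := polyInTime.ofFun_eq h hy
  simp_rw [hc]
  fun_prop

theorem weakPolynomial_sum {H : Type*} [NormedAddCommGroup H] [InnerProductSpace ℝ H] {q : ℕ}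
    {ι : Type*} (s : Finset ι) (p : ι → Polynomial ℝ) (hp : ∀ m ∈ s, (p m).natDegree ≤ q)
    (c : ι → H) : WeakPolynomial q fun t => ∑ m ∈ s, (p m).eval t • c m := fun φ =>
  ⟨∑ m ∈ s, Polynomial.C (inner ℝ (c m) φ) * p m,
    Polynomial.natDegree_sum_le_of_forall_le _ _ fun m hm =>
      (Polynomial.natDegree_C_mul_le _ _).trans (hp m hm),
    fun t => by
      rw [sum_inner, Polynomial.eval_finsetSum]
      refine Finset.sum_congr rfl fun m _ => ?_
      rw [real_inner_smul_left, Polynomial.eval_mul, Polynomial.eval_C, mul_comm]⟩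

theorem WeakPolynomial.sub {H : Type*} [NormedAddCommGroup H] [InnerProductSpace ℝ H] {q : ℕ}
    {ξ ζ : ℝ → H} (hξ : WeakPolynomial q ξ) (hζ : WeakPolynomial q ζ) :
    WeakPolynomial q fun t => ξ t - ζ t := fun φ => by
  obtain ⟨P, hP, h1⟩ := hξ φ
  obtain ⟨Q, hQ, h2⟩ := hζ φ
  exact ⟨P - Q, (Polynomial.natDegree_sub_le _ _).trans (max_le hP hQ), fun t => by
    rw [inner_sub_left, h1, h2, Polynomial.eval_sub]⟩

theorem polyInTime.weakPolynomial {q : ℕ} {y : ℝ → (Fin d → ℝ) → ℝ} (hy : y ∈ polyInTime V q) :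
    WeakPolynomial q fun t => L2Sub.ofFun h (y t) := by
  obtain ⟨c, hc⟩ := polyInTime.ofFun_eq h hy
  simp_rw [hc]
  have := weakPolynomial_sum (q := q) Finset.univ
    (fun m : Fin (q + 1) => (Polynomial.X ^ (m : ℕ) : Polynomial ℝ))
    (fun m _ => by
      rw [Polynomial.natDegree_X_pow]; exact Nat.lt_succ_iff.1 m.2) c
  simpa using this

/-- The scalar factors of Taylor's formula. -/
def taylorFactor (t : ℝ) (m : ℕ) : Polynomial ℝ :=
  Polynomial.C ((m.factorial : ℝ)⁻¹) * (Polynomial.X - Polynomial.C t) ^ m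

theorem natDegree_taylorFactor_le (t : ℝ) (m : ℕ) : (taylorFactor t m).natDegree ≤ m := by
  refine (Polynomial.natDegree_C_mul_le _ _).trans (Polynomial.natDegree_pow_le.trans ?_)
  rw [Polynomial.natDegree_X_sub_C, mul_one]

theorem taylor_eq_sum {H : Type*} [NormedAddCommGroup H] [InnerProductSpace ℝ H] (k : ℕ)
    (W : ℕ → ℝ → H) (t s : ℝ) :
    taylor k W t s = ∑ m ∈ Finset.range (k + 1), (taylorFactor t m).eval s • W m t := by
  refine Finset.sum_congr rfl fun m _ => ?_
  simp [taylorFactor, div_eq_inv_mul]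

theorem weakPolynomial_taylor {H : Type*} [NormedAddCommGroup H] [InnerProductSpace ℝ H] (k : ℕ)
    (W : ℕ → ℝ → H) (t : ℝ) : WeakPolynomial k (taylor k W t) := by
  have := weakPolynomial_sum (q := k) (Finset.range (k + 1)) (taylorFactor t)
    (fun m hm => (natDegree_taylorFactor_le t m).trans (Nat.lt_succ_iff.1 (Finset.mem_range.1 hm)))
    fun m => W m t
  simpa only [← taylor_eq_sum] using this

theorem continuous_taylor {H : Type*} [NormedAddCommGroup H] [InnerProductSpace ℝ H] (k : ℕ)
    (W : ℕ → ℝ → H) (t : ℝ) : Continuous (taylor k W t) := by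
  unfold taylor; fun_prop

theorem polyInTime_sum {q : ℕ} {ι : Type*} (s : Finset ι) (p : ι → Polynomial ℝ)
    (hp : ∀ m ∈ s, (p m).natDegree ≤ q) (c : ι → L2Sub h) :
    (fun t => L2Sub.coe h (∑ m ∈ s, (p m).eval t • c m)) ∈ polyInTime V q := by
  refine ⟨fun l => L2Sub.coe h (∑ m ∈ s, (p m).coeff l • c m), fun l => L2Sub.coe_mem h _,
    fun t => ?_⟩
  simp_rw [← map_smul]
  rw [← map_sum]
  congr 1
  simp_rw [Finset.smul_sum, smul_smul]
  rw [Finset.sum_comm]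
  refine Finset.sum_congr rfl fun m hm => ?_
  rw [← Finset.sum_smul, Polynomial.eval_eq_sum_range' (Nat.lt_succ_of_le (hp m hm)),
    Finset.sum_range]
  simp_rw [mul_comm]

theorem polyInTime_smul {q : ℕ} {p : Polynomial ℝ} (hp : p.natDegree ≤ q) (φ : L2Sub h) :
    (fun t => p.eval t • L2Sub.coe h φ) ∈ polyInTime V q := by
  have := polyInTime_sum h (q := q) (Finset.univ : Finset Unit) (fun _ => p) (fun _ _ => hp)
    fun _ => φ
  simpa using this

/-- This makes a discrete trace or flux minus a Taylor polynomial an admissible test function of the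
projections on a window. -/
theorem polyInTime_sub_taylor {q : ℕ} {y : ℝ → (Fin d → ℝ) → ℝ} (hy : y ∈ polyInTime V q)
    (W : ℕ → ℝ → L2Sub h) (b : ℝ) :
    (fun t => L2Sub.coe h (L2Sub.ofFun h (y t) - taylor q W b t)) ∈ polyInTime V q := by
  have h1 := polyInTime_sum h (q := q) (Finset.range (q + 1)) (taylorFactor b)
    (fun m hm => (natDegree_taylorFactor_le b m).trans (Nat.lt_succ_iff.1 (Finset.mem_range.1 hm)))
    fun m => W m b
  simp only [← taylor_eq_sum] at h1
  have hmem := polyInTime.mem hy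
  obtain ⟨c, hc, hyc⟩ := hy
  obtain ⟨c', hc', hyc'⟩ := h1
  refine ⟨fun m => c m - c' m, fun m => V.sub_mem (hc m) (hc' m), fun t => ?_⟩
  have hyt : L2Sub.coe h (taylor q W b t) = ∑ m : Fin (q + 1), t ^ (m : ℕ) • c' m := hyc' t
  simp only [map_sub, L2Sub.coe_ofFun h (hmem t), hyt, smul_sub, Finset.sum_sub_distrib]
  rw [hyc]

end OfFun

/-! ### The bilinear forms on the finite element spaces -/

theorem ip_comm {d : ℕ} (D : Set (Fin d → ℝ)) (v w : (Fin d → ℝ) → ℝ) : ip D v w = ip D w v := by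
  simp only [ip, mul_comm]

theorem ip_smul_right {d : ℕ} (D : Set (Fin d → ℝ)) (c : ℝ) (v w : (Fin d → ℝ) → ℝ) :
    ip D v (c • w) = c * ip D v w := by
  simp only [ip, Pi.smul_apply, smul_eq_mul, ← integral_const_mul]
  congr 1; funext x; ring

theorem ip_add_left {d : ℕ} {D : Set (Fin d → ℝ)} {v v' w : (Fin d → ℝ) → ℝ}
    (h : IntegrableOn (fun x => v x * w x) D) (h' : IntegrableOn (fun x => v' x * w x) D) :
    ip D (v + v') w = ip D v w + ip D v' w := by
  simp only [ip, Pi.add_apply, add_mul]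
  exact integral_add h h'

/-- Bilinear maps on finite-dimensional spaces are bounded. For `L` this stands in for an inverse
inequality and is the source of the mesh dependence of the constants. -/
theorem exists_bound_bilinear {E F : Type*} [NormedAddCommGroup E] [NormedSpace ℝ E]
    [FiniteDimensional ℝ E] [NormedAddCommGroup F] [NormedSpace ℝ F] [FiniteDimensional ℝ F]
    (B : E →ₗ[ℝ] F →ₗ[ℝ] ℝ) : ∃ c, 0 ≤ c ∧ ∀ v w, |B v w| ≤ c * ‖v‖ * ‖w‖ :=
  ⟨‖B.toContinuousBilinearMap‖, ContinuousLinearMap.opNorm_nonneg _, fun v w =>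
    B.toContinuousBilinearMap.le_opNorm₂ v w⟩

theorem continuous_bilinear_left {E F : Type*} [NormedAddCommGroup E] [NormedSpace ℝ E]
    [FiniteDimensional ℝ E] [NormedAddCommGroup F] [NormedSpace ℝ F] [FiniteDimensional ℝ F]
    (B : E →ₗ[ℝ] F →ₗ[ℝ] ℝ) : Continuous fun z : E × F => B z.1 z.2 :=
  B.toContinuousBilinearMap.continuous₂

/-- The space `U_i` as a Hilbert space. -/
abbrev SpatialMesh.HU (S : SpatialMesh n) (i : Fin 2) : Type := L2Sub (S.isL2Space_U i)

/-- The space `U_Γ` as a Hilbert space. -/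
abbrev SpatialMesh.HΓ (S : SpatialMesh n) : Type := L2Sub S.isL2Space_UΓ

theorem SpatialMesh.hasBoundedGradient_coe (S : SpatialMesh n) (i : Fin 2) (v : S.HU i) :
    HasBoundedGradient (Ω n i) (L2Sub.coe _ v) :=
  S.hasBoundedGradient i (L2Sub.coe_mem _ v)

/-- The form `L` on the finite element space. -/
def formL (S : SpatialMesh n) (P : ModelProblem n) (i : Fin 2) : S.HU i →ₗ[ℝ] S.HU i →ₗ[ℝ] ℝ :=
  LinearMap.mk₂ ℝ (fun v w => P.L i (L2Sub.coe _ v) (L2Sub.coe _ w))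
    (fun v v' w => by
      rw [map_add]
      exact P.L_add_left i (S.hasBoundedGradient_coe i v) (S.hasBoundedGradient_coe i v')
        (S.hasBoundedGradient_coe i w))
    (fun c v w => by
      rw [map_smul]; exact P.L_smul_left i c (S.hasBoundedGradient_coe i v))
    (fun v w w' => by
      rw [map_add]
      exact P.L_add_right i (S.hasBoundedGradient_coe i v) (S.hasBoundedGradient_coe i w)
        (S.hasBoundedGradient_coe i w'))
    (fun c v w => by
      rw [map_smul]; exact P.L_smul_right i c (S.hasBoundedGradient_coe i w))

theorem formL_apply (S : SpatialMesh n) (P : ModelProblem n) (i : Fin 2) (v w : S.HU i) :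
    formL S P i v w = P.L i (L2Sub.coe _ v) (L2Sub.coe _ w) := rfl

theorem SpatialMesh.integrable_trace (S : SpatialMesh n) (i : Fin 2) (v : S.HU i) (μ : S.HΓ) :
    IntegrableOn (fun y => trace (L2Sub.coe _ v) y * L2Sub.coe _ μ y) (Gam n) :=
  integrableOn_mul_of_continuousOn isBounded_Gam
    (trace_continuousOn (L2Sub.coe_mem _ v).1) (L2Sub.coe_mem _ μ).1

/-- The pairing of traces with functions on the interface. -/
def formΓ (S : SpatialMesh n) (i : Fin 2) : S.HU i →ₗ[ℝ] S.HΓ →ₗ[ℝ] ℝ :=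
  LinearMap.mk₂ ℝ (fun v μ => ip (Gam n) (trace (L2Sub.coe _ v)) (L2Sub.coe _ μ))
    (fun v v' μ => by
      rw [map_add]
      exact ip_add_left (S.integrable_trace i v μ) (S.integrable_trace i v' μ))
    (fun c v μ => by
      rw [map_smul, ip_comm, ip_comm (Gam n) (trace _)]
      exact ip_smul_right _ c _ _)
    (fun v μ μ' => by
      rw [map_add, ip_comm, ip_comm (Gam n) (trace _), ip_comm (Gam n) (trace _)]
      refine ip_add_left ?_ ?_
      · simpa only [mul_comm] using S.integrable_trace i v μ
      · simpa only [mul_comm] using S.integrable_trace i v μ')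
    (fun c v μ => by rw [map_smul]; exact ip_smul_right _ c _ _)

theorem formΓ_apply (S : SpatialMesh n) (i : Fin 2) (v : S.HU i) (μ : S.HΓ) :
    formΓ S i v μ = ip (Gam n) (trace (L2Sub.coe _ v)) (L2Sub.coe _ μ) := rfl

/-! ### Regular solutions of the semi-discrete problem -/

/-- A solution of the semi-discrete problem with the regularity in time that matches the orders
of the scheme. -/
structure RegularSolution (S : SpatialMesh n) (P : ModelProblem n) (A : TimeScheme) where
  u : Fin 2 → ℝ → (Fin (n + 1) → ℝ) → ℝ
  F : Fin 2 → ℝ → (Fin n → ℝ) → ℝ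
  sol : IsSemiDiscreteSolution S P u F
  Du : Fin 2 → ℕ → ℝ → (Fin (n + 1) → ℝ) → ℝ
  hu : ∀ i, HasTimeDerivatives (Ω n i) (S.U i) P.tf (A.q + 1) (u i) (Du i)
  DΓ : Fin 2 → ℕ → ℝ → (Fin n → ℝ) → ℝ
  hΓ : ∀ i, HasTimeDerivatives (Gam n) S.UΓ P.tf (A.r i + 1) (fun t => trace (u i t)) (DΓ i)
  DF : Fin 2 → ℕ → ℝ → (Fin n → ℝ) → ℝ
  hF : ∀ i, HasTimeDerivatives (Gam n) S.UΓ P.tf (A.r i + 1) (F i) (DF i)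

namespace RegularSolution

variable {S : SpatialMesh n} {P : ModelProblem n} {A : TimeScheme} (X : RegularSolution S P A)

/-- The state in the Hilbert space `U_i`. -/
def uH (i : Fin 2) (t : ℝ) : S.HU i := L2Sub.ofFun _ (X.u i t)

/-- The time derivatives of the state in the Hilbert space `U_i`. -/
def W (i : Fin 2) (m : ℕ) (t : ℝ) : S.HU i := L2Sub.ofFun _ (X.Du i m t)

/-- The trace of the state and its time derivatives in the Hilbert space `U_Γ`. -/
def γ (i : Fin 2) (m : ℕ) (t : ℝ) : S.HΓ := L2Sub.ofFun _ (X.DΓ i m t)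

/-- The flux and its time derivatives in the Hilbert space `U_Γ`. -/
def Φ (i : Fin 2) (m : ℕ) (t : ℝ) : S.HΓ := L2Sub.ofFun _ (X.DF i m t)

theorem weakDerivs_W (i : Fin 2) : WeakDerivs P.tf (A.q + 1) (X.W i) :=
  (X.hu i).weakDerivs _ P.tf_pos

theorem weakDerivs_γ (i : Fin 2) : WeakDerivs P.tf (A.r i + 1) (X.γ i) :=
  (X.hΓ i).weakDerivs _ P.tf_pos

theorem weakDerivs_Φ (i : Fin 2) : WeakDerivs P.tf (A.r i + 1) (X.Φ i) :=
  (X.hF i).weakDerivs _ P.tf_pos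

theorem continuousOn_uH (i : Fin 2) : ContinuousOn (X.uH i) (Icc 0 P.tf) :=
  L2Sub.continuousOn_ofFun _ (X.sol.u_mem i) (X.sol.continuous i)

theorem continuousOn_γ (i : Fin 2) : ContinuousOn (X.γ i 0) (Icc 0 P.tf) :=
  (X.weakDerivs_γ i).continuousOn P.tf_pos.le (Nat.succ_pos _)

theorem continuousOn_Φ (i : Fin 2) : ContinuousOn (X.Φ i 0) (Icc 0 P.tf) :=
  (X.weakDerivs_Φ i).continuousOn P.tf_pos.le (Nat.succ_pos _)

/-- The two sides agree for almost every time and are continuous, hence agree at every time, in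
particular at grid points. -/
theorem uH_eq (i : Fin 2) {t : ℝ} (ht : t ∈ Icc 0 P.tf) : X.uH i t = X.W i 0 t := by
  refine Measure.eqOn_Icc_of_ae_eq volume P.tf_pos.ne ?_ (X.continuousOn_uH i)
    ((X.weakDerivs_W i).continuousOn P.tf_pos.le (Nat.succ_pos _)) ht
  rw [← restrict_Ioo_eq_restrict_Icc]
  filter_upwards [(X.hu i).zero] with t ht
  rw [uH, W, ht]

/-- The weak form of the evolution equation: `du` is the derivative of `(u_i, φ)`. -/
theorem exists_inner_deriv (i : Fin 2) (φ : S.HU i) : ∃ du : ℝ → ℝ,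
    (∀ (p : Polynomial ℝ) (a b : ℝ), 0 ≤ a → a ≤ b → b ≤ P.tf →
      IntervalIntegrable du volume a b ∧ ∫ t in a..b, p.eval t * du t =
        p.eval b * inner ℝ (X.uH i b) φ - p.eval a * inner ℝ (X.uH i a) φ -
          ∫ t in a..b, p.derivative.eval t * inner ℝ (X.uH i t) φ) ∧
    ∀ t ∈ Ioc 0 P.tf, ip (Ω n i) (P.f i t) (L2Sub.coe _ φ) =
      du t + formL S P i (X.uH i t) φ + ip (Gam n) (X.F i t) (trace (L2Sub.coe _ φ)) := by
  choose! du hmem hder heq using X.sol.evolution i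
  refine ⟨fun t => inner ℝ (L2Sub.ofFun (S.isL2Space_U i) (du t)) φ, ?_, fun t ht => ?_⟩
  · intro p a b ha hab hb
    -- The first weak derivative supplies the integrability, the evolution equation the pointwise
    -- derivative.
    refine integral_polynomial_mul_deriv ((X.weakDerivs_W i).integrable 1 (by omega) φ)
      (U := fun t => inner ℝ (X.uH i t) φ) (fun t ht => ?_) (fun t ht => ?_) p ha hab hb
    · rw [X.uH_eq i ht, X.uH_eq i ⟨le_rfl, P.tf_pos.le⟩]
      exact (X.weakDerivs_W i).primitive 0 (Nat.succ_pos _) φ t ht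
    · obtain ⟨c, hc⟩ := L2Sub.exists_inner_repr (S.isL2Space_U i) φ
      have htm : t ∈ Ioc 0 P.tf := Ioo_subset_Ioc_self ht
      simp only [uH]
      rw [hc _ (hmem t htm)]
      have h1 : HasDerivAt (fun τ => ∑ x ∈ c.support, c x * X.u i τ x)
          (∑ x ∈ c.support, c x * du t x) t :=
        HasDerivAt.fun_sum fun x _ =>
          (((hder t htm x).hasDerivAt (Icc_mem_nhds ht.1 ht.2)).const_mul (c x))
      refine h1.congr_of_eventuallyEq ?_
      filter_upwards [Icc_mem_nhds ht.1 ht.2] with τ hτ using hc _ (X.sol.u_mem i τ hτ)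
  · have h1 := heq t ht _ (L2Sub.coe_mem _ φ)
    beta_reduce
    rw [L2Sub.inner_ofFun _ (hmem t ht), h1, formL_apply, uH,
      L2Sub.coe_ofFun _ (X.sol.u_mem i t (Ioc_subset_Icc_self ht))]
    ring

/-- The regularity of the trace is stated for a representative, so the identity is available only
for almost every time. -/
theorem ae_trace (i : Fin 2) : ∀ᵐ t ∂(volume.restrict (Ioc 0 P.tf)), ∀ μ : S.HΓ,
    formΓ S i (X.uH i t) μ = inner ℝ (X.γ i 0 t) μ := by
  rw [← restrict_Ioo_eq_restrict_Ioc]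
  filter_upwards [(X.hΓ i).zero, ae_restrict_mem measurableSet_Ioo] with t ht htm μ
  have htc := Ioo_subset_Icc_self htm
  rw [formΓ_apply, uH, L2Sub.coe_ofFun _ (X.sol.u_mem i t htc), γ,
    L2Sub.inner_ofFun _ ((X.hΓ i).mem 0 (Nat.zero_le _) t htc), ht]

theorem ae_flux (i : Fin 2) : ∀ᵐ t ∂(volume.restrict (Ioc 0 P.tf)),
    L2Sub.coe _ (X.Φ i 0 t) = X.F i t := by
  rw [← restrict_Ioo_eq_restrict_Ioc]
  filter_upwards [(X.hF i).zero, ae_restrict_mem measurableSet_Ioo] with t ht htm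
  rw [Φ, L2Sub.coe_ofFun _ ((X.hF i).mem 0 (Nat.zero_le _) t (Ioo_subset_Icc_self htm)), ht]

/-- The interface condition in weak form, for arbitrary discrete traces `c₀`, `c₁`. -/
theorem ae_interface (i : Fin 2) : ∀ᵐ t ∂(volume.restrict (Ioc 0 P.tf)), ∀ c₀ c₁ μ : S.HΓ,
    ip (Gam n) (fun y => P.b i 0 * L2Sub.coe _ c₀ y + P.b i 1 * L2Sub.coe _ c₁ y - P.g i t y)
      (L2Sub.coe _ μ) = P.b i 0 * inner ℝ (c₀ - X.γ 0 0 t) μ +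
        P.b i 1 * inner ℝ (c₁ - X.γ 1 0 t) μ + inner ℝ (X.Φ i 0 t) μ := by
  filter_upwards [X.ae_trace 0, X.ae_trace 1, X.ae_flux i, ae_restrict_mem measurableSet_Ioc]
    with t h0 h1 hF htm c₀ c₁ μ
  have htc := Ioc_subset_Icc_self htm
  -- The datum `g` is merely square integrable, so its product with `μ` is integrable by Hölder's
  -- inequality.
  have hg : IntegrableOn (fun y => P.g i t y * L2Sub.coe _ μ y) (Gam n) := by
    have hμ : MemLp (L2Sub.coe _ μ) 2 (volume.restrict (Gam n)) := by
      have hc := (L2Sub.coe_mem _ μ).1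
      refine (memLp_two_iff_integrable_sq
        ((hc.mono subset_closure).aestronglyMeasurable isOpen_Gam.measurableSet)).2 ?_
      simp_rw [pow_two]
      exact integrableOn_mul_of_continuousOn isBounded_Gam hc hc
    exact (P.g_memLp i t htm).integrable_mul hμ
  have hcoe : ∀ c μ : S.HΓ, IntegrableOn (fun y => L2Sub.coe _ c y * L2Sub.coe _ μ y) (Gam n) :=
    fun c μ => S.isL2Space_UΓ.integrable _ (L2Sub.coe_mem _ c) _ (L2Sub.coe_mem _ μ)
  have key : ∀ v w : (Fin n → ℝ) → ℝ,
      IntegrableOn (fun y => v y * L2Sub.coe _ μ y) (Gam n) →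
      IntegrableOn (fun y => w y * L2Sub.coe _ μ y) (Gam n) →
      ip (Gam n) (fun y => P.b i 0 * v y + P.b i 1 * w y - P.g i t y) (L2Sub.coe _ μ) =
        P.b i 0 * ip (Gam n) v (L2Sub.coe _ μ) + P.b i 1 * ip (Gam n) w (L2Sub.coe _ μ) -
          ip (Gam n) (P.g i t) (L2Sub.coe _ μ) := by
    intro v w hv hw
    have hs : IntegrableOn (fun y => P.b i 0 * (v y * L2Sub.coe _ μ y) +
        P.b i 1 * (w y * L2Sub.coe _ μ y)) (Gam n) := (hv.const_mul _).add (hw.const_mul _)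
    simp only [ip]
    rw [← integral_const_mul, ← integral_const_mul,
      ← integral_add (hv.const_mul _) (hw.const_mul _), ← integral_sub hs hg]
    congr 1; funext y; ring
  -- The semi-discrete interface condition eliminates `g` in favour of the exact flux and traces.
  have h2 := X.sol.interface i t htm _ (L2Sub.coe_mem _ μ)
  have hu : ∀ j, L2Sub.coe _ (X.uH j t) = X.u j t := fun j =>
    L2Sub.coe_ofFun _ (X.sol.u_mem j t htc)
  have h3 := key (trace (X.u 0 t)) (trace (X.u 1 t))
    (by simpa only [hu] using S.integrable_trace 0 (X.uH 0 t) μ)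
    (by simpa only [hu] using S.integrable_trace 1 (X.uH 1 t) μ)
  have h0' := h0 μ
  have h1' := h1 μ
  rw [formΓ_apply, hu] at h0' h1'
  rw [h3, h0', h1', ← hF, ← L2Sub.inner_eq] at h2
  rw [key _ _ (hcoe c₀ μ) (hcoe c₁ μ), ← L2Sub.inner_eq, ← L2Sub.inner_eq, inner_sub_left,
    inner_sub_left]
  linarith

end RegularSolution

/-! ### Grids -/

section Grid

variable (G : TimeGrid) {tf : ℝ}

theorem TimeGrid.dt_pos (htf : 0 < tf) : 0 < G.dt tf :=
  div_pos htf (Nat.cast_pos.2 G.N_pos)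

theorem TimeGrid.dts_pos (htf : 0 < tf) (i : Fin 2) : 0 < G.dts tf i :=
  div_pos (G.dt_pos htf) (Nat.cast_pos.2 (G.M_pos i))

theorem TimeGrid.M_mul_dts (i : Fin 2) : (G.M i : ℝ) * G.dts tf i = G.dt tf :=
  mul_div_cancel₀ _ (Nat.cast_pos.2 (G.M_pos i)).ne'

theorem TimeGrid.N_mul_dt : (G.N : ℝ) * G.dt tf = tf :=
  mul_div_cancel₀ _ (Nat.cast_pos.2 G.N_pos).ne'

theorem TimeGrid.dts_le_dt (htf : 0 < tf) (i : Fin 2) : G.dts tf i ≤ G.dt tf :=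
  div_le_self (G.dt_pos htf).le (Nat.one_le_cast.2 (G.M_pos i))

theorem TimeGrid.idx_succ (i : Fin 2) (w k : ℕ) : G.idx i w (k + 1) = G.idx i w k + 1 := rfl

theorem TimeGrid.idx_le {i : Fin 2} {w m : ℕ} (hw : 1 ≤ w) (hm : m ≤ G.M i) :
    G.idx i w m ≤ w * G.M i := by
  obtain ⟨v, rfl⟩ : ∃ v, w = v + 1 := ⟨w - 1, by omega⟩
  simp only [TimeGrid.idx, Nat.add_sub_cancel, add_mul, one_mul]
  omega

theorem TimeGrid.time_le (htf : 0 < tf) {i : Fin 2} {j : ℕ} (hj : j ≤ G.N * G.M i) :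
    (j : ℝ) * G.dts tf i ≤ tf := by
  calc (j : ℝ) * G.dts tf i ≤ (G.N * G.M i : ℕ) * G.dts tf i := by
        have := (G.dts_pos htf i).le
        gcongr
    _ = G.N * (G.M i * G.dts tf i) := by push_cast; ring
    _ = tf := by rw [G.M_mul_dts, G.N_mul_dt]

theorem TimeGrid.window_time_le (htf : 0 < tf) {w : ℕ} (hw : w ≤ G.N) : (w : ℝ) * G.dt tf ≤ tf := by
  calc (w : ℝ) * G.dt tf ≤ G.N * G.dt tf := by
        have := (G.dt_pos htf).le
        gcongr
    _ = tf := G.N_mul_dt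

theorem TimeGrid.idx_zero_mul {i : Fin 2} {w : ℕ} (hw : 1 ≤ w) :
    (G.idx i w 0 : ℝ) * G.dts tf i = ((w : ℝ) - 1) * G.dt tf := by
  rw [TimeGrid.idx, ← G.M_mul_dts i]
  push_cast [Nat.cast_sub hw]
  ring

theorem TimeGrid.idx_last_mul {i : Fin 2} {w : ℕ} (hw : 1 ≤ w) :
    (G.idx i w (G.M i) : ℝ) * G.dts tf i = w * G.dt tf := by
  rw [TimeGrid.idx, ← G.M_mul_dts i]
  push_cast [Nat.cast_sub hw]
  ring

theorem sum_Icc_one_eq_range {f : ℕ → ℝ} (M : ℕ) :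
    ∑ m ∈ Finset.Icc 1 M, f m = ∑ k ∈ Finset.range M, f (k + 1) := by
  have : Finset.Icc 1 M = Finset.Ico 1 (M + 1) := by ext; simp
  rw [this, Finset.sum_Ico_eq_sum_range]
  exact Finset.sum_congr rfl fun k _ => by rw [add_comm]

theorem TimeGrid.mem_Icc_of_step (htf : 0 < tf) {i : Fin 2} {w m : ℕ} (hw : w ∈ Icc 1 G.N)
    (hm : m ∈ Icc 1 (G.M i)) :
    ((G.idx i w m : ℝ) - 1) * G.dts tf i ∈ Icc 0 tf ∧ (G.idx i w m : ℝ) * G.dts tf i ∈ Icc 0 tf ∧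
      ((G.idx i w m : ℝ) - 1) * G.dts tf i < (G.idx i w m : ℝ) * G.dts tf i := by
  have h0 := G.dts_pos htf i
  have h1 : (1 : ℝ) ≤ G.idx i w m := by
    exact_mod_cast hm.1.trans (Nat.le_add_left _ _)
  have h2 := G.time_le htf ((G.idx_le hw.1 hm.2).trans (Nat.mul_le_mul_right _ hw.2))
  have h3 : ((G.idx i w m : ℝ) - 1) * G.dts tf i < (G.idx i w m : ℝ) * G.dts tf i := by
    gcongr; linarith
  have h4 : 0 ≤ ((G.idx i w m : ℝ) - 1) * G.dts tf i := mul_nonneg (by linarith) h0.le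
  exact ⟨⟨h4, h3.le.trans h2⟩, ⟨h4.trans h3.le, h2⟩, h3⟩

theorem TimeGrid.sum_integral_steps (htf : 0 < tf) {i : Fin 2} {w : ℕ} (hw : w ∈ Icc 1 G.N)
    {f : ℝ → ℝ} (hf : IntervalIntegrable f volume 0 tf) :
    ∑ m ∈ Finset.Icc 1 (G.M i), ∫ t in
      (((G.idx i w m : ℝ) - 1) * G.dts tf i)..((G.idx i w m : ℝ) * G.dts tf i), f t =
      ∫ t in (((w : ℝ) - 1) * G.dt tf)..(w * G.dt tf), f t := by
  rw [sum_Icc_one_eq_range, ← G.idx_zero_mul (i := i) hw.1, ← G.idx_last_mul (i := i) hw.1,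
    ← intervalIntegral.sum_integral_adjacent_intervals
      (a := fun k : ℕ => (G.idx i w k : ℝ) * G.dts tf i)]
  · refine Finset.sum_congr rfl fun k _ => ?_
    rw [G.idx_succ]; push_cast; congr 2; ring
  · intro k hk
    have h := G.mem_Icc_of_step htf hw (i := i) (m := k + 1) ⟨by omega, hk⟩
    have h1 := h.1
    rw [G.idx_succ] at h1
    push_cast at h1
    rw [add_sub_cancel_right] at h1
    exact intervalIntegrable_sub_of_mem hf h1 h.2.1

end Grid

/-! ### Runs of the method -/

/-- A solution of the method on windows `N₀, …, N`, with consistent side conditions. -/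
structure Run {S : SpatialMesh n} {P : ModelProblem n} {A : TimeScheme}
    (X : RegularSolution S P A) (N₀ : ℕ) (K : ℝ) where
  one_le : 1 ≤ N₀
  G : TimeGrid
  late : LateStart A G N₀
  cons : ConsistentSide P A G N₀ K X.u X.Du
  Y : DiscreteApprox n
  sol : IsDGiTSolution S P A G N₀ Y

namespace Run

variable {S : SpatialMesh n} {P : ModelProblem n} {A : TimeScheme} {X : RegularSolution S P A}
  {N₀ : ℕ} {K : ℝ} (Z : Run X N₀ K)

/-- The length of a substep. -/
def h (i : Fin 2) : ℝ := Z.G.dts P.tf i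

/-- The left end of a substep. -/
def tl (i : Fin 2) (w m : ℕ) : ℝ := ((Z.G.idx i w m : ℝ) - 1) * Z.G.dts P.tf i

/-- The right end of a substep. -/
def tr (i : Fin 2) (w m : ℕ) : ℝ := (Z.G.idx i w m : ℝ) * Z.G.dts P.tf i

/-- The discrete state. -/
def y (i : Fin 2) (j : ℕ) (t : ℝ) : S.HU i := L2Sub.ofFun _ (Z.Y.u i j t)

/-- The state error. -/
def e (i : Fin 2) (j : ℕ) (t : ℝ) : S.HU i := X.uH i t - Z.y i j t

/-- The side value error. -/
def E (i : Fin 2) (j : ℕ) : S.HU i :=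
  X.uH i (j * Z.G.dts P.tf i) - L2Sub.ofFun _ (Z.Y.sv i j)

/-- The discrete flux. -/
def F (i : Fin 2) (w : ℕ) (t : ℝ) : S.HΓ := L2Sub.ofFun _ (Z.Y.F i w t)

/-- The flux error. -/
def δF (i : Fin 2) (w : ℕ) (t : ℝ) : S.HΓ := X.Φ i 0 t - Z.F i w t

/-- The discrete trace. -/
def uΓ (i : Fin 2) (w : ℕ) (t : ℝ) : S.HΓ := L2Sub.ofFun _ (Z.Y.uΓ i w t)

theorem h_pos (i : Fin 2) : 0 < Z.h i := Z.G.dts_pos P.tf_pos i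

theorem tr_sub_tl (i : Fin 2) (w m : ℕ) : Z.tr i w m - Z.tl i w m = Z.h i := by
  simp only [tr, tl, h]; ring

theorem window_mem {w : ℕ} (hw : w ∈ Icc N₀ Z.G.N) : w ∈ Icc 1 Z.G.N :=
  ⟨Z.one_le.trans hw.1, hw.2⟩

theorem step_mem {i : Fin 2} {w m : ℕ} (hw : w ∈ Icc N₀ Z.G.N) (hm : m ∈ Icc 1 (Z.G.M i)) :
    Z.tl i w m ∈ Icc 0 P.tf ∧ Z.tr i w m ∈ Icc 0 P.tf ∧ Z.tl i w m < Z.tr i w m :=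
  Z.G.mem_Icc_of_step P.tf_pos (Z.window_mem hw) hm

theorem idx_mem {i : Fin 2} {w m : ℕ} (hw : w ∈ Icc N₀ Z.G.N) (hm : m ∈ Icc 1 (Z.G.M i)) :
    Z.G.idx i w m ∈ Icc 1 (Z.G.N * Z.G.M i) :=
  ⟨hm.1.trans (Nat.le_add_left _ _),
    (Z.G.idx_le (Z.window_mem hw).1 hm.2).trans (Nat.mul_le_mul_right _ hw.2)⟩

theorem u_mem {i : Fin 2} {w m : ℕ} (hw : w ∈ Icc N₀ Z.G.N) (hm : m ∈ Icc 1 (Z.G.M i)) :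
    Z.Y.u i (Z.G.idx i w m) ∈ polyInTime (S.U i) A.q :=
  Z.sol.u_mem i _ (Z.idx_mem hw hm)

theorem continuous_y {i : Fin 2} {w m : ℕ} (hw : w ∈ Icc N₀ Z.G.N) (hm : m ∈ Icc 1 (Z.G.M i)) :
    Continuous (Z.y i (Z.G.idx i w m)) :=
  polyInTime.continuous_ofFun _ (Z.u_mem hw hm)

theorem continuousOn_e {i : Fin 2} {w m : ℕ} (hw : w ∈ Icc N₀ Z.G.N)
    (hm : m ∈ Icc 1 (Z.G.M i)) : ContinuousOn (Z.e i (Z.G.idx i w m)) (Icc 0 P.tf) :=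
  (X.continuousOn_uH i).sub (Z.continuous_y hw hm).continuousOn

theorem continuous_F (i : Fin 2) {w : ℕ} (hw : w ∈ Icc N₀ Z.G.N) : Continuous (Z.F i w) :=
  polyInTime.continuous_ofFun _ (Z.sol.F_mem i w hw)

theorem continuous_uΓ (i : Fin 2) {w : ℕ} (hw : w ∈ Icc N₀ Z.G.N) : Continuous (Z.uΓ i w) :=
  polyInTime.continuous_ofFun _ (Z.sol.uΓ_mem i w hw)

theorem continuousOn_δF (i : Fin 2) {w : ℕ} (hw : w ∈ Icc N₀ Z.G.N) :
    ContinuousOn (Z.δF i w) (Icc 0 P.tf) :=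
  (X.continuousOn_Φ i).sub (Z.continuous_F i hw).continuousOn

/-- The residual of the right hand side on a substep. -/
def R (i : Fin 2) (w m : ℕ) (t : ℝ) (φ : S.HU i) : ℝ :=
  formL S P i (Z.e i (Z.G.idx i w m) t) φ + formΓ S i φ (Z.δF i w t)

theorem continuousOn_R {i : Fin 2} {w m : ℕ} (hw : w ∈ Icc N₀ Z.G.N) (hm : m ∈ Icc 1 (Z.G.M i))
    (φ : S.HU i) : ContinuousOn (fun t => Z.R i w m t φ) (Icc 0 P.tf) := by
  have h1 : ContinuousOn (fun t => (Z.e i (Z.G.idx i w m) t, φ)) (Icc 0 P.tf) :=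
    (Z.continuousOn_e hw hm).prodMk continuousOn_const
  have h2 : ContinuousOn (fun t => (φ, Z.δF i w t)) (Icc 0 P.tf) :=
    continuousOn_const.prodMk (Z.continuousOn_δF i hw)
  have h3 := (continuous_bilinear_left (formL S P i)).comp_continuousOn h1
  have h4 := (continuous_bilinear_left (formΓ S i)).comp_continuousOn h2
  exact h3.add h4

theorem ae_Ioc_of_mem {a b T : ℝ} (ha : 0 ≤ a) (hb : b ≤ T) {p : ℝ → Prop}
    (h : ∀ᵐ t ∂(volume.restrict (Ioc 0 T)), p t) : ∀ᵐ t ∂(volume.restrict (Ioc a b)), p t :=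
  ae_mono (Measure.restrict_mono (Ioc_subset_Ioc ha hb) le_rfl) h

/-- The method is tested with `p(t) φ`, and the evolution equation is multiplied by `p` and
integrated by parts. In the difference the source `f` cancels and no defect is left; consistency
errors enter only through side conditions, traces and fluxes. -/
theorem errorEquation {i : Fin 2} {w m : ℕ} (hw : w ∈ Icc N₀ Z.G.N)
    (hm : m ∈ Icc 1 (Z.G.M i)) :
    ErrorEquation (A.q + 1 - A.ns) (Z.tl i w m) (Z.tr i w m) (Z.E i (Z.G.idx i w m - 1))
      (Z.E i (Z.G.idx i w m)) (Z.e i (Z.G.idx i w m)) (Z.R i w m) := by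
  intro p hp φ
  obtain ⟨hl, hr, hlr⟩ := Z.step_mem hw hm
  obtain ⟨du, hdu, hf⟩ := X.exists_inner_deriv i φ
  have hj := Z.idx_mem hw hm
  set j := Z.G.idx i w m with hjdef
  have hjm := Z.u_mem hw hm
  obtain ⟨hdi, hparts⟩ := hdu p _ _ hl.1 hlr.le hr.2
  have hgal := Z.sol.galerkin i w hw m hm _ (polyInTime_smul _ hp φ)
  rw [← hjdef] at hgal hjm
  have htl : ((j : ℝ) - 1) * Z.G.dts P.tf i = Z.tl i w m := rfl
  have htr : (j : ℝ) * Z.G.dts P.tf i = Z.tr i w m := rfl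
  -- The truncated subtraction is exact, because substeps are numbered from 1.
  have htl' : ((j - 1 : ℕ) : ℝ) * Z.G.dts P.tf i = Z.tl i w m := by
    rw [Nat.cast_sub hj.1, Nat.cast_one]; rfl
  have hsv : ∀ l, l ≤ Z.G.N * Z.G.M i → ∀ c : ℝ,
      ip (Ω n i) (Z.Y.sv i l) (c • L2Sub.coe _ φ) =
        c * inner ℝ (L2Sub.ofFun (S.isL2Space_U i) (Z.Y.sv i l)) φ := by
    intro l hl c
    rw [ip_smul_right, L2Sub.inner_ofFun _ (Z.sol.sv_mem i l hl)]
  have hderiv : ∀ t, ip (Ω n i) (Z.Y.u i j t)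
      (fun x => deriv (fun τ => (p.eval τ • L2Sub.coe _ φ) x) t) =
        p.derivative.eval t * inner ℝ (Z.y i j t) φ := by
    intro t
    have : (fun x => deriv (fun τ => (p.eval τ • L2Sub.coe _ φ) x) t) =
        p.derivative.eval t • L2Sub.coe _ φ := by
      funext x
      simp only [Pi.smul_apply, smul_eq_mul]
      exact ((p.hasDerivAt t).mul_const _).deriv
    rw [this, ip_smul_right, y, L2Sub.inner_ofFun _ (polyInTime.mem hjm t)]
  -- The source `f` is expressed by the exact derivative, state and flux; the latter is identified
  -- with `Φ` only almost everywhere, hence the passage to set integrals.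
  have hrhs : ∫ t in (Z.tl i w m)..(Z.tr i w m),
      (P.L i (Z.Y.u i j t) (p.eval t • L2Sub.coe _ φ) +
        ip (Gam n) (Z.Y.F i w t) (trace (p.eval t • L2Sub.coe _ φ)) -
        ip (Ω n i) (P.f i t) (p.eval t • L2Sub.coe _ φ)) =
      -(∫ t in (Z.tl i w m)..(Z.tr i w m), p.eval t * Z.R i w m t φ) -
        ∫ t in (Z.tl i w m)..(Z.tr i w m), p.eval t * du t := by
    have hi1 : IntervalIntegrable (fun t => p.eval t * Z.R i w m t φ) volume
        (Z.tl i w m) (Z.tr i w m) :=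
      (p.continuous.continuousOn.mul ((Z.continuousOn_R hw hm φ).mono
        (uIcc_subset_Icc hl hr))).intervalIntegrable
    have hi2 : IntervalIntegrable (fun t => p.eval t * du t) volume (Z.tl i w m) (Z.tr i w m) :=
      hdi.continuousOn_mul p.continuous.continuousOn
    have hi3 : IntervalIntegrable (fun t => -(p.eval t * Z.R i w m t φ)) volume
        (Z.tl i w m) (Z.tr i w m) := hi1.neg
    rw [← intervalIntegral.integral_neg, ← intervalIntegral.integral_sub hi3 hi2,
      intervalIntegral.integral_of_le hlr.le, intervalIntegral.integral_of_le hlr.le]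
    refine integral_congr_ae ?_
    filter_upwards [ae_Ioc_of_mem hl.1 hr.2 (X.ae_flux i),
      ae_Ioc_of_mem hl.1 hr.2 (ae_restrict_mem measurableSet_Ioc)] with t hFt htm
    have h1 : P.L i (Z.Y.u i j t) (p.eval t • L2Sub.coe _ φ) =
        p.eval t * formL S P i (Z.y i j t) φ := by
      rw [P.L_smul_right i _ (S.hasBoundedGradient_coe i φ), formL_apply, y,
        L2Sub.coe_ofFun _ (polyInTime.mem hjm t)]
    have h2 : ip (Gam n) (Z.Y.F i w t) (trace (p.eval t • L2Sub.coe _ φ)) =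
        p.eval t * formΓ S i φ (Z.F i w t) := by
      have : trace (p.eval t • L2Sub.coe (S.isL2Space_U i) φ) =
        p.eval t • trace (L2Sub.coe _ φ) := rfl
      rw [this, ip_smul_right, ip_comm, formΓ_apply, F,
        L2Sub.coe_ofFun _ (polyInTime.mem (Z.sol.F_mem i w hw) t)]
    have h3 : ip (Gam n) (X.F i t) (trace (L2Sub.coe _ φ)) = formΓ S i φ (X.Φ i 0 t) := by
      rw [← hFt, ip_comm, formΓ_apply]
    rw [h1, h2, ip_smul_right, hf t htm, h3, R, e, δF, map_sub, map_sub, LinearMap.sub_apply,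
      ← hjdef]
    ring
  rw [htl, htr, hsv j hj.2, hsv (j - 1) ((Nat.sub_le _ _).trans hj.2), hrhs] at hgal
  simp_rw [hderiv] at hgal
  have hc1 : IntervalIntegrable (fun t => p.derivative.eval t * inner ℝ (X.uH i t) φ) volume
      (Z.tl i w m) (Z.tr i w m) :=
    (p.derivative.continuous.continuousOn.mul (((X.continuousOn_uH i).mono
      (uIcc_subset_Icc hl hr)).inner continuousOn_const)).intervalIntegrable
  have hc2 : IntervalIntegrable (fun t => p.derivative.eval t * inner ℝ (Z.y i j t) φ) volume
      (Z.tl i w m) (Z.tr i w m) :=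
    (p.derivative.continuous.mul ((Z.continuous_y hw hm).inner
      continuous_const)).intervalIntegrable _ _
  simp only [E, e, htr, htl', inner_sub_left, mul_sub]
  rw [intervalIntegral.integral_sub hc1 hc2]
  linarith

/-! ### Local error estimate -/

/-- Boundedness of the bilinear forms. -/
def _root_.DGiT.FormBound (S : SpatialMesh n) (P : ModelProblem n) (c : ℝ) : Prop :=
  0 ≤ c ∧ (∀ i v w, |formL S P i v w| ≤ c * ‖v‖ * ‖w‖) ∧
    ∀ i v μ, |formΓ S i v μ| ≤ c * ‖v‖ * ‖μ‖

theorem _root_.DGiT.exists_formBound (S : SpatialMesh n) (P : ModelProblem n) :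
    ∃ c, FormBound S P c := by
  choose cL hL hL' using fun i => exists_bound_bilinear (formL S P i)
  choose cΓ hΓ hΓ' using fun i => exists_bound_bilinear (formΓ S i)
  have hs1 : ∀ i, cL i ≤ ∑ i, cL i := fun i =>
    Finset.single_le_sum (fun i _ => hL i) (Finset.mem_univ i)
  have hs2 : ∀ i, cΓ i ≤ ∑ i, cΓ i := fun i =>
    Finset.single_le_sum (fun i _ => hΓ i) (Finset.mem_univ i)
  have h1 : 0 ≤ ∑ i, cL i := Finset.sum_nonneg fun i _ => hL i
  have h2 : 0 ≤ ∑ i, cΓ i := Finset.sum_nonneg fun i _ => hΓ i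
  refine ⟨∑ i, cL i + ∑ i, cΓ i, by positivity, fun i v w => (hL' i v w).trans ?_,
    fun i v μ => (hΓ' i v μ).trans ?_⟩
  · gcongr; linarith [hs1 i]
  · gcongr; linarith [hs2 i]

variable {Z} in
theorem abs_R_le {c : ℝ} (hc : FormBound S P c) (i : Fin 2) (w m : ℕ) (t : ℝ) (φ : S.HU i) :
    |Z.R i w m t φ| ≤ c * (‖Z.e i (Z.G.idx i w m) t‖ + ‖Z.δF i w t‖) * ‖φ‖ := by
  have h1 := hc.2.1 i (Z.e i (Z.G.idx i w m) t) φ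
  have h2 := hc.2.2 i φ (Z.δF i w t)
  refine (abs_add_le _ _).trans ((add_le_add h1 h2).trans (le_of_eq ?_))
  ring

/-- The bound of the residual on a substep. -/
def g (c : ℝ) (i : Fin 2) (w m : ℕ) (t : ℝ) : ℝ :=
  c * (‖Z.e i (Z.G.idx i w m) t‖ + ‖Z.δF i w t‖)

/-- The squared state error on a substep. -/
def e2 (i : Fin 2) (w m : ℕ) : ℝ :=
  ∫ t in (Z.tl i w m)..(Z.tr i w m), ‖Z.e i (Z.G.idx i w m) t‖ ^ 2

/-- The squared flux error on a substep. -/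
def f2 (i : Fin 2) (w m : ℕ) : ℝ :=
  ∫ t in (Z.tl i w m)..(Z.tr i w m), ‖Z.δF i w t‖ ^ 2

theorem continuousOn_g (c : ℝ) {i : Fin 2} {w m : ℕ} (hw : w ∈ Icc N₀ Z.G.N)
    (hm : m ∈ Icc 1 (Z.G.M i)) : ContinuousOn (Z.g c i w m) (Icc 0 P.tf) :=
  continuousOn_const.mul ((Z.continuousOn_e hw hm).norm.add (Z.continuousOn_δF i hw).norm)

theorem intervalIntegrable_of_continuousOn {f : ℝ → ℝ} (hf : ContinuousOn f (Icc 0 P.tf)) {a b : ℝ}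
    (ha : a ∈ Icc 0 P.tf) (hb : b ∈ Icc 0 P.tf) : IntervalIntegrable f volume a b :=
  (hf.mono (uIcc_subset_Icc ha hb)).intervalIntegrable

/-- Cauchy–Schwarz supplies the factor `h`, the smallness that later permits absorption. -/
theorem sq_integral_g_le (c : ℝ) {i : Fin 2} {w m : ℕ} (hw : w ∈ Icc N₀ Z.G.N)
    (hm : m ∈ Icc 1 (Z.G.M i)) :
    (∫ t in (Z.tl i w m)..(Z.tr i w m), Z.g c i w m t) ^ 2 ≤
      Z.h i * (2 * c ^ 2 * (Z.e2 i w m + Z.f2 i w m)) := by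
  obtain ⟨hl, hr, hlr⟩ := Z.step_mem hw hm
  have hg := Z.continuousOn_g c hw hm
  have ig := intervalIntegrable_of_continuousOn hg hl hr
  have ig2 : IntervalIntegrable (fun t => Z.g c i w m t ^ 2) volume (Z.tl i w m) (Z.tr i w m) :=
    intervalIntegrable_of_continuousOn (hg.pow 2) hl hr
  have ie : IntervalIntegrable (fun t => ‖Z.e i (Z.G.idx i w m) t‖ ^ 2) volume
      (Z.tl i w m) (Z.tr i w m) :=
    intervalIntegrable_of_continuousOn ((Z.continuousOn_e hw hm).norm.pow 2) hl hr
  have iF : IntervalIntegrable (fun t => ‖Z.δF i w t‖ ^ 2) volume (Z.tl i w m) (Z.tr i w m) :=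
    intervalIntegrable_of_continuousOn ((Z.continuousOn_δF i hw).norm.pow 2) hl hr
  have h1 := sq_integral_le hlr.le ig ig2
  rw [Z.tr_sub_tl] at h1
  refine h1.trans (mul_le_mul_of_nonneg_left ?_ (Z.h_pos i).le)
  rw [e2, f2, ← intervalIntegral.integral_add ie iF, ← intervalIntegral.integral_const_mul]
  refine intervalIntegral.integral_mono_on hlr.le ig2 ((ie.add iF).const_mul _) fun t _ => ?_
  rw [g, mul_pow, mul_comm (2 : ℝ), mul_assoc]
  refine mul_le_mul_of_nonneg_left ?_ (sq_nonneg _)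
  nlinarith [sq_nonneg (‖Z.e i (Z.G.idx i w m) t‖ - ‖Z.δF i w t‖)]

theorem norm_E_sub_le {c : ℝ} (hc : FormBound S P c) {i : Fin 2} {w m : ℕ}
    (hw : w ∈ Icc N₀ Z.G.N) (hm : m ∈ Icc 1 (Z.G.M i)) :
    ‖Z.E i (Z.G.idx i w m) - Z.E i (Z.G.idx i w m - 1)‖ ≤
      ∫ t in (Z.tl i w m)..(Z.tr i w m), Z.g c i w m t := by
  obtain ⟨hl, hr, hlr⟩ := Z.step_mem hw hm
  exact (Z.errorEquation hw hm).norm_sub_le hlr.le (fun t _ φ => abs_R_le hc i w m t φ)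
    (intervalIntegrable_of_continuousOn (Z.continuousOn_g c hw hm) hl hr)
    fun t _ => mul_nonneg hc.1 (by positivity)

end Run

/-! ### Taylor remainders of the state, side conditions and the local estimate -/

/-- A function on `(0, T)`, extended by zero. -/
def extendZero (T : ℝ) (f : ℝ → ℝ) : ℝ → ℝ := (Ioc 0 T).indicator f

theorem integrable_extendZero {T : ℝ} (hT : 0 ≤ T) {f : ℝ → ℝ}
    (hf : IntervalIntegrable f volume 0 T) : Integrable (extendZero T f) := by
  rw [intervalIntegrable_iff, uIoc_of_le hT] at hf
  exact hf.integrable_indicator measurableSet_Ioc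

theorem extendZero_nonneg {T : ℝ} {f : ℝ → ℝ} (hf : ∀ t, 0 ≤ f t) (t : ℝ) :
    0 ≤ extendZero T f t := indicator_nonneg (fun t _ => hf t) t

/-- The interval is enlarged to the left, possibly past time zero, as happens with the uniform
look-back `reach` on the earliest substeps. -/
theorem integral_le_extendZero {T a b a' : ℝ} (hT : 0 ≤ T) {f : ℝ → ℝ}
    (hf : IntervalIntegrable f volume 0 T) (h0 : ∀ t, 0 ≤ f t) (ha : 0 ≤ a) (hab : a ≤ b)
    (hb : b ≤ T) (ha' : a' ≤ a) : ∫ t in a..b, f t ≤ ∫ t in a'..b, extendZero T f t := by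
  have h1 : ∫ t in a..b, f t = ∫ t in a..b, extendZero T f t := by
    rw [intervalIntegral.integral_of_le hab, intervalIntegral.integral_of_le hab]
    refine setIntegral_congr_fun measurableSet_Ioc fun t ht => ?_
    exact (indicator_of_mem (show t ∈ Ioc 0 T from ⟨ha.trans_lt ht.1, ht.2.trans hb⟩) f).symm
  rw [h1]
  exact intervalIntegral.integral_mono_interval ha' hab le_rfl
    (Filter.Eventually.of_forall fun t => extendZero_nonneg h0 t)
    (integrable_extendZero hT hf).intervalIntegrable

namespace RegularSolution

variable {S : SpatialMesh n} {P : ModelProblem n} {A : TimeScheme} (X : RegularSolution S P A)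

/-- The density of the squared `H^(q+1)` norm of the state. -/
def density (i : Fin 2) (t : ℝ) : ℝ := ∑ μ ∈ Finset.range (A.q + 2), ‖X.W i μ t‖ ^ 2

theorem density_nonneg (i : Fin 2) (t : ℝ) : 0 ≤ X.density i t :=
  Finset.sum_nonneg fun _ _ => sq_nonneg _

theorem intervalIntegrable_density (i : Fin 2) :
    IntervalIntegrable (X.density i) volume 0 P.tf := by
  have := IntervalIntegrable.sum (Finset.range (A.q + 2)) (f := fun μ t => ‖X.W i μ t‖ ^ 2)
    (μ := volume) (a := 0) (b := P.tf)
    fun μ hμ => (X.weakDerivs_W i).norm_sq μ (by have := Finset.mem_range.1 hμ; omega)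
  refine this.congr fun t _ => ?_
  simp [density, Finset.sum_apply]

/-- The density of the squared `H^(q+1)` norm of the state, extended by zero. -/
def ω (i : Fin 2) : ℝ → ℝ := extendZero P.tf (X.density i)

theorem norm_uH_sub_taylor_sq_le (i : Fin 2) {s t a : ℝ} (hs : 0 ≤ s) (hst : s ≤ t)
    (ht : t ≤ P.tf) (ha : a ≤ s) :
    ‖X.uH i s - taylor A.q (X.W i) t s‖ ^ 2 ≤ (t - s) ^ (2 * A.q + 1) * ∫ τ in a..t, X.ω i τ := by
  rw [X.uH_eq i ⟨hs, hst.trans ht⟩]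
  refine ((X.weakDerivs_W i).norm_sub_taylor_sq_le hs hst ht).trans
    (mul_le_mul_of_nonneg_left ?_ (pow_nonneg (sub_nonneg.2 hst) _))
  refine le_trans ?_ (integral_le_extendZero P.tf_pos.le (X.intervalIntegrable_density i)
    (X.density_nonneg i) hs hst ht ha)
  have hsm : s ∈ Icc 0 P.tf := ⟨hs, hst.trans ht⟩
  have htm : t ∈ Icc 0 P.tf := ⟨hs.trans hst, ht⟩
  refine intervalIntegral.integral_mono_on hst
    (intervalIntegrable_sub_of_mem ((X.weakDerivs_W i).norm_sq _ le_rfl) hsm htm)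
    (intervalIntegrable_sub_of_mem (X.intervalIntegrable_density i) hsm htm) fun τ _ => ?_
  exact Finset.single_le_sum (f := fun μ => ‖X.W i μ τ‖ ^ 2) (fun _ _ => sq_nonneg _)
    (Finset.mem_range.2 (by omega))

end RegularSolution

/-- A number of substeps that the side conditions reach back. -/
def TimeScheme.reach (A : TimeScheme) : ℕ := A.ks + 1 + ∑ k, ⌈1 - A.θ k⌉₊

theorem TimeScheme.one_le_reach (A : TimeScheme) : 1 ≤ A.reach := by
  unfold reach; omega

theorem TimeScheme.ks_le_reach (A : TimeScheme) : A.ks ≤ A.reach := by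
  unfold reach; omega

theorem TimeScheme.sub_θ_le_reach (A : TimeScheme) (k : Fin A.ns) : 1 - A.θ k ≤ A.reach := by
  refine (Nat.le_ceil _).trans ?_
  have : ⌈1 - A.θ k⌉₊ ≤ ∑ k, ⌈1 - A.θ k⌉₊ :=
    Finset.single_le_sum (f := fun k => ⌈1 - A.θ k⌉₊) (fun _ _ => Nat.zero_le _)
      (Finset.mem_univ k)
  exact_mod_cast this.trans (by unfold reach; omega)

namespace Run

variable {S : SpatialMesh n} {P : ModelProblem n} {A : TimeScheme} {X : RegularSolution S P A}
  {N₀ : ℕ} {K : ℝ} (Z : Run X N₀ K)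

/-- The share of the `H^(q+1)` norm of the state that enters the estimate on substep `j`. -/
def o (i : Fin 2) (j : ℕ) : ℝ :=
  ∫ t in (((j : ℝ) - A.reach) * Z.G.dts P.tf i)..((j : ℝ) * Z.G.dts P.tf i), X.ω i t

theorem o_nonneg (i : Fin 2) (j : ℕ) : 0 ≤ Z.o i j := by
  refine intervalIntegral.integral_nonneg ?_ fun t _ => extendZero_nonneg (X.density_nonneg i) t
  have := (Z.G.dts_pos P.tf_pos i).le
  gcongr
  simp

/-- The first substep of window `N₀` is the worst case, and there `LateStart` applies. -/
theorem late_θ {i : Fin 2} {w m : ℕ} (hw : w ∈ Icc N₀ Z.G.N) (hm : m ∈ Icc 1 (Z.G.M i))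
    (k : Fin A.ns) : 0 ≤ (Z.G.idx i w m : ℝ) - 1 + A.θ k ∧ A.ks ≤ Z.G.idx i w m := by
  obtain ⟨h1, h2⟩ := Z.late i k
  have h3 : (N₀ - 1) * Z.G.M i + 1 ≤ Z.G.idx i w m := by
    unfold TimeGrid.idx
    have : (N₀ - 1) * Z.G.M i ≤ (w - 1) * Z.G.M i :=
      Nat.mul_le_mul_right _ (Nat.sub_le_sub_right hw.1 1)
    have := hm.1
    omega
  refine ⟨?_, h2.trans h3⟩
  have h4 : (((N₀ - 1) * Z.G.M i + 1 : ℕ) : ℝ) ≤ Z.G.idx i w m := by exact_mod_cast h3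
  push_cast [Nat.cast_sub Z.one_le] at h4
  linarith

/-- The consistency error of a side condition. -/
def ρ (i : Fin 2) (w m : ℕ) (k : Fin A.ns) : S.HU i :=
  X.uH i (((Z.G.idx i w m : ℝ) - 1 + A.θ k) * Z.G.dts P.tf i) -
    ∑ l : Fin (A.ks + 1), A.Dm k l • X.uH i (((Z.G.idx i w m - (l : ℕ) : ℕ) : ℝ) * Z.G.dts P.tf i)

theorem side_time_mem {i : Fin 2} {w m : ℕ} (hw : w ∈ Icc N₀ Z.G.N) (hm : m ∈ Icc 1 (Z.G.M i))
    (k : Fin A.ns) : 0 ≤ ((Z.G.idx i w m : ℝ) - 1 + A.θ k) * Z.G.dts P.tf i ∧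
      ((Z.G.idx i w m : ℝ) - 1 + A.θ k) * Z.G.dts P.tf i ≤ Z.tr i w m := by
  have h0 := (Z.G.dts_pos P.tf_pos i).le
  refine ⟨mul_nonneg (Z.late_θ hw hm k).1 h0, ?_⟩
  unfold tr
  gcongr
  linarith [A.θ_le_one k]

theorem sum_ρ_sq_le {i : Fin 2} {w m : ℕ} (hw : w ∈ Icc N₀ Z.G.N) (hm : m ∈ Icc 1 (Z.G.M i)) :
    Z.h i * ∑ k, ‖Z.ρ i w m k‖ ^ 2 ≤
      |K| * (Z.h i ^ (2 * A.q + 2) * Z.o i (Z.G.idx i w m)) := by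
  have hh := (Z.h_pos i).le
  -- Without side conditions the sum is empty. Otherwise any index `k₀` yields `ks ≤ idx`, so the
  -- truncated subtractions in `ρ` are exact.
  rcases isEmpty_or_nonempty (Fin A.ns) with hns | ⟨⟨k₀⟩⟩
  · simp only [Finset.univ_eq_empty, Finset.sum_empty, mul_zero]
    exact mul_nonneg (abs_nonneg _) (mul_nonneg (pow_nonneg hh _) (Z.o_nonneg _ _))
  have hks := (Z.late_θ hw hm k₀).2
  obtain ⟨hl, hr, hlr⟩ := Z.step_mem hw hm
  have hmem : ∀ l : Fin (A.ks + 1),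
      X.u i (((Z.G.idx i w m : ℝ) - (l : ℕ)) * Z.G.dts P.tf i) ∈ S.U i := by
    intro l
    refine X.sol.u_mem i _ ⟨mul_nonneg ?_ (Z.G.dts_pos P.tf_pos i).le, le_trans ?_ hr.2⟩
    · have : ((l : ℕ) : ℝ) ≤ Z.G.idx i w m := by
        exact_mod_cast (Nat.lt_succ_iff.1 l.2).trans hks
      linarith
    · unfold tr
      have := (Z.G.dts_pos P.tf_pos i).le
      gcongr
      linarith [Nat.cast_nonneg (α := ℝ) (l : ℕ)]
  have h1 := Z.cons i w hw m hm
  have h2 : ∀ k, ‖Z.ρ i w m k‖ = nrm (Ω n i)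
      (X.u i (((Z.G.idx i w m : ℝ) - 1 + A.θ k) * Z.G.dts P.tf i) -
        ∑ l : Fin (A.ks + 1), A.Dm k l •
          X.u i (((Z.G.idx i w m : ℝ) - (l : ℕ)) * Z.G.dts P.tf i)) := by
    intro k
    have hk := Z.side_time_mem hw hm k
    rw [L2Sub.norm_eq, ρ, map_sub, map_sum, RegularSolution.uH,
      L2Sub.coe_ofFun _ (X.sol.u_mem i _ ⟨hk.1, hk.2.trans hr.2⟩)]
    congr 2
    refine Finset.sum_congr rfl fun l _ => ?_
    rw [map_smul, RegularSolution.uH, Nat.cast_sub ((Nat.lt_succ_iff.1 l.2).trans hks),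
      L2Sub.coe_ofFun _ (hmem l)]
  simp_rw [h2]
  refine h1.trans ?_
  have hks' : 0 ≤ ((Z.G.idx i w m : ℝ) - A.ks) * Z.G.dts P.tf i := by
    have : (A.ks : ℝ) ≤ Z.G.idx i w m := by exact_mod_cast hks
    exact mul_nonneg (by linarith) (Z.G.dts_pos P.tf_pos i).le
  have hks2 : ((Z.G.idx i w m : ℝ) - A.ks) * Z.G.dts P.tf i ≤ Z.tr i w m := by
    unfold tr
    have := (Z.G.dts_pos P.tf_pos i).le
    gcongr
    simp
  have h3 : ∫ t in (((Z.G.idx i w m : ℝ) - A.ks) * Z.G.dts P.tf i)..(Z.tr i w m),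
      ∑ μ ∈ Finset.range (A.q + 2), nrm (Ω n i) (X.Du i μ t) ^ 2 =
      ∫ t in (((Z.G.idx i w m : ℝ) - A.ks) * Z.G.dts P.tf i)..(Z.tr i w m), X.density i t := by
    refine intervalIntegral.integral_congr fun t ht => ?_
    rw [uIcc_of_le hks2] at ht
    refine Finset.sum_congr rfl fun μ hμ => ?_
    rw [RegularSolution.W, L2Sub.norm_ofFun _ ((X.hu i).mem μ
      (by have := Finset.mem_range.1 hμ; omega) t ⟨hks'.trans ht.1, ht.2.trans hr.2⟩)]
  have h4 : ∫ t in (((Z.G.idx i w m : ℝ) - A.ks) * Z.G.dts P.tf i)..(Z.tr i w m), X.density i t ≤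
      Z.o i (Z.G.idx i w m) := by
    refine integral_le_extendZero P.tf_pos.le (X.intervalIntegrable_density i)
      (X.density_nonneg i) hks' hks2 hr.2 ?_
    have := (Z.G.dts_pos P.tf_pos i).le
    have hk : (A.ks : ℝ) ≤ A.reach := by exact_mod_cast A.ks_le_reach
    gcongr
  have h5 : 0 ≤ ∫ t in (((Z.G.idx i w m : ℝ) - A.ks) * Z.G.dts P.tf i)..(Z.tr i w m),
      X.density i t :=
    intervalIntegral.integral_nonneg hks2 fun t _ => X.density_nonneg i t
  change K * Z.h i ^ (2 * A.q + 2) *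
    (∫ t in (((Z.G.idx i w m : ℝ) - A.ks) * Z.G.dts P.tf i)..(Z.tr i w m),
      ∑ μ ∈ Finset.range (A.q + 2), nrm (Ω n i) (X.Du i μ t) ^ 2) ≤ _
  rw [h3, mul_assoc]
  refine mul_le_mul (le_abs_self K) ?_ (by positivity) (abs_nonneg _)
  gcongr

/-- The polynomial part of the state error on a substep. -/
def ξ (i : Fin 2) (w m : ℕ) (t : ℝ) : S.HU i :=
  taylor A.q (X.W i) (Z.tr i w m) t - Z.y i (Z.G.idx i w m) t

/-- At a side time `ξ` splits into the side value errors weighted by the coefficients of the side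
condition, its consistency error, and a Taylor remainder. The Taylor polynomial is centred at the
right end of the substep, at most `reach` substeps away. -/
theorem ξ_side {i : Fin 2} {w m : ℕ} (hw : w ∈ Icc N₀ Z.G.N) (hm : m ∈ Icc 1 (Z.G.M i))
    {s : ℝ} (hs : ∀ j ≤ Z.G.idx i w m, ‖Z.E i j‖ ≤ s) (k : Fin A.ns) :
    ‖Z.ξ i w m (Z.tl i w m + A.θ k * (Z.tr i w m - Z.tl i w m))‖ ≤
      (∑ l, |A.Dm k l|) * s + (‖Z.ρ i w m k‖ +
        √((A.reach * Z.h i) ^ (2 * A.q + 1) * Z.o i (Z.G.idx i w m))) := by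
  have hh := (Z.h_pos i).le
  obtain ⟨hl, hr, hlr⟩ := Z.step_mem hw hm
  obtain ⟨hk0, hk1⟩ := Z.side_time_mem hw hm k
  have ht : Z.tl i w m + A.θ k * (Z.tr i w m - Z.tl i w m) =
      ((Z.G.idx i w m : ℝ) - 1 + A.θ k) * Z.G.dts P.tf i := by
    rw [Z.tr_sub_tl, tl, h]; ring
  rw [ht]
  set tk := ((Z.G.idx i w m : ℝ) - 1 + A.θ k) * Z.G.dts P.tf i with htk
  have hside := Z.sol.side i w hw m hm k
  have hy : Z.y i (Z.G.idx i w m) tk = ∑ l : Fin (A.ks + 1),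
      A.Dm k l • L2Sub.ofFun (S.isL2Space_U i) (Z.Y.sv i (Z.G.idx i w m - (l : ℕ))) := by
    apply L2Sub.coe_injective
    rw [y, L2Sub.coe_ofFun _ (polyInTime.mem (Z.u_mem hw hm) _), hside, map_sum]
    refine Finset.sum_congr rfl fun l _ => ?_
    rw [map_smul, L2Sub.coe_ofFun _ (Z.sol.sv_mem i _
      ((Nat.sub_le _ _).trans (Z.idx_mem hw hm).2))]
  have hdec : Z.ξ i w m tk = (∑ l : Fin (A.ks + 1), A.Dm k l • Z.E i (Z.G.idx i w m - (l : ℕ))) +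
      (Z.ρ i w m k - (X.uH i tk - taylor A.q (X.W i) (Z.tr i w m) tk)) := by
    rw [ξ, hy, ρ, ← htk]
    simp only [E, smul_sub, Finset.sum_sub_distrib]
    abel
  rw [hdec]
  refine (norm_add_le _ _).trans (add_le_add ?_ ((norm_sub_le _ _).trans
    (add_le_add le_rfl ?_)))
  · rw [Finset.sum_mul]
    refine (norm_sum_le _ _).trans (Finset.sum_le_sum fun l _ => ?_)
    rw [norm_smul, Real.norm_eq_abs]
    exact mul_le_mul_of_nonneg_left (hs _ (Nat.sub_le _ _)) (abs_nonneg _)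
  · refine Real.le_sqrt_of_sq_le ?_
    have hreach : Z.tr i w m - tk ≤ A.reach * Z.h i := by
      have : Z.tr i w m - tk = (1 - A.θ k) * Z.h i := by rw [tr, htk, h]; ring
      rw [this]
      exact mul_le_mul_of_nonneg_right (A.sub_θ_le_reach k) hh
    have ha : ((Z.G.idx i w m : ℝ) - A.reach) * Z.G.dts P.tf i ≤ tk := by
      rw [htk]
      have := (Z.G.dts_pos P.tf_pos i).le
      gcongr
      linarith [A.sub_θ_le_reach k]
    refine (X.norm_uH_sub_taylor_sq_le i hk0 hk1 hr.2 ha).trans ?_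
    refine mul_le_mul_of_nonneg_right ?_ (Z.o_nonneg _ _)
    exact pow_le_pow_left₀ (sub_nonneg.2 hk1) hreach _

/-- The sum of the moduli of the coefficients of the side conditions. -/
def _root_.DGiT.TimeScheme.dsum (A : TimeScheme) : ℝ := ∑ k, ∑ l, |A.Dm k l|

/-- The factor of the consistency errors in the local estimate. -/
def _root_.DGiT.TimeScheme.consFactor (A : TimeScheme) (K : ℝ) : ℝ :=
  1 + 2 * A.ns * (|K| + A.ns * A.reach ^ (2 * A.q + 1))

/-- The local estimate. It is still implicit, since the residual contains the state error, but there
`e2` carries the factor `h²`. -/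
theorem e2_le {C c : ℝ} (hC : 0 ≤ C) (hA : A.StableWith C) (hc : FormBound S P c) {i : Fin 2}
    {w m : ℕ} (hw : w ∈ Icc N₀ Z.G.N) (hm : m ∈ Icc 1 (Z.G.M i)) {s : ℝ}
    (hs : ∀ j ≤ Z.G.idx i w m, ‖Z.E i j‖ ≤ s) :
    Z.e2 i w m ≤ 4 * (C * (A.q + 2 + A.dsum) + 1) ^ 2 *
      (Z.h i * s ^ 2 + Z.h i ^ 2 * (2 * c ^ 2 * (Z.e2 i w m + Z.f2 i w m)) +
        A.consFactor K * (Z.h i ^ (2 * A.q + 2) * Z.o i (Z.G.idx i w m))) := by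
  have hh := (Z.h_pos i).le
  have ho := Z.o_nonneg i (Z.G.idx i w m)
  obtain ⟨hl, hr, hlr⟩ := Z.step_mem hw hm
  set O := Z.o i (Z.G.idx i w m) with hO
  -- Taylor remainder of the state on the substep. Integration over the substep later raises the
  -- power `2 q + 1` to `2 q + 2`.
  set β := √(Z.h i ^ (2 * A.q + 1) * O) with hβdef
  have hβ : ∀ t ∈ Icc (Z.tl i w m) (Z.tr i w m),
      ‖Z.e i (Z.G.idx i w m) t - Z.ξ i w m t‖ ≤ β := by
    intro t ht
    have h1 : Z.e i (Z.G.idx i w m) t - Z.ξ i w m t =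
        X.uH i t - taylor A.q (X.W i) (Z.tr i w m) t := by
      rw [e, ξ]; abel
    rw [h1]
    refine Real.le_sqrt_of_sq_le ?_
    refine (X.norm_uH_sub_taylor_sq_le i (hl.1.trans ht.1) ht.2 hr.2
      (a := ((Z.G.idx i w m : ℝ) - A.reach) * Z.G.dts P.tf i) ?_).trans ?_
    · refine le_trans ?_ ht.1
      unfold tl
      have := (Z.G.dts_pos P.tf_pos i).le
      have h1 : (1 : ℝ) ≤ A.reach := by exact_mod_cast A.one_le_reach
      gcongr
    · refine mul_le_mul_of_nonneg_right ?_ ho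
      refine pow_le_pow_left₀ (sub_nonneg.2 ht.2) ?_ _
      rw [← Z.tr_sub_tl i w m]
      linarith [ht.1]
  set η := √((A.reach * Z.h i) ^ (2 * A.q + 1) * O) with hηdef
  set r := ∑ k, (‖Z.ρ i w m k‖ + η) with hrdef
  have hη0 : 0 ≤ η := Real.sqrt_nonneg _
  have hr0 : 0 ≤ r := Finset.sum_nonneg fun k _ => add_nonneg (norm_nonneg _) hη0
  have hd0 : 0 ≤ A.dsum := Finset.sum_nonneg fun _ _ => Finset.sum_nonneg fun _ _ => abs_nonneg _
  have hside : ∑ k, ‖Z.ξ i w m (Z.tl i w m + A.θ k * (Z.tr i w m - Z.tl i w m))‖ ≤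
      A.dsum * s + r := by
    refine (Finset.sum_le_sum fun k _ => Z.ξ_side hw hm hs k).trans (le_of_eq ?_)
    rw [Finset.sum_add_distrib, ← Finset.sum_mul]
    rfl
  have hξ : WeakPolynomial A.q (Z.ξ i w m) :=
    (weakPolynomial_taylor _ _ _).sub (polyInTime.weakPolynomial _ (Z.u_mem hw hm))
  have h1 := (Z.errorEquation hw hm).integral_norm_sq_le hC hA hlr
    (fun t _ φ => abs_R_le hc i w m t φ)
    (intervalIntegrable_of_continuousOn (Z.continuousOn_g c hw hm) hl hr)
    (fun t _ => mul_nonneg hc.1 (by positivity))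
    ((Z.continuousOn_e hw hm).mono (Icc_subset_Icc hl.1 hr.2)) hξ hβ
    (hs _ (Nat.sub_le _ _)) hd0 hr0 hside
  rw [Z.tr_sub_tl] at h1
  refine h1.trans (mul_le_mul_of_nonneg_left ?_ (by positivity))
  have h2 := Z.sq_integral_g_le c hw hm
  have hβ2 : Z.h i * β ^ 2 = Z.h i ^ (2 * A.q + 2) * O := by
    rw [hβdef, Real.sq_sqrt (by positivity)]; ring
  have hη2 : Z.h i * η ^ 2 = A.reach ^ (2 * A.q + 1) * (Z.h i ^ (2 * A.q + 2) * O) := by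
    rw [hηdef, Real.sq_sqrt (by positivity)]; ring
  have hr2 : Z.h i * r ^ 2 ≤ 2 * A.ns * (|K| + A.ns * A.reach ^ (2 * A.q + 1)) *
      (Z.h i ^ (2 * A.q + 2) * O) := by
    have h3 : r ^ 2 ≤ A.ns * ∑ k, (‖Z.ρ i w m k‖ + η) ^ 2 := by
      have := sq_sum_le_card_mul_sum_sq (s := (Finset.univ : Finset (Fin A.ns)))
        (f := fun k => ‖Z.ρ i w m k‖ + η)
      simpa using this
    have h4 : ∑ k, (‖Z.ρ i w m k‖ + η) ^ 2 ≤ 2 * (∑ k, ‖Z.ρ i w m k‖ ^ 2) + 2 * (A.ns * η ^ 2) := by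
      calc ∑ k, (‖Z.ρ i w m k‖ + η) ^ 2 ≤ ∑ k, (2 * ‖Z.ρ i w m k‖ ^ 2 + 2 * η ^ 2) :=
            Finset.sum_le_sum fun k _ => by nlinarith [sq_nonneg (‖Z.ρ i w m k‖ - η)]
        _ = _ := by
            rw [Finset.sum_add_distrib, ← Finset.mul_sum]
            simp; ring
    have h5 := Z.sum_ρ_sq_le hw hm
    calc Z.h i * r ^ 2 ≤ Z.h i * (A.ns * (2 * (∑ k, ‖Z.ρ i w m k‖ ^ 2) + 2 * (A.ns * η ^ 2))) := by
          gcongr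
          exact h3.trans (by gcongr)
      _ = 2 * A.ns * (Z.h i * (∑ k, ‖Z.ρ i w m k‖ ^ 2) + A.ns * (Z.h i * η ^ 2)) := by ring
      _ ≤ 2 * A.ns * (|K| * (Z.h i ^ (2 * A.q + 2) * O) +
          A.ns * (A.reach ^ (2 * A.q + 1) * (Z.h i ^ (2 * A.q + 2) * O))) := by
          rw [hη2]; gcongr
      _ = _ := by ring
  have h6 : Z.h i * (∫ t in (Z.tl i w m)..(Z.tr i w m), Z.g c i w m t) ^ 2 ≤
      Z.h i * (Z.h i * (2 * c ^ 2 * (Z.e2 i w m + Z.f2 i w m))) := by gcongr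
  change Z.h i * (s ^ 2 + (∫ t in (Z.tl i w m)..(Z.tr i w m), Z.g c i w m t) ^ 2 + β ^ 2 +
    r ^ 2) ≤ _
  unfold TimeScheme.consFactor
  linarith

end Run

/-! ### Projection errors of the coupling variables -/

/-! ### Traces and fluxes -/

/-- The Taylor polynomial at the right end of a window is the comparison function for the
projections onto the coupling spaces. -/
theorem WeakDerivs.integral_sub_taylor_sq_le {H : Type*} [NormedAddCommGroup H]
    [InnerProductSpace ℝ H] [FiniteDimensional ℝ H] {T : ℝ} {k : ℕ} {W : ℕ → ℝ → H}
    (hW : WeakDerivs T (k + 1) W) {a b : ℝ} (ha : 0 ≤ a) (hab : a ≤ b) (hb : b ≤ T) :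
    ∫ t in a..b, ‖W 0 t - taylor k W b t‖ ^ 2 ≤
      (b - a) ^ (2 * k + 2) * ∫ t in a..b, extendZero T (fun t => ‖W (k + 1) t‖ ^ 2) t := by
  have hT : 0 ≤ T := ha.trans (hab.trans hb)
  set J := ∫ t in a..b, extendZero T (fun t => ‖W (k + 1) t‖ ^ 2) t with hJ
  have hJ0 : 0 ≤ J := intervalIntegral.integral_nonneg hab fun t _ =>
    extendZero_nonneg (fun t => sq_nonneg _) t
  have hc : ContinuousOn (fun t => ‖W 0 t - taylor k W b t‖ ^ 2) (uIcc a b) := by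
    rw [uIcc_of_le hab]
    exact ((((hW.continuousOn hT (Nat.succ_pos _)).mono (Icc_subset_Icc ha hb)).sub
      (continuous_taylor k W b).continuousOn).norm.pow 2)
  calc ∫ t in a..b, ‖W 0 t - taylor k W b t‖ ^ 2 ≤ ∫ t in a..b, (b - a) ^ (2 * k + 1) * J := by
        refine intervalIntegral.integral_mono_on hab hc.intervalIntegrable
          intervalIntegrable_const fun t ht => ?_
        refine (hW.norm_sub_taylor_sq_le (ha.trans ht.1) ht.2 hb).trans ?_
        refine mul_le_mul (pow_le_pow_left₀ (sub_nonneg.2 ht.2) (by linarith [ht.1]) _)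
          (integral_le_extendZero hT (hW.norm_sq _ le_rfl) (fun t => sq_nonneg _)
            (ha.trans ht.1) ht.2 hb ht.1)
          (intervalIntegral.integral_nonneg ht.2 fun _ _ => sq_nonneg _)
          (pow_nonneg (sub_nonneg.2 hab) _)
    _ = (b - a) ^ (2 * k + 2) * J := by
        rw [intervalIntegral.integral_const, smul_eq_mul]; ring

namespace Run

variable {S : SpatialMesh n} {P : ModelProblem n} {A : TimeScheme} {X : RegularSolution S P A}
  {N₀ : ℕ} {K : ℝ} (Z : Run X N₀ K)

/-- The left end of a window. -/
def wl (w : ℕ) : ℝ := ((w : ℝ) - 1) * Z.G.dt P.tf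

/-- The right end of a window. -/
def wr (w : ℕ) : ℝ := (w : ℝ) * Z.G.dt P.tf

theorem dt_pos : 0 < Z.G.dt P.tf := Z.G.dt_pos P.tf_pos

theorem wr_sub_wl (w : ℕ) : Z.wr w - Z.wl w = Z.G.dt P.tf := by
  simp only [wr, wl]; ring

theorem wl_lt_wr (w : ℕ) : Z.wl w < Z.wr w := by
  linarith [Z.wr_sub_wl w, Z.dt_pos]

theorem wl_nonneg {w : ℕ} (hw : w ∈ Icc N₀ Z.G.N) : 0 ≤ Z.wl w := by
  have : (1 : ℝ) ≤ w := by exact_mod_cast (Z.window_mem hw).1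
  exact mul_nonneg (by linarith) Z.dt_pos.le

theorem wr_le {w : ℕ} (hw : w ∈ Icc N₀ Z.G.N) : Z.wr w ≤ P.tf :=
  Z.G.window_time_le P.tf_pos hw.2

theorem wl_mem {w : ℕ} (hw : w ∈ Icc N₀ Z.G.N) : Z.wl w ∈ Icc 0 P.tf :=
  ⟨Z.wl_nonneg hw, (Z.wl_lt_wr w).le.trans (Z.wr_le hw)⟩

theorem wr_mem {w : ℕ} (hw : w ∈ Icc N₀ Z.G.N) : Z.wr w ∈ Icc 0 P.tf :=
  ⟨(Z.wl_nonneg hw).trans (Z.wl_lt_wr w).le, Z.wr_le hw⟩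

theorem sum_steps (i : Fin 2) {w : ℕ} (hw : w ∈ Icc N₀ Z.G.N) {f : ℝ → ℝ}
    (hf : ContinuousOn f (Icc 0 P.tf)) :
    ∑ m ∈ Finset.Icc 1 (Z.G.M i), ∫ t in (Z.tl i w m)..(Z.tr i w m), f t =
      ∫ t in (Z.wl w)..(Z.wr w), f t :=
  Z.G.sum_integral_steps P.tf_pos (Z.window_mem hw)
    (intervalIntegrable_of_continuousOn hf ⟨le_rfl, P.tf_pos.le⟩ ⟨P.tf_pos.le, le_rfl⟩)

/-- The share of the `H^(r+1)` norm of the trace on a window. -/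
def JΓ (i : Fin 2) (w : ℕ) : ℝ :=
  ∫ t in (Z.wl w)..(Z.wr w), extendZero P.tf (fun t => ‖X.γ i (A.r i + 1) t‖ ^ 2) t

/-- The share of the `H^(r+1)` norm of the flux on a window. -/
def JF (i : Fin 2) (w : ℕ) : ℝ :=
  ∫ t in (Z.wl w)..(Z.wr w), extendZero P.tf (fun t => ‖X.Φ i (A.r i + 1) t‖ ^ 2) t

theorem JΓ_nonneg (i : Fin 2) (w : ℕ) : 0 ≤ Z.JΓ i w :=
  intervalIntegral.integral_nonneg (Z.wl_lt_wr w).le fun t _ =>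
    extendZero_nonneg (fun _ => sq_nonneg _) t

theorem JF_nonneg (i : Fin 2) (w : ℕ) : 0 ≤ Z.JF i w :=
  intervalIntegral.integral_nonneg (Z.wl_lt_wr w).le fun t _ =>
    extendZero_nonneg (fun _ => sq_nonneg _) t

theorem e2_nonneg (i : Fin 2) (w m : ℕ) : 0 ≤ Z.e2 i w m := by
  refine intervalIntegral.integral_nonneg ?_ fun t _ => sq_nonneg _
  linarith [Z.tr_sub_tl i w m, Z.h_pos i]

/-- The discrete trace is the projection in time of the trace of the discrete state. Tested with its
difference `q` from the Taylor polynomial, it deviates from the projection of the exact trace only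
by the pairing of `e` with `q`, at most `c² ‖e‖² + ‖q‖² / 4`; quasi-optimality does the rest. -/
theorem traces_error {c : ℝ} (hc : FormBound S P c) (i : Fin 2) {w : ℕ}
    (hw : w ∈ Icc N₀ Z.G.N) :
    ∫ t in (Z.wl w)..(Z.wr w), ‖X.γ i 0 t - Z.uΓ i w t‖ ^ 2 ≤
      4 * (c ^ 2 * ∑ m ∈ Finset.Icc 1 (Z.G.M i), Z.e2 i w m) +
        6 * (Z.G.dt P.tf ^ (2 * A.r i + 2) * Z.JΓ i w) := by
  have hlr := (Z.wl_lt_wr w).le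
  have hsub : Icc (Z.wl w) (Z.wr w) ⊆ Icc 0 P.tf := Icc_subset_Icc (Z.wl_nonneg hw) (Z.wr_le hw)
  let q : ℝ → S.HΓ := fun t => Z.uΓ i w t - taylor (A.r i) (X.γ i) (Z.wr w) t
  have hq : Continuous q := (Z.continuous_uΓ i hw).sub (continuous_taylor _ _ _)
  have hcu : ContinuousOn (fun t => formΓ S i (X.uH i t) (q t)) (Icc 0 P.tf) := by
    have h1 : ContinuousOn (fun t => (X.uH i t, q t)) (Icc 0 P.tf) :=
      (X.continuousOn_uH i).prodMk hq.continuousOn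
    exact (continuous_bilinear_left (formΓ S i)).comp_continuousOn h1
  have htr := Z.sol.traces i w hw _
    (polyInTime_sub_taylor _ (Z.sol.uΓ_mem i w hw) (X.γ i) (Z.wr w))
  have h1 : ∀ t, ip (Gam n) (Z.Y.uΓ i w t) (L2Sub.coe _ (L2Sub.ofFun S.isL2Space_UΓ
      (Z.Y.uΓ i w t) - taylor (A.r i) (X.γ i) (Z.wr w) t)) = inner ℝ (Z.uΓ i w t) (q t) :=
    fun t => (L2Sub.inner_ofFun _ (polyInTime.mem (Z.sol.uΓ_mem i w hw) t) _).symm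
  have h2 : ∀ m ∈ Finset.Icc 1 (Z.G.M i), ∀ t, ip (Gam n) (trace (Z.Y.u i (Z.G.idx i w m) t))
      (L2Sub.coe _ (L2Sub.ofFun S.isL2Space_UΓ
      (Z.Y.uΓ i w t) - taylor (A.r i) (X.γ i) (Z.wr w) t)) =
      formΓ S i (Z.y i (Z.G.idx i w m) t) (q t) := by
    intro m hm t
    rw [formΓ_apply, y, L2Sub.coe_ofFun _ (polyInTime.mem (Z.u_mem hw (Finset.mem_Icc.1 hm)) t)]
    rfl
  simp_rw [h1] at htr
  rw [Finset.sum_congr rfl fun m hm => intervalIntegral.integral_congr fun t _ => h2 m hm t] at htr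
  change ∫ t in (Z.wl w)..(Z.wr w), inner ℝ (Z.uΓ i w t) (q t) = ∑ m ∈ Finset.Icc 1 (Z.G.M i),
    ∫ t in (Z.tl i w m)..(Z.tr i w m), formΓ S i (Z.y i (Z.G.idx i w m) t) (q t) at htr
  -- The two subdomains have different substeps, so the exact trace is split along the substeps of
  -- subdomain `i` for comparison with the discrete states.
  have h3 : ∫ t in (Z.wl w)..(Z.wr w), inner ℝ (X.γ i 0 t) (q t) =
      ∑ m ∈ Finset.Icc 1 (Z.G.M i),
        ∫ t in (Z.tl i w m)..(Z.tr i w m), formΓ S i (X.uH i t) (q t) := by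
    rw [Z.sum_steps i hw hcu, intervalIntegral.integral_of_le hlr,
      intervalIntegral.integral_of_le hlr]
    refine integral_congr_ae ?_
    filter_upwards [ae_Ioc_of_mem (Z.wl_nonneg hw) (Z.wr_le hw) (X.ae_trace i)] with t ht
    exact (ht (q t)).symm
  have hi1 : IntervalIntegrable (fun t => inner ℝ (Z.uΓ i w t) (q t)) volume (Z.wl w) (Z.wr w) :=
    ((Z.continuous_uΓ i hw).inner hq).intervalIntegrable _ _
  have hi2 : IntervalIntegrable (fun t => inner ℝ (X.γ i 0 t) (q t)) volume (Z.wl w) (Z.wr w) :=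
    intervalIntegrable_of_continuousOn ((X.continuousOn_γ i).inner hq.continuousOn)
      (Z.wl_mem hw) (Z.wr_mem hw)
  have hstep : ∀ m ∈ Finset.Icc 1 (Z.G.M i),
      (∫ t in (Z.tl i w m)..(Z.tr i w m), formΓ S i (Z.y i (Z.G.idx i w m) t) (q t)) -
        ∫ t in (Z.tl i w m)..(Z.tr i w m), formΓ S i (X.uH i t) (q t) ≤
      c ^ 2 * Z.e2 i w m + 1 / 4 * ∫ t in (Z.tl i w m)..(Z.tr i w m), ‖q t‖ ^ 2 := by
    intro m hm
    have hm' := Finset.mem_Icc.1 hm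
    obtain ⟨hl, hr, hlr⟩ := Z.step_mem hw hm'
    have i1 : IntervalIntegrable (fun t => formΓ S i (Z.y i (Z.G.idx i w m) t) (q t)) volume
        (Z.tl i w m) (Z.tr i w m) := by
      have h1 : Continuous fun t => (Z.y i (Z.G.idx i w m) t, q t) :=
        (Z.continuous_y hw hm').prodMk hq
      exact ((continuous_bilinear_left (formΓ S i)).comp h1).intervalIntegrable _ _
    have i2 := intervalIntegrable_of_continuousOn hcu hl hr
    have i3 : IntervalIntegrable (fun t => ‖Z.e i (Z.G.idx i w m) t‖ ^ 2) volume
        (Z.tl i w m) (Z.tr i w m) :=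
      intervalIntegrable_of_continuousOn ((Z.continuousOn_e hw hm').norm.pow 2) hl hr
    have i4 : IntervalIntegrable (fun t => ‖q t‖ ^ 2) volume (Z.tl i w m) (Z.tr i w m) :=
      (hq.norm.pow 2).intervalIntegrable _ _
    rw [e2, ← intervalIntegral.integral_sub i1 i2, ← intervalIntegral.integral_const_mul,
      ← intervalIntegral.integral_const_mul,
      ← intervalIntegral.integral_add (i3.const_mul _) (i4.const_mul _)]
    refine intervalIntegral.integral_mono_on hlr.le (i1.sub i2)
      ((i3.const_mul _).add (i4.const_mul _)) fun t _ => ?_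
    have h4 := hc.2.2 i (Z.e i (Z.G.idx i w m) t) (q t)
    have h5 : formΓ S i (Z.y i (Z.G.idx i w m) t) (q t) - formΓ S i (X.uH i t) (q t) =
        -formΓ S i (Z.e i (Z.G.idx i w m) t) (q t) := by
      generalize q t = z
      rw [e, (formΓ S i).map_sub, LinearMap.sub_apply]; ring
    rw [h5]
    have h6 := neg_le_abs (formΓ S i (Z.e i (Z.G.idx i w m) t) (q t))
    nlinarith [sq_nonneg (c * ‖Z.e i (Z.G.idx i w m) t‖ - 1 / 2 * ‖q t‖)]
  have hcond : ∫ t in (Z.wl w)..(Z.wr w), inner ℝ (Z.uΓ i w t - X.γ i 0 t)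
      (Z.uΓ i w t - taylor (A.r i) (X.γ i) (Z.wr w) t) ≤
      c ^ 2 * (∑ m ∈ Finset.Icc 1 (Z.G.M i), Z.e2 i w m) + 1 / 4 * ∫ t in (Z.wl w)..(Z.wr w),
        ‖Z.uΓ i w t - taylor (A.r i) (X.γ i) (Z.wr w) t‖ ^ 2 := by
    have h4 : ∫ t in (Z.wl w)..(Z.wr w), inner ℝ (Z.uΓ i w t - X.γ i 0 t) (q t) =
        (∫ t in (Z.wl w)..(Z.wr w), inner ℝ (Z.uΓ i w t) (q t)) -
          ∫ t in (Z.wl w)..(Z.wr w), inner ℝ (X.γ i 0 t) (q t) := by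
      rw [← intervalIntegral.integral_sub hi1 hi2]
      simp_rw [inner_sub_left]
    change ∫ t in (Z.wl w)..(Z.wr w), inner ℝ (Z.uΓ i w t - X.γ i 0 t) (q t) ≤
      c ^ 2 * (∑ m ∈ Finset.Icc 1 (Z.G.M i), Z.e2 i w m) +
        1 / 4 * ∫ t in (Z.wl w)..(Z.wr w), ‖q t‖ ^ 2
    rw [h4, htr, h3, ← Finset.sum_sub_distrib]
    refine (Finset.sum_le_sum hstep).trans (le_of_eq ?_)
    have hqc : ContinuousOn (fun t => ‖q t‖ ^ 2) (Icc 0 P.tf) := (hq.norm.pow 2).continuousOn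
    rw [Finset.sum_add_distrib, ← Finset.mul_sum, ← Finset.mul_sum, Z.sum_steps i hw hqc]
  have h5 := integral_norm_sub_sq_le hlr ((X.continuousOn_γ i).mono hsub)
    (Z.continuous_uΓ i hw).continuousOn (continuous_taylor _ _ _).continuousOn hcond
  have h6 := (X.weakDerivs_γ i).integral_sub_taylor_sq_le (Z.wl_nonneg hw) hlr (Z.wr_le hw)
  rw [Z.wr_sub_wl] at h6
  refine h5.trans ?_
  gcongr
  exact h6

/-- The squared flux error on a window. -/
def fl (i : Fin 2) (w : ℕ) : ℝ := ∫ t in (Z.wl w)..(Z.wr w), ‖Z.δF i w t‖ ^ 2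

theorem sum_f2 (i : Fin 2) {w : ℕ} (hw : w ∈ Icc N₀ Z.G.N) :
    ∑ m ∈ Finset.Icc 1 (Z.G.M i), Z.f2 i w m = Z.fl i w :=
  Z.sum_steps i hw ((Z.continuousOn_δF i hw).norm.pow 2)

/-- The same argument for the flux. Once `g` is eliminated, the perturbation consists of the two
trace errors; Young's inequality spends `‖q‖² / 8` on each, which makes up the quarter that
quasi-optimality allows. -/
theorem flux_error (i : Fin 2) {w : ℕ} (hw : w ∈ Icc N₀ Z.G.N) :
    Z.fl i w ≤ 4 * (2 * ∑ j, P.b i j ^ 2 *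
        ∫ t in (Z.wl w)..(Z.wr w), ‖X.γ j 0 t - Z.uΓ j w t‖ ^ 2) +
      6 * (Z.G.dt P.tf ^ (2 * A.r i + 2) * Z.JF i w) := by
  have hlr := (Z.wl_lt_wr w).le
  have hsub : Icc (Z.wl w) (Z.wr w) ⊆ Icc 0 P.tf := Icc_subset_Icc (Z.wl_nonneg hw) (Z.wr_le hw)
  let q : ℝ → S.HΓ := fun t => Z.F i w t - taylor (A.r i) (X.Φ i) (Z.wr w) t
  have hq : Continuous q := (Z.continuous_F i hw).sub (continuous_taylor _ _ _)
  have hfl := Z.sol.fluxes i w hw _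
    (polyInTime_sub_taylor _ (Z.sol.F_mem i w hw) (X.Φ i) (Z.wr w))
  have h1 : ∀ t, ip (Gam n) (Z.Y.F i w t) (L2Sub.coe _ (L2Sub.ofFun S.isL2Space_UΓ
      (Z.Y.F i w t) - taylor (A.r i) (X.Φ i) (Z.wr w) t)) = inner ℝ (Z.F i w t) (q t) :=
    fun t => (L2Sub.inner_ofFun _ (polyInTime.mem (Z.sol.F_mem i w hw) t) _).symm
  simp_rw [h1] at hfl
  have hcγ : ∀ j, ContinuousOn (fun t => inner ℝ (Z.uΓ j w t - X.γ j 0 t) (q t)) (Icc 0 P.tf) :=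
    fun j => ((Z.continuous_uΓ j hw).continuousOn.sub (X.continuousOn_γ j)).inner hq.continuousOn
  have iγ : ∀ j, IntervalIntegrable (fun t => P.b i j * inner ℝ (Z.uΓ j w t - X.γ j 0 t) (q t))
      volume (Z.wl w) (Z.wr w) := fun j =>
    (intervalIntegrable_of_continuousOn (hcγ j) (Z.wl_mem hw) (Z.wr_mem hw)).const_mul _
  have iΦ : IntervalIntegrable (fun t => inner ℝ (X.Φ i 0 t) (q t)) volume (Z.wl w) (Z.wr w) :=
    intervalIntegrable_of_continuousOn ((X.continuousOn_Φ i).inner hq.continuousOn)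
      (Z.wl_mem hw) (Z.wr_mem hw)
  have iF : IntervalIntegrable (fun t => inner ℝ (Z.F i w t) (q t)) volume (Z.wl w) (Z.wr w) :=
    ((Z.continuous_F i hw).inner hq).intervalIntegrable _ _
  have h2 : ∫ t in (Z.wl w)..(Z.wr w), inner ℝ (Z.F i w t) (q t) =
      ∫ t in (Z.wl w)..(Z.wr w), (P.b i 0 * inner ℝ (Z.uΓ 0 w t - X.γ 0 0 t) (q t) +
        P.b i 1 * inner ℝ (Z.uΓ 1 w t - X.γ 1 0 t) (q t) + inner ℝ (X.Φ i 0 t) (q t)) := by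
    refine Eq.trans hfl ?_
    change ∫ t in (Z.wl w)..(Z.wr w), _ = _
    rw [intervalIntegral.integral_of_le hlr, intervalIntegral.integral_of_le hlr]
    refine integral_congr_ae ?_
    filter_upwards [ae_Ioc_of_mem (Z.wl_nonneg hw) (Z.wr_le hw) (X.ae_interface i)] with t ht
    have h3 := ht (Z.uΓ 0 w t) (Z.uΓ 1 w t) (q t)
    have h4 : ∀ j, L2Sub.coe S.isL2Space_UΓ (Z.uΓ j w t) = Z.Y.uΓ j w t := fun j =>
      L2Sub.coe_ofFun _ (polyInTime.mem (Z.sol.uΓ_mem j w hw) t)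
    rw [h4, h4] at h3
    exact h3
  have hcond : ∫ t in (Z.wl w)..(Z.wr w), inner ℝ (Z.F i w t - X.Φ i 0 t)
      (Z.F i w t - taylor (A.r i) (X.Φ i) (Z.wr w) t) ≤
      2 * (∑ j, P.b i j ^ 2 * ∫ t in (Z.wl w)..(Z.wr w), ‖X.γ j 0 t - Z.uΓ j w t‖ ^ 2) +
        1 / 4 * ∫ t in (Z.wl w)..(Z.wr w),
          ‖Z.F i w t - taylor (A.r i) (X.Φ i) (Z.wr w) t‖ ^ 2 := by
    have h4 : ∫ t in (Z.wl w)..(Z.wr w), inner ℝ (Z.F i w t - X.Φ i 0 t) (q t) =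
        ∫ t in (Z.wl w)..(Z.wr w), (P.b i 0 * inner ℝ (Z.uΓ 0 w t - X.γ 0 0 t) (q t) +
          P.b i 1 * inner ℝ (Z.uΓ 1 w t - X.γ 1 0 t) (q t)) := by
      simp_rw [inner_sub_left]
      rw [intervalIntegral.integral_sub iF iΦ, h2,
        intervalIntegral.integral_add ((iγ 0).add (iγ 1)) iΦ]
      simp_rw [inner_sub_left]
      ring
    change ∫ t in (Z.wl w)..(Z.wr w), inner ℝ (Z.F i w t - X.Φ i 0 t) (q t) ≤
      2 * (∑ j, P.b i j ^ 2 * ∫ t in (Z.wl w)..(Z.wr w), ‖X.γ j 0 t - Z.uΓ j w t‖ ^ 2) +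
        1 / 4 * ∫ t in (Z.wl w)..(Z.wr w), ‖q t‖ ^ 2
    have i5 : ∀ j, IntervalIntegrable (fun t => P.b i j ^ 2 * ‖X.γ j 0 t - Z.uΓ j w t‖ ^ 2)
        volume (Z.wl w) (Z.wr w) := fun j =>
      (intervalIntegrable_of_continuousOn (((X.continuousOn_γ j).sub
        (Z.continuous_uΓ j hw).continuousOn).norm.pow 2) (Z.wl_mem hw) (Z.wr_mem hw)).const_mul _
    have i6 : IntervalIntegrable (fun t => ‖q t‖ ^ 2) volume (Z.wl w) (Z.wr w) :=
      (hq.norm.pow 2).intervalIntegrable _ _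
    rw [h4, Fin.sum_univ_two, ← intervalIntegral.integral_const_mul,
      ← intervalIntegral.integral_const_mul, ← intervalIntegral.integral_add (i5 0) (i5 1),
      ← intervalIntegral.integral_const_mul, ← intervalIntegral.integral_const_mul,
      ← intervalIntegral.integral_add (((i5 0).add (i5 1)).const_mul _) (i6.const_mul _)]
    refine intervalIntegral.integral_mono_on hlr ((iγ 0).add (iγ 1))
      ((((i5 0).add (i5 1)).const_mul _).add (i6.const_mul _)) fun t _ => ?_
    have h5 : ∀ j, P.b i j * inner ℝ (Z.uΓ j w t - X.γ j 0 t) (q t) ≤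
        2 * (P.b i j ^ 2 * ‖X.γ j 0 t - Z.uΓ j w t‖ ^ 2) + 1 / 8 * ‖q t‖ ^ 2 := by
      intro j
      have h6 := abs_real_inner_le_norm (Z.uΓ j w t - X.γ j 0 t) (q t)
      rw [norm_sub_rev] at h6
      have h7 : P.b i j * inner ℝ (Z.uΓ j w t - X.γ j 0 t) (q t) ≤
          |P.b i j| * (‖X.γ j 0 t - Z.uΓ j w t‖ * ‖q t‖) := by
        refine (le_abs_self _).trans ?_
        rw [abs_mul]
        gcongr
      rw [← sq_abs (P.b i j)]
      nlinarith [sq_nonneg (2 * (|P.b i j| * ‖X.γ j 0 t - Z.uΓ j w t‖) - 1 / 2 * ‖q t‖)]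
    have := h5 0
    have := h5 1
    linarith
  have h5 := integral_norm_sub_sq_le hlr ((X.continuousOn_Φ i).mono hsub)
    (Z.continuous_F i hw).continuousOn (continuous_taylor _ _ _).continuousOn hcond
  have h6 := (X.weakDerivs_Φ i).integral_sub_taylor_sq_le (Z.wl_nonneg hw) hlr (Z.wr_le hw)
  rw [Z.wr_sub_wl] at h6
  refine h5.trans ?_
  gcongr
  exact h6

end Run

/-! ### Error bounds on the windows -/

theorem sum_windows_le {N₀ N M : ℕ} (h0 : 1 ≤ N₀) {f : ℕ → ℝ} (hf : ∀ j, 0 ≤ f j) :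
    ∑ w ∈ Finset.Icc N₀ N, ∑ m ∈ Finset.Icc 1 M, f ((w - 1) * M + m) ≤
      ∑ j ∈ Finset.range (N * M), f (j + 1) := by
  have h1 : ∀ N : ℕ, ∑ w ∈ Finset.Icc 1 N, ∑ m ∈ Finset.Icc 1 M, f ((w - 1) * M + m) =
      ∑ j ∈ Finset.range (N * M), f (j + 1) := by
    intro N
    induction N with
    | zero => simp
    | succ N ih =>
      rw [Finset.sum_Icc_succ_top (by omega), ih, add_mul, one_mul, Finset.sum_range_add,
        sum_Icc_one_eq_range]
      simp only [Nat.add_sub_cancel, add_assoc]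
  rw [← h1]
  exact Finset.sum_le_sum_of_subset_of_nonneg (Finset.Icc_subset_Icc_left h0)
    fun w _ _ => Finset.sum_nonneg fun m _ => hf _

namespace Run

variable {S : SpatialMesh n} {P : ModelProblem n} {A : TimeScheme} {X : RegularSolution S P A}
  {N₀ : ℕ} {K : ℝ} (Z : Run X N₀ K)

/-- The largest side value error up to the end of a window. -/
def maxSideError (w : ℕ) : ℝ :=
  Finset.univ.sup' Finset.univ_nonempty fun i : Fin 2 =>
    (Finset.range (w * Z.G.M i + 1)).sup' Finset.nonempty_range_add_one fun j => ‖Z.E i j‖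

theorem norm_E_le_maxSideError {i : Fin 2} {w j : ℕ} (hj : j ≤ w * Z.G.M i) :
    ‖Z.E i j‖ ≤ Z.maxSideError w :=
  (Finset.le_sup' (fun j => ‖Z.E i j‖) (Finset.mem_range.2 (Nat.lt_succ_of_le hj))).trans
    (Finset.le_sup' (fun i : Fin 2 => (Finset.range (w * Z.G.M i + 1)).sup'
      Finset.nonempty_range_add_one fun j => ‖Z.E i j‖) (Finset.mem_univ i))

theorem maxSideError_le {w : ℕ} {B : ℝ} (h : ∀ i, ∀ j ≤ w * Z.G.M i, ‖Z.E i j‖ ≤ B) :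
    Z.maxSideError w ≤ B :=
  Finset.sup'_le _ _ fun i _ => Finset.sup'_le _ _ fun j hj =>
    h i j (Nat.lt_succ_iff.1 (Finset.mem_range.1 hj))

theorem maxSideError_nonneg (w : ℕ) : 0 ≤ Z.maxSideError w :=
  (norm_nonneg _).trans (Z.norm_E_le_maxSideError (i := 0) (Nat.zero_le _))

/-- The squared state error on a window. -/
def stateSq (w : ℕ) : ℝ := ∑ i, ∑ m ∈ Finset.Icc 1 (Z.G.M i), Z.e2 i w m

/-- The squared flux error of both subdomains on a window. -/
def fluxSq (w : ℕ) : ℝ := ∑ i, Z.fl i w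

/-- The squared consistency error of one subdomain on a window. -/
def defect (i : Fin 2) (w : ℕ) : ℝ :=
  Z.h i ^ (2 * A.q + 2) * (∑ m ∈ Finset.Icc 1 (Z.G.M i), Z.o i (Z.G.idx i w m)) +
    Z.G.dt P.tf ^ (2 * A.r i + 2) * (Z.JΓ i w + Z.JF i w)

theorem defect_nonneg (i : Fin 2) (w : ℕ) : 0 ≤ Z.defect i w := by
  have h1 : 0 ≤ ∑ m ∈ Finset.Icc 1 (Z.G.M i), Z.o i (Z.G.idx i w m) :=
    Finset.sum_nonneg fun m _ => Z.o_nonneg _ _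
  have h2 := (Z.h_pos i).le
  have h3 := Z.dt_pos.le
  have h4 := Z.JΓ_nonneg i w
  have h5 := Z.JF_nonneg i w
  exact add_nonneg (mul_nonneg (pow_nonneg h2 _) h1)
    (mul_nonneg (pow_nonneg h3 _) (add_nonneg h4 h5))

theorem defect_le_sum (i : Fin 2) (w : ℕ) : Z.defect i w ≤ ∑ i, Z.defect i w :=
  Finset.single_le_sum (fun i _ => Z.defect_nonneg i w) (Finset.mem_univ i)

theorem sum_e2_nonneg (i : Fin 2) (w : ℕ) : 0 ≤ ∑ m ∈ Finset.Icc 1 (Z.G.M i), Z.e2 i w m :=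
  Finset.sum_nonneg fun m _ => Z.e2_nonneg i w m

theorem stateSq_nonneg (w : ℕ) : 0 ≤ Z.stateSq w :=
  Finset.sum_nonneg fun i _ => Z.sum_e2_nonneg i w

theorem sum_e2_le_stateSq (i : Fin 2) (w : ℕ) :
    ∑ m ∈ Finset.Icc 1 (Z.G.M i), Z.e2 i w m ≤ Z.stateSq w :=
  Finset.single_le_sum (f := fun i => ∑ m ∈ Finset.Icc 1 (Z.G.M i), Z.e2 i w m)
    (fun i _ => Z.sum_e2_nonneg i w) (Finset.mem_univ i)

theorem fl_nonneg (i : Fin 2) (w : ℕ) : 0 ≤ Z.fl i w :=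
  intervalIntegral.integral_nonneg (Z.wl_lt_wr w).le fun _ _ => sq_nonneg _

/-- The local estimates are summed. The `M i` copies of `h S²` add up to `dt S²`, so no power is
lost and the substep numbers disappear; the factor 2 counts the subdomains. -/
theorem stateSq_le {C c : ℝ} (hC : 0 ≤ C) (hA : A.StableWith C) (hc : FormBound S P c) {w : ℕ}
    (hw : w ∈ Icc N₀ Z.G.N) :
    Z.stateSq w ≤ 4 * (C * (A.q + 2 + A.dsum) + 1) ^ 2 *
      (2 * (Z.G.dt P.tf * Z.maxSideError w ^ 2) +
        Z.G.dt P.tf ^ 2 * (2 * c ^ 2 * (Z.stateSq w + Z.fluxSq w)) +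
        A.consFactor K * ∑ i, Z.defect i w) := by
  have hK0 : 0 ≤ A.consFactor K := by
    unfold TimeScheme.consFactor; positivity
  have key : ∀ i, ∑ m ∈ Finset.Icc 1 (Z.G.M i), Z.e2 i w m ≤
      4 * (C * (A.q + 2 + A.dsum) + 1) ^ 2 *
      (Z.G.dt P.tf * Z.maxSideError w ^ 2 +
        Z.G.dt P.tf ^ 2 * (2 * c ^ 2 * ((∑ m ∈ Finset.Icc 1 (Z.G.M i), Z.e2 i w m) + Z.fl i w)) +
        A.consFactor K * Z.defect i w) := by
    intro i
    have hh := (Z.h_pos i).le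
    have hhd : Z.h i ≤ Z.G.dt P.tf := Z.G.dts_le_dt P.tf_pos i
    refine (Finset.sum_le_sum fun m hm => Z.e2_le hC hA hc hw (Finset.mem_Icc.1 hm)
      (s := Z.maxSideError w) fun j hj => Z.norm_E_le_maxSideError
        (hj.trans (Z.G.idx_le (Z.window_mem hw).1 (Finset.mem_Icc.1 hm).2))).trans ?_
    rw [← Finset.mul_sum]
    refine mul_le_mul_of_nonneg_left ?_ (by positivity)
    rw [Finset.sum_add_distrib, Finset.sum_add_distrib, Finset.sum_const, Nat.card_Icc,
      Nat.add_sub_cancel, nsmul_eq_mul, ← mul_assoc, ← Finset.mul_sum, ← Finset.mul_sum,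
      ← Finset.mul_sum, ← Finset.mul_sum, Finset.sum_add_distrib, Z.sum_f2 i hw]
    have hMh : (Z.G.M i : ℝ) * Z.h i = Z.G.dt P.tf := Z.G.M_mul_dts i
    rw [hMh]
    have h1 := Z.sum_e2_nonneg i w
    have h2 := Z.fl_nonneg i w
    have h3 := Z.JΓ_nonneg i w
    have h4 := Z.JF_nonneg i w
    have h5 := Z.dt_pos.le
    have h6 : Z.h i ^ (2 * A.q + 2) * (∑ m ∈ Finset.Icc 1 (Z.G.M i), Z.o i (Z.G.idx i w m)) ≤
        Z.defect i w :=
      le_add_of_nonneg_right (mul_nonneg (pow_nonneg h5 _) (add_nonneg h3 h4))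
    have h7 : Z.h i ^ 2 ≤ Z.G.dt P.tf ^ 2 := pow_le_pow_left₀ hh hhd 2
    exact add_le_add (add_le_add le_rfl (mul_le_mul_of_nonneg_right h7
      (mul_nonneg (mul_nonneg zero_le_two (sq_nonneg c)) (add_nonneg h1 h2))))
      (mul_le_mul_of_nonneg_left h6 hK0)
  refine (Finset.sum_le_sum fun i _ => key i).trans (le_of_eq ?_)
  simp only [stateSq, fluxSq, Fin.sum_univ_two]
  ring

theorem fluxSq_le {c : ℝ} (hc : FormBound S P c) {w : ℕ} (hw : w ∈ Icc N₀ Z.G.N) :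
    Z.fluxSq w ≤ (8 * (∑ i, ∑ j, P.b i j ^ 2) * (4 * c ^ 2 + 6) + 6) *
      (Z.stateSq w + ∑ i, Z.defect i w) := by
  set D := ∑ i, Z.defect i w with hD
  have hD0 : 0 ≤ D := Finset.sum_nonneg fun i _ => Z.defect_nonneg i w
  have hs := Z.stateSq_nonneg w
  have hdt := Z.dt_pos.le
  have ho : ∀ i, 0 ≤ Z.h i ^ (2 * A.q + 2) *
      (∑ m ∈ Finset.Icc 1 (Z.G.M i), Z.o i (Z.G.idx i w m)) := fun i =>
    mul_nonneg (pow_nonneg (Z.h_pos i).le _) (Finset.sum_nonneg fun m _ => Z.o_nonneg _ _)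
  have h1 : ∀ j, ∫ t in (Z.wl w)..(Z.wr w), ‖X.γ j 0 t - Z.uΓ j w t‖ ^ 2 ≤
      (4 * c ^ 2 + 6) * (Z.stateSq w + D) := by
    intro j
    have h2 : Z.G.dt P.tf ^ (2 * A.r j + 2) * Z.JΓ j w ≤ D := by
      refine le_trans ?_ (Z.defect_le_sum j w)
      have := mul_nonneg (pow_nonneg hdt (2 * A.r j + 2)) (Z.JF_nonneg j w)
      have := ho j
      unfold defect
      linarith
    have h3 := Z.sum_e2_le_stateSq j w
    calc _ ≤ _ := Z.traces_error hc j hw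
      _ ≤ 4 * (c ^ 2 * Z.stateSq w) + 6 * D := by gcongr
      _ ≤ _ := by nlinarith [mul_nonneg (sq_nonneg c) hD0]
  have h2 : ∀ i, Z.fl i w ≤ 8 * ((∑ j, P.b i j ^ 2) * ((4 * c ^ 2 + 6) * (Z.stateSq w + D))) +
      6 * Z.defect i w := by
    intro i
    have h3 : Z.G.dt P.tf ^ (2 * A.r i + 2) * Z.JF i w ≤ Z.defect i w := by
      have := mul_nonneg (pow_nonneg hdt (2 * A.r i + 2)) (Z.JΓ_nonneg i w)
      have := ho i
      unfold defect
      linarith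
    have h4 : ∑ j, P.b i j ^ 2 * ∫ t in (Z.wl w)..(Z.wr w), ‖X.γ j 0 t - Z.uΓ j w t‖ ^ 2 ≤
        (∑ j, P.b i j ^ 2) * ((4 * c ^ 2 + 6) * (Z.stateSq w + D)) := by
      rw [Finset.sum_mul]
      exact Finset.sum_le_sum fun j _ => mul_le_mul_of_nonneg_left (h1 j) (sq_nonneg _)
    linarith [Z.flux_error i hw]
  refine (Finset.sum_le_sum fun i _ => h2 i).trans ?_
  rw [Finset.sum_add_distrib, ← Finset.mul_sum, ← Finset.mul_sum, ← Finset.sum_mul, ← hD]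
  linarith

/-- Inside a window the side errors grow by the integrals of the residual bound. Cauchy–Schwarz over
the `M i` substeps together with `M i * h i = dt` keeps the estimate independent of the number of
substeps. -/
theorem exists_maxSideError_le {c : ℝ} (hc : FormBound S P c) {w : ℕ}
    (hw : w ∈ Icc N₀ Z.G.N) : ∃ y, Z.maxSideError w ≤ Z.maxSideError (w - 1) + y ∧
      y ^ 2 ≤ 4 * c ^ 2 * (Z.G.dt P.tf * (Z.stateSq w + Z.fluxSq w)) := by
  have hw1 := (Z.window_mem hw).1
  let a : Fin 2 → ℕ → ℝ := fun i m => ∫ t in (Z.tl i w m)..(Z.tr i w m), Z.g c i w m t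
  have ha : ∀ i, ∀ m ∈ Icc 1 (Z.G.M i), 0 ≤ a i m := fun i m hm =>
    intervalIntegral.integral_nonneg (Z.step_mem hw hm).2.2.le fun t _ =>
      mul_nonneg hc.1 (by positivity)
  let y : Fin 2 → ℝ := fun i => ∑ m ∈ Finset.Icc 1 (Z.G.M i), a i m
  have hy : ∀ i, 0 ≤ y i := fun i => Finset.sum_nonneg fun m hm => ha i m (Finset.mem_Icc.1 hm)
  refine ⟨∑ i, y i, Z.maxSideError_le fun i j hj => ?_, ?_⟩
  · have hstep : ∀ k ≤ Z.G.M i, ‖Z.E i (Z.G.idx i w k)‖ ≤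
        Z.maxSideError (w - 1) + ∑ m ∈ Finset.Icc 1 k, a i m := by
      intro k
      induction k with
      | zero =>
        intro _
        simpa using Z.norm_E_le_maxSideError (i := i) (w := w - 1) (j := Z.G.idx i w 0) le_rfl
      | succ k ih =>
        intro hk
        have h1 := ih (by omega)
        have h2 := Z.norm_E_sub_le hc hw (i := i) (m := k + 1) ⟨by omega, hk⟩
        rw [Z.G.idx_succ, Nat.add_sub_cancel, ← Z.G.idx_succ] at h2
        have h3 := norm_sub_norm_le (Z.E i (Z.G.idx i w (k + 1))) (Z.E i (Z.G.idx i w k))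
        rw [Finset.sum_Icc_succ_top (by omega)]
        change _ ≤ a i (k + 1) at h2
        linarith
    have hyi : y i ≤ ∑ i, y i := Finset.single_le_sum (fun i _ => hy i) (Finset.mem_univ i)
    -- A side value either belongs to an earlier window or is reached from the last earlier one by
    -- at most `M i` substeps.
    rcases le_total j ((w - 1) * Z.G.M i) with h | h
    · exact (Z.norm_E_le_maxSideError h).trans
        (le_add_of_nonneg_right ((hy i).trans hyi))
    · obtain ⟨k, rfl⟩ := Nat.exists_eq_add_of_le h
      have hk : k ≤ Z.G.M i := by
        obtain ⟨v, rfl⟩ : ∃ v, w = v + 1 := ⟨w - 1, by omega⟩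
        rw [Nat.add_sub_cancel, add_mul, one_mul] at hj
        omega
      refine (hstep k hk).trans (add_le_add le_rfl (le_trans ?_ hyi))
      exact Finset.sum_le_sum_of_subset_of_nonneg (Finset.Icc_subset_Icc_right hk)
        fun m hm _ => ha i m (Finset.mem_Icc.1 hm)
  · have h1 : ∀ i, y i ^ 2 ≤ 2 * c ^ 2 * (Z.G.dt P.tf *
        ((∑ m ∈ Finset.Icc 1 (Z.G.M i), Z.e2 i w m) + Z.fl i w)) := by
      intro i
      have h2 := sq_sum_le_card_mul_sum_sq (s := Finset.Icc 1 (Z.G.M i)) (f := a i)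
      rw [Nat.card_Icc, Nat.add_sub_cancel] at h2
      have hMh : (Z.G.M i : ℝ) * Z.h i = Z.G.dt P.tf := Z.G.M_mul_dts i
      calc y i ^ 2 ≤ Z.G.M i * ∑ m ∈ Finset.Icc 1 (Z.G.M i), a i m ^ 2 := h2
        _ ≤ Z.G.M i * ∑ m ∈ Finset.Icc 1 (Z.G.M i),
            Z.h i * (2 * c ^ 2 * (Z.e2 i w m + Z.f2 i w m)) := by
          gcongr with m hm
          exact Z.sq_integral_g_le c hw (Finset.mem_Icc.1 hm)
        _ = _ := by
          rw [← Finset.mul_sum, ← Finset.mul_sum, Finset.sum_add_distrib, Z.sum_f2 i hw, ← hMh]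
          ring
    have h3 := sq_sum_le_card_mul_sum_sq (s := (Finset.univ : Finset (Fin 2))) (f := y)
    rw [Finset.card_univ, Fintype.card_fin] at h3
    calc (∑ i, y i) ^ 2 ≤ 2 * ∑ i, y i ^ 2 := by exact_mod_cast h3
      _ ≤ 2 * ∑ i, 2 * c ^ 2 * (Z.G.dt P.tf *
        ((∑ m ∈ Finset.Icc 1 (Z.G.M i), Z.e2 i w m) + Z.fl i w)) := by
        gcongr with i; exact h1 i
      _ = _ := by
        rw [← Finset.mul_sum, ← Finset.mul_sum, Finset.sum_add_distrib]
        unfold stateSq fluxSq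
        ring

/-! ### Summation of the defects and the global error bound -/

/-- The size of the derivatives of the semi-discrete solution. -/
def _root_.DGiT.RegularSolution.size (X : RegularSolution S P A) : ℝ :=
  ∑ i, (A.reach * (∫ t, X.ω i t) +
    ((∫ t, extendZero P.tf (fun t => ‖X.γ i (A.r i + 1) t‖ ^ 2) t) +
      ∫ t, extendZero P.tf (fun t => ‖X.Φ i (A.r i + 1) t‖ ^ 2) t))

theorem _root_.DGiT.RegularSolution.size_term_nonneg (X : RegularSolution S P A) (i : Fin 2) :
    0 ≤ A.reach * (∫ t, X.ω i t) +
    ((∫ t, extendZero P.tf (fun t => ‖X.γ i (A.r i + 1) t‖ ^ 2) t) +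
      ∫ t, extendZero P.tf (fun t => ‖X.Φ i (A.r i + 1) t‖ ^ 2) t) := by
  have h1 : 0 ≤ ∫ t, X.ω i t := integral_nonneg fun t => extendZero_nonneg (X.density_nonneg i) t
  have h2 : 0 ≤ ∫ t, extendZero P.tf (fun t => ‖X.γ i (A.r i + 1) t‖ ^ 2) t :=
    integral_nonneg fun t => extendZero_nonneg (fun _ => sq_nonneg _) t
  have h3 : 0 ≤ ∫ t, extendZero P.tf (fun t => ‖X.Φ i (A.r i + 1) t‖ ^ 2) t :=
    integral_nonneg fun t => extendZero_nonneg (fun _ => sq_nonneg _) t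
  positivity

theorem _root_.DGiT.RegularSolution.size_nonneg (X : RegularSolution S P A) : 0 ≤ X.size :=
  Finset.sum_nonneg fun i _ => X.size_term_nonneg i

theorem sum_integral_windows_le {W : ℕ → ℝ → S.HΓ} {k : ℕ} (hW : WeakDerivs P.tf k W) :
    ∑ w ∈ Finset.Icc N₀ Z.G.N, ∫ t in (Z.wl w)..(Z.wr w),
      extendZero P.tf (fun t => ‖W k t‖ ^ 2) t ≤
      ∫ t, extendZero P.tf (fun t => ‖W k t‖ ^ 2) t := by
  have h0 : ∀ t, 0 ≤ extendZero P.tf (fun t => ‖W k t‖ ^ 2) t :=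
    extendZero_nonneg fun _ => sq_nonneg _
  have h1 := sum_integral_overlapping_le
    (integrable_extendZero P.tf_pos.le (hW.norm_sq k le_rfl)) h0 Z.dt_pos.le Z.G.N 1
  rw [Nat.cast_one, one_mul] at h1
  refine le_trans ?_ h1
  refine (Finset.sum_le_sum_of_subset_of_nonneg (Finset.Icc_subset_Icc_left Z.one_le)
    fun w _ _ => intervalIntegral.integral_nonneg (Z.wl_lt_wr w).le fun t _ => h0 t).trans ?_
  rw [sum_Icc_one_eq_range]
  refine le_of_eq (Finset.sum_congr rfl fun k _ => ?_)
  simp only [wl, wr, Nat.cast_add, Nat.cast_one]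

/-- The look-back intervals of consecutive substeps overlap `reach` times. -/
theorem sum_o_le (i : Fin 2) : ∑ w ∈ Finset.Icc N₀ Z.G.N, ∑ m ∈ Finset.Icc 1 (Z.G.M i),
    Z.o i (Z.G.idx i w m) ≤ A.reach * ∫ t, X.ω i t := by
  refine (sum_windows_le Z.one_le (f := Z.o i) (Z.o_nonneg i)).trans ?_
  refine le_trans (le_of_eq ?_) (sum_integral_overlapping_le
    (integrable_extendZero P.tf_pos.le (X.intervalIntegrable_density i))
    (extendZero_nonneg (X.density_nonneg i)) (Z.h_pos i).le (Z.G.N * Z.G.M i) A.reach)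
  refine Finset.sum_congr rfl fun j _ => ?_
  simp only [o, h, Nat.cast_add, Nat.cast_one]
  rfl

/-- Each squared step size power is at most the square of the sum of all of them. What remains are
sums of local integrals, bounded by global ones. -/
theorem sum_defect_le : ∑ w ∈ Finset.Icc N₀ Z.G.N, ∑ i, Z.defect i w ≤
    (√X.size * ∑ i, (Z.G.dts P.tf i ^ (A.q + 1) + Z.G.dt P.tf ^ (A.r i + 1))) ^ 2 := by
  have hd : ∀ i, 0 ≤ Z.G.dts P.tf i := fun i => (Z.G.dts_pos P.tf_pos i).le
  have hdt := Z.dt_pos.le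
  set ε : Fin 2 → ℝ := fun i => Z.G.dts P.tf i ^ (A.q + 1) + Z.G.dt P.tf ^ (A.r i + 1) with hε
  have hε0 : ∀ i, 0 ≤ ε i := fun i => by have := hd i; positivity
  have h1 : ∀ i, ∑ w ∈ Finset.Icc N₀ Z.G.N, Z.defect i w ≤ (∑ i, ε i) ^ 2 *
      (A.reach * (∫ t, X.ω i t) +
      ((∫ t, extendZero P.tf (fun t => ‖X.γ i (A.r i + 1) t‖ ^ 2) t) +
        ∫ t, extendZero P.tf (fun t => ‖X.Φ i (A.r i + 1) t‖ ^ 2) t)) := by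
    intro i
    have hdi := hd i
    have hεi : ε i ≤ ∑ i, ε i := Finset.single_le_sum (fun i _ => hε0 i) (Finset.mem_univ i)
    have ha : Z.h i ^ (2 * A.q + 2) ≤ (∑ i, ε i) ^ 2 := by
      have : Z.h i ^ (2 * A.q + 2) = (Z.G.dts P.tf i ^ (A.q + 1)) ^ 2 := by
        rw [← pow_mul, h]; ring
      rw [this]
      refine pow_le_pow_left₀ (by positivity) (le_trans ?_ hεi) 2
      exact le_add_of_nonneg_right (by positivity)
    have hb : Z.G.dt P.tf ^ (2 * A.r i + 2) ≤ (∑ i, ε i) ^ 2 := by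
      have : Z.G.dt P.tf ^ (2 * A.r i + 2) = (Z.G.dt P.tf ^ (A.r i + 1)) ^ 2 := by
        rw [← pow_mul]; ring
      rw [this]
      refine pow_le_pow_left₀ (by positivity) (le_trans ?_ hεi) 2
      exact le_add_of_nonneg_left (by positivity)
    unfold defect
    rw [Finset.sum_add_distrib, ← Finset.mul_sum, ← Finset.mul_sum, Finset.sum_add_distrib,
      mul_add ((∑ i, ε i) ^ 2)]
    have h2 : 0 ≤ ∑ w ∈ Finset.Icc N₀ Z.G.N, ∑ m ∈ Finset.Icc 1 (Z.G.M i),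
      Z.o i (Z.G.idx i w m) :=
      Finset.sum_nonneg fun w _ => Finset.sum_nonneg fun m _ => Z.o_nonneg _ _
    have h3 : 0 ≤ ∑ w ∈ Finset.Icc N₀ Z.G.N, Z.JΓ i w :=
      Finset.sum_nonneg fun w _ => Z.JΓ_nonneg i w
    have h4 : 0 ≤ ∑ w ∈ Finset.Icc N₀ Z.G.N, Z.JF i w :=
      Finset.sum_nonneg fun w _ => Z.JF_nonneg i w
    exact add_le_add (mul_le_mul ha (Z.sum_o_le i) h2 (sq_nonneg _))
      (mul_le_mul hb (add_le_add (Z.sum_integral_windows_le (X.weakDerivs_γ i))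
        (Z.sum_integral_windows_le (X.weakDerivs_Φ i))) (add_nonneg h3 h4) (sq_nonneg _))
  rw [Finset.sum_comm, mul_pow, Real.sq_sqrt X.size_nonneg, mul_comm, RegularSolution.size,
    Finset.mul_sum]
  exact Finset.sum_le_sum fun i _ => h1 i

/-- All constants are chosen before the run, which makes them independent of the grid and of the
discrete solution. -/
theorem exists_error_bound (hA : A.Unisolvent) (X : RegularSolution S P A) (N₀ : ℕ) (K : ℝ) :
    ∃ C > 0, ∃ δ > 0, ∀ Z : Run X N₀ K, Z.G.dt P.tf ≤ δ → ∀ B, 0 ≤ B →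
      Z.maxSideError (N₀ - 1) ≤ B → ∀ w ∈ Icc N₀ Z.G.N,
      Z.maxSideError w ≤ C * (B + √X.size *
        ∑ i, (Z.G.dts P.tf i ^ (A.q + 1) + Z.G.dt P.tf ^ (A.r i + 1))) ∧
      Z.stateSq w ≤ (C * (B + √X.size *
        ∑ i, (Z.G.dts P.tf i ^ (A.q + 1) + Z.G.dt P.tf ^ (A.r i + 1)))) ^ 2 := by
  obtain ⟨C, hC, hCA⟩ := hA.exists_stableWith
  obtain ⟨c, hc⟩ := exists_formBound S P
  have hK0 : 0 ≤ A.consFactor K := by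
    unfold TimeScheme.consFactor; positivity
  set C₁ := 4 * (C * (A.q + 2 + A.dsum) + 1) ^ 2 with hC₁
  have hC₁0 : 0 ≤ C₁ := by positivity
  set C₂ := 8 * (∑ i, ∑ j, P.b i j ^ 2) * (4 * c ^ 2 + 6) + 6 with hC₂
  have hC₂0 : 0 ≤ C₂ := by positivity
  -- One constant for the three inequalities that `window_gronwall` requires; each summand serves
  -- one of them.
  set C₃ := C₁ * (2 + 2 * c ^ 2 + A.consFactor K) + C₂ + 4 * c ^ 2 with hC₃
  have hC₃0 : 0 ≤ C₃ := by positivity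
  obtain ⟨C', hC', δ, hδ, hbound⟩ := window_gronwall hC₃0 P.tf_pos
  refine ⟨C', hC', δ, hδ, fun Z hdt B hB hstart => ?_⟩
  have hdt0 := Z.dt_pos.le
  refine hbound Z.G.N Z.G.N_pos hdt N₀ Z.one_le Z.maxSideError Z.stateSq Z.fluxSq
    (fun w => ∑ i, Z.defect i w) B _ hB ?_ Z.maxSideError_nonneg Z.stateSq_nonneg
    (fun w => Finset.sum_nonneg fun i _ => Z.defect_nonneg i w) hstart ?_ ?_ ?_ Z.sum_defect_le
  · refine mul_nonneg (Real.sqrt_nonneg _) (Finset.sum_nonneg fun i _ => ?_)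
    have := (Z.G.dts_pos P.tf_pos i).le
    positivity
  · intro w hw
    have h1 := Z.stateSq_le hC hCA hc hw
    have hD : 0 ≤ ∑ i, Z.defect i w := Finset.sum_nonneg fun i _ => Z.defect_nonneg i w
    have he := Z.stateSq_nonneg w
    have hf : 0 ≤ Z.fluxSq w := Finset.sum_nonneg fun i _ => Z.fl_nonneg i w
    change _ ≤ C₃ * (Z.G.dt P.tf * _ + Z.G.dt P.tf ^ 2 * _ + _)
    have hle : C₁ * (2 + 2 * c ^ 2 + A.consFactor K) ≤ C₃ := by
      rw [hC₃]; have : 0 ≤ c ^ 2 := sq_nonneg c; linarith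
    have hx : 0 ≤ Z.G.dt P.tf * Z.maxSideError w ^ 2 := by positivity
    have hy : 0 ≤ Z.G.dt P.tf ^ 2 * (Z.stateSq w + Z.fluxSq w) := by positivity
    set x := Z.G.dt P.tf * Z.maxSideError w ^ 2
    set y := Z.G.dt P.tf ^ 2 * (Z.stateSq w + Z.fluxSq w) with hydef
    set D := ∑ i, Z.defect i w
    have hrw : Z.G.dt P.tf ^ 2 * (2 * c ^ 2 * (Z.stateSq w + Z.fluxSq w)) = 2 * c ^ 2 * y := by
      rw [hydef]; ring
    rw [hrw] at h1
    calc Z.stateSq w ≤ C₁ * (2 * x + 2 * c ^ 2 * y + A.consFactor K * D) := h1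
      _ ≤ C₁ * ((2 + 2 * c ^ 2 + A.consFactor K) * (x + y + D)) := by
        refine mul_le_mul_of_nonneg_left ?_ hC₁0
        have := sq_nonneg c
        nlinarith [mul_nonneg this hx, mul_nonneg this hD, mul_nonneg hK0 hx, mul_nonneg hK0 hy]
      _ = C₁ * (2 + 2 * c ^ 2 + A.consFactor K) * (x + y + D) := by ring
      _ ≤ C₃ * (x + y + D) := by gcongr
  · intro w hw
    have hD : 0 ≤ ∑ i, Z.defect i w := Finset.sum_nonneg fun i _ => Z.defect_nonneg i w
    refine (Z.fluxSq_le hc hw).trans (mul_le_mul_of_nonneg_right ?_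
      (add_nonneg (Z.stateSq_nonneg w) hD))
    have : 0 ≤ C₁ * (2 + 2 * c ^ 2 + A.consFactor K) := by positivity
    have := sq_nonneg c
    linarith
  · intro w hw
    obtain ⟨y, hy1, hy2⟩ := Z.exists_maxSideError_le hc hw
    have hf : 0 ≤ Z.fluxSq w := Finset.sum_nonneg fun i _ => Z.fl_nonneg i w
    refine ⟨y, hy1, hy2.trans (mul_le_mul_of_nonneg_right ?_
      (mul_nonneg hdt0 (add_nonneg (Z.stateSq_nonneg w) hf)))⟩
    have : 0 ≤ C₁ * (2 + 2 * c ^ 2 + A.consFactor K) := by positivity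
    linarith

/-! ### Return from the Hilbert spaces to functions, and the initial errors -/

theorem uH_sub_ofFun (i : Fin 2) {t : ℝ} (ht : t ∈ Icc 0 P.tf) {v : (Fin (n + 1) → ℝ) → ℝ}
    (hv : v ∈ S.U i) : ‖X.uH i t - L2Sub.ofFun _ v‖ = nrm (Ω n i) (X.u i t - v) := by
  rw [L2Sub.norm_eq, map_sub, RegularSolution.uH, L2Sub.coe_ofFun _ (X.sol.u_mem i t ht),
    L2Sub.coe_ofFun _ hv]

theorem norm_E_eq {i : Fin 2} {j : ℕ} (hj : j ≤ Z.G.N * Z.G.M i) :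
    ‖Z.E i j‖ = nrm (Ω n i) (X.u i (j * Z.G.dts P.tf i) - Z.Y.sv i j) :=
  uH_sub_ofFun i ⟨mul_nonneg (Nat.cast_nonneg _) (Z.G.dts_pos P.tf_pos i).le,
    Z.G.time_le P.tf_pos hj⟩ (Z.sol.sv_mem i j hj)

theorem sideError_eq {i : Fin 2} {w m : ℕ} (hw : w ∈ Icc 1 Z.G.N) (hm : m ∈ Icc 1 (Z.G.M i)) :
    sideError P Z.G X.u Z.Y i w m = ‖Z.E i (Z.G.idx i w m)‖ :=
  (Z.norm_E_eq ((Z.G.idx_le hw.1 hm.2).trans (Nat.mul_le_mul_right _ hw.2))).symm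

theorem stateError_eq {w : ℕ} (hw : w ∈ Icc N₀ Z.G.N) :
    stateError P Z.G X.u Z.Y w = √(Z.stateSq w) := by
  unfold stateError stateSq
  congr 1
  refine Finset.sum_congr rfl fun i _ => Finset.sum_congr rfl fun m hm => ?_
  have hm' := Finset.mem_Icc.1 hm
  obtain ⟨hl, hr, hlr⟩ := Z.step_mem hw hm'
  refine intervalIntegral.integral_congr fun t ht => ?_
  have ht' := uIcc_subset_Icc hl hr ht
  change _ = ‖Z.e i (Z.G.idx i w m) t‖ ^ 2
  rw [e, y, uH_sub_ofFun i ht' (polyInTime.mem (Z.u_mem hw hm') t)]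

/-- Every side value up to the end of window `N₀ - 1` is the initial one or belongs to a window
before `N₀`, and a single term is at most the root of the sum of squares. -/
theorem maxSideError_start_le (hN : N₀ ≤ Z.G.N) {p : ℝ}
    (h : AccurateStart P Z.G N₀ K p X.u Z.Y) :
    Z.maxSideError (N₀ - 1) ≤ |K| * Z.G.dt P.tf ^ p := by
  have hK : K * Z.G.dt P.tf ^ p ≤ |K| * Z.G.dt P.tf ^ p :=
    mul_le_mul_of_nonneg_right (le_abs_self K) (Real.rpow_nonneg Z.dt_pos.le _)
  refine Z.maxSideError_le fun i j hj => le_trans ?_ hK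
  have hM := Z.G.M_pos i
  have hjN : j ≤ Z.G.N * Z.G.M i :=
    hj.trans (Nat.mul_le_mul_right _ ((Nat.sub_le _ _).trans hN))
  rcases Nat.eq_zero_or_pos j with rfl | hj0
  · refine le_trans (Real.le_sqrt_of_sq_le ?_) h.initial
    rw [Z.norm_E_eq hjN, Nat.cast_zero, zero_mul]
    exact Finset.single_le_sum (f := fun i => nrm (Ω n i) (X.u i 0 - Z.Y.sv i 0) ^ 2)
      (fun i _ => sq_nonneg _) (Finset.mem_univ i)
  -- Division of `j - 1` by `M i`; the shift by one places the last substep of a window in that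
  -- window rather than in the next.
  · obtain ⟨v, m, hm, hidx, hvN⟩ : ∃ v m, m ∈ Icc 1 (Z.G.M i) ∧ Z.G.idx i (v + 1) m = j ∧
        v + 1 < N₀ := by
      have h1 := Nat.div_add_mod' (j - 1) (Z.G.M i)
      have h2 : (j - 1) / Z.G.M i < N₀ - 1 :=
        Nat.div_lt_of_lt_mul (by rw [mul_comm]; omega)
      refine ⟨(j - 1) / Z.G.M i, (j - 1) % Z.G.M i + 1, ⟨Nat.le_add_left _ _,
        Nat.mod_lt _ hM⟩, ?_, Nat.add_lt_of_lt_sub h2⟩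
      simp only [TimeGrid.idx, Nat.add_sub_cancel]
      rw [← add_assoc, h1]
      omega
    refine le_trans (Real.le_sqrt_of_sq_le ?_) (h.side (v + 1) ⟨by omega, hvN⟩ (by omega))
    have h1 : ‖Z.E i j‖ = sideError P Z.G X.u Z.Y i (v + 1) m := by
      rw [Z.sideError_eq ⟨by omega, by omega⟩ hm, hidx]
    rw [h1]
    refine (Finset.single_le_sum (f := fun m => sideError P Z.G X.u Z.Y i (v + 1) m ^ 2)
      (fun m _ => sq_nonneg _) (Finset.mem_Icc.2 hm)).trans ?_
    exact Finset.single_le_sum (f := fun i => ∑ m ∈ Finset.Icc 1 (Z.G.M i),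
      sideError P Z.G X.u Z.Y i (v + 1) m ^ 2)
      (fun i _ => Finset.sum_nonneg fun m _ => sq_nonneg _) (Finset.mem_univ i)

end Run

end DGiT

end

/-! ### The convergence theorem -/

theorem theorem5p6 {n : ℕ} (hn : n = 1 ∨ n = 2)
    (S : DGiT.SpatialMesh n) (P : DGiT.ModelProblem n)
    (A : DGiT.TimeScheme) (hA : A.Unisolvent)
    (u : Fin 2 → ℝ → (Fin (n + 1) → ℝ) → ℝ) (F : Fin 2 → ℝ → (Fin n → ℝ) → ℝ)
    (hsol : DGiT.IsSemiDiscreteSolution S P u F)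
    (Du : Fin 2 → ℕ → ℝ → (Fin (n + 1) → ℝ) → ℝ)
    (hu : ∀ i, DGiT.HasTimeDerivatives (DGiT.Ω n i) (S.U i) P.tf (A.q + 1) (u i) (Du i))
    (huΓ : ∀ i, ∃ w, DGiT.HasTimeDerivatives (DGiT.Gam n) S.UΓ P.tf (A.r i + 1)
      (fun t => DGiT.trace (u i t)) w)
    (hF : ∀ i, ∃ w, DGiT.HasTimeDerivatives (DGiT.Gam n) S.UΓ P.tf (A.r i + 1) (F i) w)
    (N₀ : ℕ) (hN₀ : 1 ≤ N₀) (p : ℝ) (hp : 0 < p) (K : ℝ) :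
    ∃ Ch > 0, ∃ δ > 0, ∀ G : DGiT.TimeGrid, G.dt P.tf ≤ δ →
      DGiT.LateStart A G N₀ → DGiT.ConsistentSide P A G N₀ K u Du →
      ∀ Y : DGiT.DiscreteApprox n, DGiT.IsDGiTSolution S P A G N₀ Y →
      DGiT.AccurateStart P G N₀ K p u Y →
      ∀ w ∈ Set.Icc N₀ G.N,
        (∀ i, ∀ m ∈ Set.Icc 1 (G.M i),
          DGiT.sideError P G u Y i w m ≤ Ch * DGiT.rate P A G p) ∧
        DGiT.stateError P G u Y w ≤ Ch * DGiT.rate P A G p := by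
  choose DΓ hΓ using huΓ
  choose DF hDF using hF
  let X : DGiT.RegularSolution S P A := ⟨u, F, hsol, Du, hu, DΓ, hΓ, DF, hDF⟩
  obtain ⟨C, hC, δ, hδ, hbound⟩ := DGiT.Run.exists_error_bound hA X N₀ K
  -- `|K|` accounts for the initialization, `√X.size` for the consistency errors, and the summand 1
  -- keeps the constant positive.
  refine ⟨C * (|K| + √X.size + 1), by positivity, δ, hδ, ?_⟩
  intro G hdt hlate hcons Y hY hstart w hw
  let Z : DGiT.Run X N₀ K := ⟨hN₀, G, hlate, hcons, Y, hY⟩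
  have hdt0 : 0 < G.dt P.tf := Z.dt_pos
  have hp0 : 0 ≤ G.dt P.tf ^ p := Real.rpow_nonneg hdt0.le _
  obtain ⟨h1, h2⟩ := hbound Z hdt _ (mul_nonneg (abs_nonneg K) hp0)
    (Z.maxSideError_start_le (hw.1.trans hw.2) hstart) w hw
  have hε : 0 ≤ ∑ i, (G.dts P.tf i ^ (A.q + 1) + G.dt P.tf ^ (A.r i + 1)) :=
    Finset.sum_nonneg fun i _ => by
      have := (G.dts_pos P.tf_pos i).le
      positivity
  have h3 : C * (|K| * G.dt P.tf ^ p +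
      √X.size * ∑ i, (G.dts P.tf i ^ (A.q + 1) + G.dt P.tf ^ (A.r i + 1))) ≤
      C * (|K| + √X.size + 1) * DGiT.rate P A G p := by
    rw [mul_assoc, DGiT.rate]
    refine mul_le_mul_of_nonneg_left ?_ hC.le
    nlinarith [mul_nonneg (abs_nonneg K) hε, mul_nonneg (Real.sqrt_nonneg X.size) hp0]
  refine ⟨fun i m hm => ?_, ?_⟩
  · have h4 := Z.sideError_eq (i := i) (m := m) (Z.window_mem hw) hm
    refine (le_of_eq h4).trans (le_trans ?_ (h1.trans h3))
    exact Z.norm_E_le_maxSideError (G.idx_le (Z.window_mem hw).1 hm.2)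
  · refine (le_of_eq (Z.stateError_eq hw)).trans (le_trans ?_ h3)
    refine Real.sqrt_le_iff.2 ⟨?_, h2⟩
    have := mul_nonneg (abs_nonneg K) hp0
    have := mul_nonneg (Real.sqrt_nonneg X.size) hε
    exact mul_nonneg hC.le (by linarith)
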